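/- **Theorem (performance bound for S³Q-learning).** *Setting.* Consider a finite-horizon MDP with stages $h=1,\dots,H$ ($H\ge1$), a measurable state space $\mathcal S$, a finite action set $\mathcal A$, starting distribution $\rho$, transition laws $P_h(\cdot\mid s,a)$ and random rewards with laws $R_h(s,a)$ supported in $[-1,1]$ and means $r_h(s,a)$, and measurable features $\phi_h:\mathcal S\times\mathcal A\to\mathbb R^d$ ($d\ge1$) with $\|\phi_h(s,a)\|_2\le1$. Policies are deterministic: $\bar\pi=(\bar\pi_1,\dots,\bar\pi_H)$ with $\bar\pi_h:\mathcal S\to\mathcal A$ measurable. Write $(\mathcal T_hQ)(s,a)=r_h(s,a)+\mathbb E_{s'\sim P_h(\cdot\mid s,a)}\max_{a'}Q(s',a')$, and let $\mathcal Q^{\rm lin}$ be the class of all $Q=(Q_1,\dots,Q_{H+1})$ with $Q_h=\langle\phi_h,\theta_h\rangle$, $\|\theta_h\|_2\le1$ for $h\le H$ and $Q_{H+1}=0$. Let $\pi$ be a fixed (possibly randomized) Markov controller, and for $Q\in\mathcal Q^{\rm lin}$ let $$\theta^{\pi}_h(Q_{h+1})\in\arg\min_{\|\theta\|_2\le1}\mathbb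 E_{\pi}\big(\langle\phi_h(S_h,A_h),\theta\rangle-(\mathcal T_hQ_{h+1})(S_h,A_h)\big)^2$$ be any fixed choice of minimizers. Suppose that the MDP is $\varepsilon$-misspecified with respect to Bellman closure: for every policy $\bar\pi$ and every $Q\in\mathcal Q^{\rm lin}$, $$\Big|\sum_{h=1}^H\mathbb E_{\bar\pi}\big[\langle\phi_h(S_h,A_h),\theta^{\pi}_h(Q_{h+1})\rangle-(\mathcal T_hQ_{h+1})(S_h,A_h)\big]\Big|\le\varepsilon .$$ *Algorithm* (regularization $\lambda>0$, no bonus). Trajectories are drawn independently with $\pi$. In epoch $e=1,2,\dots$, for the levels $\ell=H,H-1,\dots,1$ in this order: set $\hat\theta_\ell=0$, $\Sigma_\ell=\lambda I$; play $2^e$ trajectories, and in each of them, for $h=1,\dots,H$, with $\phi_h=\phi_h(s_h,a_h)$ and $\eta_h=r_h+\max_{a'}Q^{\rm tar}_{h+1}(s_{h+1},a')-\langle\phi_h,\hat\theta_h\rangle$ (where $r_h$ is the observed reward), update $$\hat\theta_h\leftarrow\hat\theta_h+\frac{\Sigma_h^{-1}\phi_h\,\eta_h}{1+\|\phi_h\|^2_{\Sigma_h^{-1}}},\qquad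 \Sigma_h^{-1}\leftarrow\Sigma_h^{-1}-\frac{\Sigma_h^{-1}\phi_h\phi_h^\top\Sigma_h^{-1}}{1+\|\phi_h\|^2_{\Sigma_h^{-1}}};$$ then set $Q^{\rm tar}_\ell=\langle\phi_\ell,\hat\theta^{\rm tar}_\ell\rangle$ with $\hat\theta^{\rm tar}_\ell=\arg\min_{\|\theta\|_2\le1}\|\theta-\hat\theta_\ell\|_{\Sigma_\ell}$. Initially $Q^{\rm tar}=0$, and always $Q^{\rm tar}_{H+1}=0$. At the end of each epoch, $\hat Q\leftarrow Q^{\rm tar}$; when stopped, the algorithm returns $\hat Q$. *Claim.* There is a universal constant $c>0$ such that for every $\delta\in(0,1)$, with probability at least $1-\delta$, for every number $K>2H$ of trajectories after which the algorithm is stopped, the following holds. Let $e_{tot}$ be the number of completed epochs, $n=K/(4H)$, $\delta'=\delta/(2He_{tot}^2d)$, $\Sigma_{\pi,h}=\mathbb E_\pi[\phi_h\phi_h^\top]$, and $$U_h(s,a)=c\Big\{\sqrt{d\log\tfrac{d\,n\,e_{tot}H}{\delta'}}+\sqrt\lambda\Big\}\,\|\phi_h(s,a)\|_{(n\Sigma_{\pi,h}+\lambda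 I)^{-1}} .$$ Then $\hat Q\in\mathcal Q^{\rm lin}$, and: (a) for all $h\in\{1,\dots,H\}$ and all $(s,a)$, with $\mathcal E_h=\hat Q_h-\mathcal T_h\hat Q_{h+1}$ and $\Delta_h=\mathcal T_h\hat Q_{h+1}-\langle\phi_h,\theta^\pi_h(\hat Q_{h+1})\rangle$, $$|\mathcal E_h(s,a)+\Delta_h(s,a)|\le U_h(s,a);$$ (b) with $\hat V_1(s)=\max_a\hat Q_1(s,a)$, for every optimal policy $\pi^\star$ (with value function $V^\star$) and every policy $\bar\pi$ that is greedy, $\bar\pi_h(s)\in\arg\max_a\hat Q_h(s,a)$ for all $h$ and $s$, $$-\mathbb E_{\pi^\star}\sum_{h=1}^HU_h(S_h,A_h)-\varepsilon\;\le\;\mathbb E_{S\sim\rho}(\hat V_1-V_1^\star)(S)\;\le\;\mathbb E_{\bar\pi}\sum_{h=1}^HU_h(S_h,A_h)+\varepsilon .$$ Furthermore, the algorithm has memory complexity $O(d^2H)$ and per-step computational complexity $O(d^2+|\mathcal A|d)$: there are one program, independent of the instance, for a unit-cost machine with index registers and arrays of reals, and a universal constant $C$, such that on every stream of trajectories, for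 every $K$, the program holds the parameters of the algorithm's $\hat Q$ after $K$ trajectories, has accessed at most $C\,d^2H$ memory cells, and executes at most $C(d^2+|\mathcal A|d)$ instructions in each time step $h$ of each trajectory. (One coordinate of a feature vector is read per instruction; the projection at the end of a level, which is not part of a time step, is delegated to an external solver.) -/

import Mathlib

open MeasureTheory ProbabilityTheory
open scoped Matrix

noncomputable section

/-- Maximum of a function over a finite non-empty set of actions. -/
def maxOver {A : Type*} [Fintype A] [Nonempty A] (f : A → ℝ) : ℝ :=
  Finset.univ.sup' Finset.univ_nonempty f

/-- The quadratic form `xᵀ M x`. -/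
def quadForm {d : ℕ} (M : Matrix (Fin d) (Fin d) ℝ) (x : EuclideanSpace ℝ (Fin d)) : ℝ :=
  x.ofLp ⬝ᵥ (M *ᵥ x.ofLp)

/-- The weighted norm `‖x‖_M = √(xᵀ M x)`. -/
def weightedNorm {d : ℕ} (M : Matrix (Fin d) (Fin d) ℝ) (x : EuclideanSpace ℝ (Fin d)) : ℝ :=
  √(quadForm M x)

/-- What is observed in one time step: state, action, reward, next state. -/
abbrev Step (S A : Type*) := S × A × ℝ × S

/-! ### Finite-horizon Markov decision processes -/

/-- The stages are `0, …, H - 1`; the kernels with an index `≥ H` play no role. -/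
structure MDP (S A : Type*) [MeasurableSpace S] [MeasurableSpace A] where
  /-- the horizon -/
  H : ℕ
  /-- the distribution of the random reward at a stage, given state and action -/
  rewardDist : ℕ → Kernel (S × A) ℝ
  /-- the distribution of the next state at a stage, given state and action -/
  trans : ℕ → Kernel (S × A) S
  /-- the distribution of the first state -/
  start : Measure S
  rewardDist_markov : ∀ h, IsMarkovKernel (rewardDist h)
  trans_markov : ∀ h, IsMarkovKernel (trans h)
  start_prob : IsProbabilityMeasure start

/-- A (deterministic, measurable) policy: one map from states to actions for each stage. -/
structure Policy (S A : Type*) [MeasurableSpace S] [MeasurableSpace A] where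
  act : ℕ → S → A
  measurable_act : ∀ h, Measurable (act h)

/-- A policy, seen as a family of kernels. -/
def Policy.kernel {S A : Type*} [MeasurableSpace S] [MeasurableSpace A] (p : Policy S A)
    (h : ℕ) : Kernel S A :=
  Kernel.deterministic (p.act h) (p.measurable_act h)

namespace MDP

variable {S A : Type*} [MeasurableSpace S] [MeasurableSpace A]

/-- The random rewards lie in `[-1, 1]`. -/
def BoundedRewards (M : MDP S A) : Prop :=
  ∀ h < M.H, ∀ s a, ∀ᵐ x ∂(M.rewardDist h (s, a)), |x| ≤ 1

/-- The mean reward `r_h(s, a)`. -/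
def meanReward (M : MDP S A) (h : ℕ) (s : S) (a : A) : ℝ :=
  ∫ x, x ∂(M.rewardDist h (s, a))

/-- Law of `(s, a, r, s')` at stage `h`, from the state `s`, when the action is drawn from the
controller `κ`. -/
def stepKernel (M : MDP S A) (κ : ℕ → Kernel S A) (h : ℕ) : Kernel S (Step S A) :=
  Kernel.id ×ₖ (κ h ⊗ₖ (M.rewardDist h ×ₖ M.trans h))

/-- Law of the `n` time steps `h, h + 1, …, h + n - 1`, from a given state at stage `h`, when the
actions are drawn from the controller `κ`. -/
def rollout (M : MDP S A) (κ : ℕ → Kernel S A) : (n h : ℕ) → Kernel S (Fin n → Step S A)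
  | 0, _ => Kernel.deterministic (fun _ => Fin.elim0) measurable_const
  | n + 1, h =>
    (M.stepKernel κ h ⊗ₖ
      (M.rollout κ n (h + 1)).comap (fun p : S × Step S A => p.2.2.2.2) (by fun_prop)).map
      (fun p => Fin.cons p.1 p.2)

/-- Law of a whole trajectory: the first state is drawn from the starting distribution. -/
def trajLaw (M : MDP S A) (κ : ℕ → Kernel S A) : Measure (Fin M.H → Step S A) :=
  M.start.bind (M.rollout κ M.H 0)

/-- `E_κ [∑_h f_h(S_h, A_h)]`. -/
def expSum (M : MDP S A) (κ : ℕ → Kernel S A) (f : ℕ → S → A → ℝ) : ℝ :=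
  ∫ τ, ∑ h : Fin M.H, f h (τ h).1 (τ h).2.1 ∂(M.trajLaw κ)

/-- The value function `V^π_h`. -/
def value (M : MDP S A) (p : Policy S A) (h : ℕ) (s : S) : ℝ :=
  ∫ τ, ∑ i : Fin (M.H - h), M.meanReward (h + i) (τ i).1 (τ i).2.1
    ∂(M.rollout p.kernel (M.H - h) h s)

/-- The optimal value function `V*_h = sup_π V^π_h`. -/
def optValue (M : MDP S A) (h : ℕ) (s : S) : ℝ :=
  ⨆ p : Policy S A, M.value p h s

/-- An optimal policy attains the optimal value at all stages and states. -/
def IsOptimal (M : MDP S A) (p : Policy S A) : Prop :=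
  ∀ h < M.H, ∀ s, M.value p h s = M.optValue h s

/-- The Bellman optimality operator
`(T_h Q)(s, a) = r_h(s, a) + E_{s' ∼ P_h(s, a)} max_{a'} Q(s', a')`. -/
def bellman [Fintype A] [Nonempty A] (M : MDP S A) (h : ℕ) (Q : S → A → ℝ) (s : S) (a : A) : ℝ :=
  M.meanReward h s a + ∫ t, maxOver (Q t) ∂(M.trans h (s, a))

end MDP

/-! ### Linear action-value functions -/

/-- A `d`-dimensional feature map for each stage. -/
abbrev Feature (S A : Type*) (d : ℕ) := ℕ → S → A → EuclideanSpace ℝ (Fin d)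

/-- The action-value function `Q_h(s, a) = ⟨φ_h(s, a), θ_h⟩` for the stages `h < H`, and `0` beyond
the horizon. -/
def linQ {S A : Type*} {d : ℕ} (H : ℕ) (φ : Feature S A d) (θ : ℕ → EuclideanSpace ℝ (Fin d))
    (h : ℕ) (s : S) (a : A) : ℝ :=
  if h < H then inner ℝ (φ h s a) (θ h) else 0

namespace MDP

variable {S A : Type*} [MeasurableSpace S] [MeasurableSpace A] [Fintype A] [Nonempty A] {d : ℕ}

/-- `θ` minimizes `E_κ (⟨φ_h(S_h, A_h), θ⟩ - (T_h Q)(S_h, A_h))²` over the unit ball. -/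
def IsBestFit (M : MDP S A) (φ : Feature S A d) (κ : ℕ → Kernel S A) (h : Fin M.H)
    (Q : S → A → ℝ) (θ : EuclideanSpace ℝ (Fin d)) : Prop :=
  IsMinOn (fun ϑ : EuclideanSpace ℝ (Fin d) =>
      ∫ τ, (inner ℝ (φ h (τ h).1 (τ h).2.1) ϑ - M.bellman h Q (τ h).1 (τ h).2.1) ^ 2
        ∂(M.trajLaw κ))
    (Metric.closedBall 0 1) θ ∧ θ ∈ Metric.closedBall (0 : EuclideanSpace ℝ (Fin d)) 1

/-- `fit h Q` is a choice of the best fit at stage `h` along `κ`, with the next-stage action-value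
function `Q`, for every `Q` in the linear class (minimizers need not be unique). -/
def IsBestFitRule (M : MDP S A) (φ : Feature S A d) (κ : ℕ → Kernel S A)
    (fit : ℕ → (S → A → ℝ) → EuclideanSpace ℝ (Fin d)) : Prop :=
  ∀ θ : ℕ → EuclideanSpace ℝ (Fin d), (∀ h, ‖θ h‖ ≤ 1) →
    ∀ h : Fin M.H, M.IsBestFit φ κ h (linQ M.H φ θ (h + 1)) (fit h (linQ M.H φ θ (h + 1)))

/-- The `ε`-misspecification with respect to Bellman closure, for the best fits `fit`: along every
policy, the summed errors of the best fits have expectation at most `ε` in absolute value, for all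
next-stage action-value functions in the linear class. -/
def Misspecified (M : MDP S A) (φ : Feature S A d)
    (fit : ℕ → (S → A → ℝ) → EuclideanSpace ℝ (Fin d)) (ε : ℝ) : Prop :=
  ∀ (p : Policy S A) (θ : ℕ → EuclideanSpace ℝ (Fin d)), (∀ h, ‖θ h‖ ≤ 1) →
    |M.expSum p.kernel fun h s a =>
      inner ℝ (φ h s a) (fit h (linQ M.H φ θ (h + 1))) -
        M.bellman h (linQ M.H φ θ (h + 1)) s a| ≤ ε

/-- The second moment matrix `Σ_h = E_κ [φ_h φ_hᵀ]`. -/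
def covariance (M : MDP S A) (φ : Feature S A d) (κ : ℕ → Kernel S A) (h : Fin M.H) :
    Matrix (Fin d) (Fin d) ℝ :=
  Matrix.of fun i j =>
    ∫ τ, φ h (τ h).1 (τ h).2.1 i * φ h (τ h).1 (τ h).2.1 j ∂(M.trajLaw κ)

end MDP

/-! ### The algorithm -/

/-- The projection of `x` to the unit ball in the norm `‖·‖_M`. -/
def projBall {d : ℕ} (M : Matrix (Fin d) (Fin d) ℝ) (x : EuclideanSpace ℝ (Fin d)) :
    EuclideanSpace ℝ (Fin d) :=
  Classical.epsilon fun θ =>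
    ‖θ‖ ≤ 1 ∧ ∀ ϑ : EuclideanSpace ℝ (Fin d), ‖ϑ‖ ≤ 1 → quadForm M (θ - x) ≤ quadForm M (ϑ - x)

/-- The variables of the algorithm. -/
structure S3State (d : ℕ) where
  /-- number of completed epochs; the current epoch is `epochs + 1` -/
  epochs : ℕ
  /-- current level (counted from `0`) -/
  level : ℕ
  /-- number of trajectories played at the current level of the current epoch -/
  count : ℕ
  /-- the network parameters -/
  theta : ℕ → EuclideanSpace ℝ (Fin d)
  /-- the inverses of the empirical covariances -/
  covInv : ℕ → Matrix (Fin d) (Fin d) ℝ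
  /-- parameters of the target networks -/
  target : ℕ → EuclideanSpace ℝ (Fin d)
  /-- parameters of the saved predictor -/
  best : ℕ → EuclideanSpace ℝ (Fin d)

namespace S3State

variable {S A : Type*} {d : ℕ}

/-- Start: all parameters vanish, and the first epoch is at its first level, `H - 1`. -/
def start (d H : ℕ) (lam : ℝ) : S3State d where
  epochs := 0
  level := H - 1
  count := 0
  theta := fun _ => 0
  covInv := fun _ => lam⁻¹ • 1
  target := fun _ => 0
  best := fun _ => 0

/-- A new level begins: its network and covariance are reset. -/
def reset (lam : ℝ) (st : S3State d) : S3State d :=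
  { st with
    theta := Function.update st.theta st.level 0
    covInv := Function.update st.covInv st.level (lam⁻¹ • 1) }

/-- One time step: the temporal difference error, and the second-order update. -/
def update [Fintype A] [Nonempty A] (H : ℕ) (φ : Feature S A d) (h : ℕ) (x : Step S A)
    (st : S3State d) : S3State d :=
  let f : EuclideanSpace ℝ (Fin d) := φ h x.1 x.2.1
  let td : ℝ := x.2.2.1 + maxOver (linQ H φ st.target (h + 1) x.2.2.2) - inner ℝ f (st.theta h)
  let P : Matrix (Fin d) (Fin d) ℝ := st.covInv h
  let den : ℝ := 1 + quadForm P f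
  { st with
    theta := Function.update st.theta h
      (st.theta h + (td / den) • WithLp.toLp 2 (P *ᵥ f.ofLp))
    covInv := Function.update st.covInv h
      (P - den⁻¹ • Matrix.vecMulVec (P *ᵥ f.ofLp) (f.ofLp ᵥ* P)) }

/-- The end of a trajectory: when `2 ^ e` trajectories have been played at this level in epoch `e`,
the target network of the level is updated and the next level begins; after the last level the
target networks are saved and a new epoch begins. -/
def finish (H : ℕ) (st : S3State d) : S3State d :=
  if st.count + 1 < 2 ^ (st.epochs + 1) then { st with count := st.count + 1 }
  else
    let target := Function.update st.target st.level
      (projBall (st.covInv st.level)⁻¹ (st.theta st.level))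
    if st.level = 0 then
      { st with epochs := st.epochs + 1, level := H - 1, count := 0, target := target,
                best := target }
    else { st with level := st.level - 1, count := 0, target := target }

/-- The algorithm plays one trajectory. -/
def trajectory [Fintype A] [Nonempty A] {H : ℕ} (φ : Feature S A d) (lam : ℝ)
    (τ : Fin H → Step S A) (st : S3State d) : S3State d :=
  finish H ((List.finRange H).foldl (fun (st : S3State d) (h : Fin H) => update H φ h (τ h) st)
    (if st.count = 0 then reset lam st else st))

/-- The variables of the algorithm after `K` trajectories of the stream `τ`. -/
def run [Fintype A] [Nonempty A] {H : ℕ} (φ : Feature S A d) (lam : ℝ)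
    (τ : ℕ → Fin H → Step S A) : ℕ → S3State d
  | 0 => start d H lam
  | K + 1 => trajectory φ lam (τ K) (run φ lam τ K)

end S3State

/-! ### The uncertainty function -/

/-- `α(n, δ) = c (√(d log (d n e H / δ)) + √λ)`, for the epoch `e`. -/
def alphaCoeff (c : ℝ) (d e H : ℕ) (lam n δ : ℝ) : ℝ :=
  c * (√(d * Real.log (d * n * e * H / δ)) + √lam)

/-- The uncertainty function after `K` trajectories and `e` completed epochs,
`α(n, δ') ‖φ_h(s, a)‖_{(n Σ_h + λ I)⁻¹}` with `n = K / (4 H)` and `δ' = δ / (2 H e² d)`;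
it is set to `0` beyond the horizon, where it plays no role. -/
def uncertainty {S A : Type*} [MeasurableSpace S] [MeasurableSpace A] {d : ℕ} (M : MDP S A)
    (φ : Feature S A d) (κ : ℕ → Kernel S A) (lam c δ : ℝ) (K e : ℕ)
    (h : ℕ) (s : S) (a : A) : ℝ :=
  let n : ℝ := K / (4 * M.H)
  if hh : h < M.H then
    alphaCoeff c d e M.H lam n (δ / (2 * M.H * e ^ 2 * d)) *
      weightedNorm (n • M.covariance φ κ ⟨h, hh⟩ + lam • (1 : Matrix (Fin d) (Fin d) ℝ))⁻¹ (φ h s a)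
  else 0

/-! ### A machine with real arrays and unit cost -/

/-- The memory cells: registers for natural numbers (indices and counters), arrays of reals with up
to three indices, and two cells that each hold a state of the decision process. -/
inductive Cell where
  | idx (x : ℕ)
  | real (arr i j k : ℕ)
  | cur
  | nxt

/-- The operand `arr[i, j, k]`, where `i`, `j`, `k` are the names of index registers. -/
structure Ref where
  arr : ℕ
  i : ℕ
  j : ℕ
  k : ℕ

/-- A configuration of the machine: the contents of the memory, the number of instructions executed
so far, and the cells accessed so far. -/
structure Mem (S : Type*) where
  idx : ℕ → ℕ
  real : ℕ → ℕ → ℕ → ℕ → ℝ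
  cur : Option S
  nxt : Option S
  time : ℕ
  used : Set Cell

namespace Mem

variable {S : Type*}

def get (σ : Mem S) (p : Ref) : ℝ :=
  σ.real p.arr (σ.idx p.i) (σ.idx p.j) (σ.idx p.k)

def set (σ : Mem S) (p : Ref) (v : ℝ) : Mem S :=
  { σ with
    real := fun arr i j k =>
      if arr = p.arr ∧ i = σ.idx p.i ∧ j = σ.idx p.j ∧ k = σ.idx p.k then v
      else σ.real arr i j k }

def setIdx (σ : Mem S) (x n : ℕ) : Mem S :=
  { σ with idx := Function.update σ.idx x n }

/-- The cells that are accessed by the use of an operand. -/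
def cells (σ : Mem S) (p : Ref) : Set Cell :=
  {Cell.idx p.i, Cell.idx p.j, Cell.idx p.k,
    Cell.real p.arr (σ.idx p.i) (σ.idx p.j) (σ.idx p.k)}

/-- Count one instruction, which accesses the cells in `cs`. -/
def tick (σ : Mem S) (cs : Set Cell) : Mem S :=
  { σ with time := σ.time + 1, used := σ.used ∪ cs }

end Mem

/-- Arithmetic operations on reals. -/
inductive RealOp where
  | add
  | sub
  | mul
  | div
  | max

def RealOp.eval : RealOp → ℝ → ℝ → ℝ
  | .add, x, y => x + y
  | .sub, x, y => x - y
  | .mul, x, y => x * y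
  | .div, x, y => x / y
  | .max, x, y => Max.max x y

/-- The elementary instructions. -/
inductive Instr where
  /-- load a constant into an index register -/
  | iconst (x n : ℕ)
  /-- add two index registers -/
  | iadd (x y z : ℕ)
  /-- truncated difference of two index registers -/
  | isub (x y z : ℕ)
  /-- load an integer constant into a real cell -/
  | rconst (p : Ref) (n : ℤ)
  /-- an arithmetic operation on reals -/
  | rop (op : RealOp) (p q r : Ref)
  /-- load one coordinate of the feature vector of the current (`false`) or the next (`true`) state;
  stage, action and coordinate are given by index registers -/
  | feat (p : Ref) (next : Bool) (h a i : ℕ)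

/-- Execution of an instruction; `F h s a i` is the `i`-th coordinate of the feature vector at stage
`h` of the state `s` and the `a`-th action. -/
def Instr.exec {S : Type*} (F : ℕ → S → ℕ → ℕ → ℝ) : Instr → Mem S → Mem S
  | .iconst x n, σ => (σ.setIdx x n).tick {Cell.idx x}
  | .iadd x y z, σ =>
    (σ.setIdx x (σ.idx y + σ.idx z)).tick {Cell.idx x, Cell.idx y, Cell.idx z}
  | .isub x y z, σ =>
    (σ.setIdx x (σ.idx y - σ.idx z)).tick {Cell.idx x, Cell.idx y, Cell.idx z}
  | .rconst p n, σ => (σ.set p n).tick (σ.cells p)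
  | .rop op p q r, σ =>
    (σ.set p (op.eval (σ.get q) (σ.get r))).tick (σ.cells p ∪ σ.cells q ∪ σ.cells r)
  | .feat p next h a i, σ =>
    (σ.set p (((if next then σ.nxt else σ.cur).map
        fun s => F (σ.idx h) s (σ.idx a) (σ.idx i)).getD 0)).tick
      (σ.cells p ∪ {if next then Cell.nxt else Cell.cur, Cell.idx h, Cell.idx a, Cell.idx i})

/-- Structured programs. Beside loops and branches there is an external solver for the projection to
the unit ball. -/
inductive Code where
  | skip
  | instr (c : Instr)
  | seq (c₁ c₂ : Code)
  /-- execute `c` with register `x` equal to `0, 1, …, n - 1`, where `n` is the initial content of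
  register `y` -/
  | loop (x y : ℕ) (c : Code)
  /-- branch on whether register `x` is less than register `y` -/
  | ifLt (x y : ℕ) (c₁ c₂ : Code)
  /-- `project a b t l`: with `l` the content of register `l`, write to `t[l, ·, 0]` the
  projection of `a[l, ·, 0]` to the unit ball, in the norm given by the inverse of the matrix
  `b[l, ·, ·]` -/
  | project (a b t l : ℕ)

namespace Code

/-- The program does not call the external solver. -/
def SolverFree : Code → Prop
  | skip => True
  | instr _ => True
  | seq c₁ c₂ => c₁.SolverFree ∧ c₂.SolverFree
  | loop _ _ c => c.SolverFree
  | ifLt _ _ c₁ c₂ => c₁.SolverFree ∧ c₂.SolverFree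
  | project _ _ _ _ => False

/-- Execution of a program, in dimension `d` and with the features `F`. -/
def exec {S : Type*} (d : ℕ) (F : ℕ → S → ℕ → ℕ → ℝ) : Code → Mem S → Mem S
  | skip, σ => σ
  | instr c, σ => c.exec F σ
  | seq c₁ c₂, σ => c₂.exec d F (c₁.exec d F σ)
  | loop x y c, σ =>
    (List.range (σ.idx y)).foldl
      (fun σ n => c.exec d F ((σ.setIdx x n).tick {Cell.idx x, Cell.idx y}))
      (σ.tick {Cell.idx y})
  | ifLt x y c₁ c₂, σ =>
    if σ.idx x < σ.idx y then c₁.exec d F (σ.tick {Cell.idx x, Cell.idx y})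
    else c₂.exec d F (σ.tick {Cell.idx x, Cell.idx y})
  | project a b t l, σ =>
    let n := σ.idx l
    let P : Matrix (Fin d) (Fin d) ℝ := Matrix.of fun i j => σ.real b n i j
    let θ := projBall P⁻¹ (WithLp.toLp 2 fun i : Fin d => σ.real a n i 0)
    ({ σ with
        real := fun arr i j k =>
          if hj : j < d then (if arr = t ∧ i = n ∧ k = 0 then θ ⟨j, hj⟩ else σ.real arr i j k)
          else σ.real arr i j k }).tick
      ({Cell.idx l} ∪ {x | ∃ i < d, x = Cell.real a n i 0 ∨ x = Cell.real t n i 0}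
        ∪ {x | ∃ i < d, ∃ j < d, x = Cell.real b n i j})

end Code

/-- A program for a learning algorithm: what it does at the beginning of a trajectory, in each time
step, and at the end of a trajectory, and the array that holds its output. -/
structure Program where
  pre : Code
  step : Code
  post : Code
  out : ℕ

namespace Program

variable {S A : Type*} [Fintype A] {d H : ℕ}

/-- Coordinates of the feature vectors, with the actions numbered from `0`. -/
def featureOracle (φ : Feature S A d) (h : ℕ) (s : S) (a i : ℕ) : ℝ :=
  if ha : a < Fintype.card A then
    if hi : i < d then φ h s ((Fintype.equivFin A).symm ⟨a, ha⟩) ⟨i, hi⟩ else 0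
  else 0

/-- The empty memory, with `d`, `|A|`, `H` in the index registers `0`, `1`, `2` and `λ` in the real
cell `0[0, 0, 0]`. -/
def boot (S : Type*) (d nA H : ℕ) (lam : ℝ) : Mem S where
  idx := fun x => if x = 0 then d else if x = 1 then nA else if x = 2 then H else 0
  real := fun arr i j k => if arr = 0 ∧ i = 0 ∧ j = 0 ∧ k = 0 then lam else 0
  cur := none
  nxt := none
  time := 0
  used := {Cell.idx 0, Cell.idx 1, Cell.idx 2, Cell.real 0 0 0 0}

/-- The environment delivers the data of time step `h`: the states, the stage and the number of the
action (in the registers `3` and `4`), and the reward (in the real cell `1[0, 0, 0]`). -/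
def deliver (h : ℕ) (x : Step S A) (σ : Mem S) : Mem S :=
  { σ with
    idx := Function.update (Function.update σ.idx 3 h) 4 (Fintype.equivFin A x.2.1)
    real := fun arr i j k => if arr = 1 ∧ i = 0 ∧ j = 0 ∧ k = 0 then x.2.2.1 else σ.real arr i j k
    cur := some x.1
    nxt := some x.2.2.2
    used := σ.used ∪ {Cell.idx 3, Cell.idx 4, Cell.real 1 0 0 0, Cell.cur, Cell.nxt} }

/-- The configuration after the first `n` time steps of the trajectory `τ`. -/
def steps (P : Program) (φ : Feature S A d) (τ : Fin H → Step S A) (σ : Mem S) : ℕ → Mem S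
  | 0 => P.pre.exec d (featureOracle φ) σ
  | n + 1 =>
    if hn : n < H then
      P.step.exec d (featureOracle φ) (deliver n (τ ⟨n, hn⟩) (P.steps φ τ σ n))
    else P.steps φ τ σ n

/-- The configuration after `K` trajectories of the stream `τ`. -/
def run (P : Program) (φ : Feature S A d) (lam : ℝ) (τ : ℕ → Fin H → Step S A) : ℕ → Mem S
  | 0 => boot S d (Fintype.card A) H lam
  | K + 1 => P.post.exec d (featureOracle φ) (P.steps φ (τ K) (P.run φ lam τ K) H)

end Program

end

set_option linter.unusedSectionVars false

open scoped ENNReal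

/-! ### Rollouts and the performance decomposition -/

section Rollout

/-! Write `θ_h` for the returned parameters, `Q_h` for the linear functions they define, and `F_h =
⟨φ_h, ϑ_h⟩` for the best fits to the Bellman backups `T_h Q_{h+1}`.

Reduction to a pointwise bound. Unrolling the Bellman recursion along a policy shows that the
expected sum of `Q_h - T_h Q_{h+1}` is at most the predicted value minus the value of the policy,
with equality for greedy policies (`pathSum_bellmanError`). In the splitting `Q - TQ = (Q - F) + (F
- TQ)` the second part sums to at most `ε` in absolute value by the misspecification hypothesis.
Hence `|Q_h - F_h| ≤ U_h` yields both inequalities (`performance_bounds`): the lower one along the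
optimal policy, the upper one along the greedy policy. The same bound is claim (a), since the two
errors there add up to `Q_h - F_h`.

The pointwise bound. By Sherman-Morrison the recursion carries the exact ridge solution for the
current batch, and its projection in the covariance norm minimizes the ridge loss over the unit ball
(`IsRidge.update`, `IsRidge.projBall_le`, `Invariant`). Let `D` be the second moment of `⟨φ, θ - ϑ⟩`
and `N` the batch size. The backup is the conditional mean of the regression target, so convexity of
the ball gives an expected excess loss over `ϑ` of at least `D` (`integral_inner_sq_le_excess`). The
fluctuations cost only `D / 2` per sample plus a logarithmic term `R`
(`integral_exp_excessLoss_le`), while the empirical excess loss is at most `λ` by minimality; thus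
`N D ≤ 2 λ + 2 R` (`covariance_error_le`). The target depends on the next-stage parameter, which
depends on earlier data; a net over this parameter and both predictors makes the concentration
uniform, so no conditioning on the past is needed (`exists_uniform_event`). Batches are fixed index
sets, and a union bound over epochs and levels gives one event for all stopping times. Finally `N`
is comparable with `n`, and Cauchy-Schwarz for `n Σ + λ I` turns the bound on `D` into the bound by
`U`.

Complexity. An explicit program is verified with the triples `Sat`, which track the result, the
accessed cells and the running time. Register `5` is constantly zero; after initialization,
registers `6` to `9` hold the level, the count, the batch size and the constant one. Arrays `0` and
`1` hold `λ` and the observed reward; arrays `2` to `5` hold the networks, inverse covariances,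
targets and saved predictor; arrays `6` to `10` and `12` to `15` are scratch space. The time of a
step is dominated by matrix-vector products, the rank-one update, and one inner product per action.
-/

theorem integral_bind_kernel {X Y : Type*} [MeasurableSpace X] [MeasurableSpace Y]
    (μ : Measure X) [SFinite μ] (κ : Kernel X Y) [IsSFiniteKernel κ] {f : Y → ℝ}
    (hf : Integrable f (μ.bind κ)) : ∫ y, f y ∂(μ.bind κ) = ∫ x, ∫ y, f y ∂(κ x) ∂μ := by
  rw [Measure.comp_eq_comp_const_apply] at hf ⊢
  rw [Kernel.integral_comp hf, Kernel.const_apply]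

variable {S A : Type*} [MeasurableSpace S] [MeasurableSpace A]

namespace MDP

attribute [instance] MDP.rewardDist_markov MDP.trans_markov MDP.start_prob

instance isMarkovKernel_stepKernel (M : MDP S A) (κ : ℕ → Kernel S A)
    [∀ h, IsMarkovKernel (κ h)] (h : ℕ) : IsMarkovKernel (M.stepKernel κ h) := by
  unfold stepKernel; infer_instance

theorem measurable_fin_cons {X : Type*} [MeasurableSpace X] (n : ℕ) :
    Measurable fun p : X × (Fin n → X) => (Fin.cons p.1 p.2 : Fin (n + 1) → X) := by
  refine measurable_pi_iff.2 fun i => ?_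
  refine Fin.cases ?_ (fun j => ?_) i
  · simpa using measurable_fst
  · exact (measurable_pi_apply j).comp measurable_snd

instance isMarkovKernel_rollout (M : MDP S A) (κ : ℕ → Kernel S A)
    [∀ h, IsMarkovKernel (κ h)] : ∀ n h, IsMarkovKernel (M.rollout κ n h)
  | 0, h => by unfold rollout; infer_instance
  | n + 1, h => by
    have := isMarkovKernel_rollout M κ n (h + 1)
    unfold rollout
    exact Kernel.IsMarkovKernel.map _ (measurable_fin_cons n)

instance isProbabilityMeasure_trajLaw (M : MDP S A) (κ : ℕ → Kernel S A)
    [∀ h, IsMarkovKernel (κ h)] : IsProbabilityMeasure (M.trajLaw κ) := by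
  unfold trajLaw; infer_instance

theorem rollout_succ (M : MDP S A) (κ : ℕ → Kernel S A) (n h : ℕ) :
    M.rollout κ (n + 1) h = (M.stepKernel κ h ⊗ₖ
      (M.rollout κ n (h + 1)).comap (fun p : S × Step S A => p.2.2.2.2) (by fun_prop)).map
      (fun p => Fin.cons p.1 p.2) := rfl

theorem lintegral_rollout_succ (M : MDP S A) (κ : ℕ → Kernel S A) [∀ h, IsMarkovKernel (κ h)]
    (n h : ℕ) (s : S) {F : (Fin (n + 1) → Step S A) → ℝ≥0∞} (hF : Measurable F) :
    ∫⁻ τ, F τ ∂(M.rollout κ (n + 1) h s) =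
      ∫⁻ x, ∫⁻ τ, F (Fin.cons x τ) ∂(M.rollout κ n (h + 1) x.2.2.2) ∂(M.stepKernel κ h s) := by
  have hF' : Measurable fun p : Step S A × (Fin n → Step S A) => F (Fin.cons p.1 p.2) :=
    hF.comp (measurable_fin_cons n)
  rw [rollout_succ, Kernel.map_apply _ (measurable_fin_cons n),
    lintegral_map hF (measurable_fin_cons n), Kernel.lintegral_compProd _ _ _ hF']
  simp [Kernel.comap_apply]

theorem integral_rollout_succ (M : MDP S A) (κ : ℕ → Kernel S A) [∀ h, IsMarkovKernel (κ h)]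
    (n h : ℕ) (s : S) {F : (Fin (n + 1) → Step S A) → ℝ} (hF : Measurable F) {C : ℝ}
    (hC : ∀ τ, |F τ| ≤ C) :
    ∫ τ, F τ ∂(M.rollout κ (n + 1) h s) =
      ∫ x, ∫ τ, F (Fin.cons x τ) ∂(M.rollout κ n (h + 1) x.2.2.2) ∂(M.stepKernel κ h s) := by
  rw [rollout_succ, Kernel.map_apply _ (measurable_fin_cons n),
    integral_map (measurable_fin_cons n).aemeasurable hF.aestronglyMeasurable,
    integral_compProd]
  · simp [Kernel.comap_apply]
  · exact Integrable.of_bound (hF.comp (measurable_fin_cons n)).aestronglyMeasurable C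
      (Filter.Eventually.of_forall fun p => hC _)

/-- Law of the reward and the next state. -/
noncomputable def outcome (M : MDP S A) (h : ℕ) : Kernel (S × A) (ℝ × S) :=
  M.rewardDist h ×ₖ M.trans h

instance isMarkovKernel_outcome (M : MDP S A) (h : ℕ) : IsMarkovKernel (M.outcome h) := by
  unfold outcome; infer_instance

theorem lintegral_stepKernel (M : MDP S A) (κ : ℕ → Kernel S A) [∀ h, IsMarkovKernel (κ h)]
    (h : ℕ) (s : S) {F : Step S A → ℝ≥0∞} (hF : Measurable F) :
    ∫⁻ x, F x ∂(M.stepKernel κ h s) =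
      ∫⁻ a, ∫⁻ p, F (s, a, p) ∂(M.outcome h (s, a)) ∂(κ h s) := by
  unfold stepKernel
  rw [Kernel.prod_apply, lintegral_prod _ hF.aemeasurable, Kernel.id_apply, lintegral_dirac']
  · rw [Kernel.lintegral_compProd _ _ _ (by fun_prop)]; rfl
  · exact hF.lintegral_prod_right'

theorem integral_stepKernel (M : MDP S A) (κ : ℕ → Kernel S A) [∀ h, IsMarkovKernel (κ h)]
    (h : ℕ) (s : S) {F : Step S A → ℝ} (hF : Measurable F) {C : ℝ} (hC : ∀ x, |F x| ≤ C) :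
    ∫ x, F x ∂(M.stepKernel κ h s) =
      ∫ a, ∫ p, F (s, a, p) ∂(M.outcome h (s, a)) ∂(κ h s) := by
  unfold stepKernel
  rw [Kernel.prod_apply, integral_prod, Kernel.id_apply, integral_dirac']
  · rw [integral_compProd]
    · rfl
    · exact Integrable.of_bound (hF.comp measurable_prodMk_left).aestronglyMeasurable C
        (Filter.Eventually.of_forall fun p => hC _)
  · exact hF.stronglyMeasurable.integral_prod_right'
  · exact Integrable.of_bound (by fun_prop) C (Filter.Eventually.of_forall fun p => hC _)

theorem measurable_lintegral_outcome (M : MDP S A) (h : ℕ) {F : Step S A → ℝ≥0∞}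
    (hF : Measurable F) :
    Measurable fun x : S × A => ∫⁻ p, F (x.1, x.2, p) ∂(M.outcome h x) :=
  Measurable.lintegral_kernel_prod_right' (f := fun q : (S × A) × (ℝ × S) => F (q.1.1, q.1.2, q.2))
    (hF.comp (by fun_prop))

/-- Given the state and action of a step, its reward and next state follow `outcome`, independently
of how the step was reached. Induction peels off the first step: for `i = 0` this is the structure
of `stepKernel`, and for later steps the shorter rollout starts at stage `h + 1`. -/
theorem lintegral_rollout_apply (M : MDP S A) (κ : ℕ → Kernel S A) [∀ h, IsMarkovKernel (κ h)]
    (n : ℕ) {F : Step S A → ℝ≥0∞} (hF : Measurable F) : ∀ (h : ℕ) (s : S) (i : Fin n),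
    ∫⁻ τ, F (τ i) ∂(M.rollout κ n h s) =
      ∫⁻ τ, ∫⁻ p, F ((τ i).1, (τ i).2.1, p) ∂(M.outcome (h + i) ((τ i).1, (τ i).2.1))
        ∂(M.rollout κ n h s) := by
  induction n with
  | zero => exact fun h s i => i.elim0
  | succ n ih =>
    intro h s i
    have hm : ∀ k, Measurable fun x : Step S A =>
        ∫⁻ p, F (x.1, x.2.1, p) ∂(M.outcome k (x.1, x.2.1)) := fun k =>
      (M.measurable_lintegral_outcome k hF).comp (by fun_prop : Measurable fun x : Step S A =>
        (x.1, x.2.1))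
    have hm' : Measurable fun τ : Fin (n + 1) → Step S A =>
        ∫⁻ p, F ((τ i).1, (τ i).2.1, p) ∂(M.outcome (h + i) ((τ i).1, (τ i).2.1)) :=
      (hm _).comp (measurable_pi_apply i)
    rw [lintegral_rollout_succ _ _ _ _ _ (by fun_prop), lintegral_rollout_succ _ _ _ _ _ hm']
    clear hm'
    refine Fin.cases ?_ (fun j => ?_) i
    · simp only [Fin.cons_zero, lintegral_const, measure_univ, mul_one, Fin.val_zero, add_zero]
      rw [lintegral_stepKernel _ _ _ _ hF, lintegral_stepKernel _ _ _ _ (hm h)]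
      simp
    · simp only [Fin.cons_succ, Fin.val_succ]
      congr 1
      ext x
      rw [ih, show h + 1 + (j : ℕ) = h + (j + 1) by ring]

/-- The law of the time step `h` of a trajectory. -/
noncomputable def stepLaw (M : MDP S A) (κ : ℕ → Kernel S A) (h : Fin M.H) : Measure (Step S A) :=
  (M.trajLaw κ).map fun τ => τ h

instance isProbabilityMeasure_stepLaw (M : MDP S A) (κ : ℕ → Kernel S A)
    [∀ h, IsMarkovKernel (κ h)] (h : Fin M.H) : IsProbabilityMeasure (M.stepLaw κ h) :=
  Measure.isProbabilityMeasure_map (measurable_pi_apply h).aemeasurable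

theorem lintegral_stepLaw (M : MDP S A) (κ : ℕ → Kernel S A) [∀ h, IsMarkovKernel (κ h)]
    (h : Fin M.H) {F : Step S A → ℝ≥0∞} (hF : Measurable F) :
    ∫⁻ x, F x ∂(M.stepLaw κ h) =
      ∫⁻ x, ∫⁻ p, F (x.1, x.2.1, p) ∂(M.outcome h (x.1, x.2.1)) ∂(M.stepLaw κ h) := by
  have hm : Measurable fun x : Step S A =>
      ∫⁻ p, F (x.1, x.2.1, p) ∂(M.outcome h (x.1, x.2.1)) :=
    (M.measurable_lintegral_outcome h hF).comp (by fun_prop : Measurable fun x : Step S A =>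
        (x.1, x.2.1))
  have hm' : Measurable fun τ : Fin M.H → Step S A =>
      ∫⁻ p, F ((τ h).1, (τ h).2.1, p) ∂(M.outcome h ((τ h).1, (τ h).2.1)) :=
    hm.comp (measurable_pi_apply h)
  have hF' : Measurable fun τ : Fin M.H → Step S A => F (τ h) := by fun_prop
  unfold stepLaw trajLaw
  rw [lintegral_map hF (by fun_prop), lintegral_map hm (by fun_prop),
    Measure.lintegral_bind (Kernel.aemeasurable _) hF'.aemeasurable,
    Measure.lintegral_bind (Kernel.aemeasurable _) hm'.aemeasurable]
  congr 1
  ext s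
  simpa using M.lintegral_rollout_apply κ M.H hF 0 s h

/-- The kernel that resamples reward and next state. -/
noncomputable def resample (M : MDP S A) (h : ℕ) : Kernel (Step S A) (Step S A) :=
  (Kernel.deterministic (fun x : Step S A => x.1) (by fun_prop)) ×ₖ
    ((Kernel.deterministic (fun x : Step S A => x.2.1) (by fun_prop)) ×ₖ
      (M.outcome h).comap (fun x : Step S A => (x.1, x.2.1)) (by fun_prop))

instance isMarkovKernel_resample (M : MDP S A) (h : ℕ) : IsMarkovKernel (M.resample h) := by
  unfold resample; infer_instance

theorem resample_apply (M : MDP S A) (h : ℕ) (x : Step S A) :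
    M.resample h x = (M.outcome h (x.1, x.2.1)).map fun p => (x.1, x.2.1, p) := by
  rw [resample, Kernel.prod_apply, Kernel.prod_apply, Kernel.deterministic_apply,
    Kernel.deterministic_apply, Kernel.comap_apply, Measure.dirac_prod, Measure.dirac_prod,
    Measure.map_map (by fun_prop) (by fun_prop)]
  rfl

/-- This replaces conditional expectations given state and action. Invariance under a kernel passes
from nonnegative functions to all integrable functions through the integral formula for composed
kernels. -/
theorem stepLaw_eq_bind (M : MDP S A) (κ : ℕ → Kernel S A) [∀ h, IsMarkovKernel (κ h)]
    (h : Fin M.H) : M.stepLaw κ h = (M.stepLaw κ h).bind (M.resample h) := by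
  refine Measure.ext_of_lintegral _ fun F hF => ?_
  rw [Measure.lintegral_bind (Kernel.aemeasurable _) hF.aemeasurable, lintegral_stepLaw _ _ _ hF]
  congr 1
  ext x
  rw [resample_apply, lintegral_map hF (by fun_prop)]

theorem integral_stepLaw (M : MDP S A) (κ : ℕ → Kernel S A) [∀ h, IsMarkovKernel (κ h)]
    (h : Fin M.H) {F : Step S A → ℝ} (hF : Measurable F) (hi : Integrable F (M.stepLaw κ h)) :
    ∫ x, F x ∂(M.stepLaw κ h) =
      ∫ x, ∫ p, F (x.1, x.2.1, p) ∂(M.outcome h (x.1, x.2.1)) ∂(M.stepLaw κ h) := by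
  conv_lhs => rw [M.stepLaw_eq_bind κ h]
  rw [integral_bind_kernel _ _ (by rwa [← M.stepLaw_eq_bind κ h])]
  congr 1
  ext x
  rw [resample_apply, integral_map (by fun_prop) hF.aestronglyMeasurable]

/-- Resampling expresses the mass of the exceptional set as an average of conditional probabilities,
each of which is zero. -/
theorem ae_stepLaw_reward (M : MDP S A) (hM : M.BoundedRewards) (κ : ℕ → Kernel S A)
    [∀ h, IsMarkovKernel (κ h)] (h : Fin M.H) : ∀ᵐ x ∂(M.stepLaw κ h), |x.2.2.1| ≤ 1 := by
  have hs : MeasurableSet {x : Step S A | |x.2.2.1| ≤ 1}ᶜ :=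
    (measurableSet_le (by fun_prop) measurable_const).compl
  have hi : Measurable ({x : Step S A | |x.2.2.1| ≤ 1}ᶜ.indicator (1 : Step S A → ℝ≥0∞)) :=
    measurable_one.indicator hs
  change M.stepLaw κ h {x : Step S A | |x.2.2.1| ≤ 1}ᶜ = 0
  rw [← lintegral_indicator_one hs, lintegral_stepLaw _ _ _ hi]
  refine (lintegral_congr fun x => ?_).trans lintegral_zero
  have hb := hM h h.2 x.1 x.2.1
  have h0 : ∀ᵐ p ∂(M.outcome h (x.1, x.2.1)), |p.1| ≤ 1 := by
    rw [outcome, Kernel.prod_apply]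
    exact Measure.quasiMeasurePreserving_fst.ae hb
  rw [lintegral_eq_zero_iff' (by
    exact (hi.comp (by fun_prop : Measurable fun p : ℝ × S => (x.1, x.2.1, p))).aemeasurable)]
  filter_upwards [h0] with p hp
  simp [hp]

end MDP

end Rollout

/-! ### Maximum over the actions. -/

section MaxOver

variable {A : Type*} [Fintype A] [Nonempty A]

theorem le_maxOver (f : A → ℝ) (a : A) : f a ≤ maxOver f :=
  Finset.le_sup' f (Finset.mem_univ a)

theorem maxOver_le {f : A → ℝ} {c : ℝ} (h : ∀ a, f a ≤ c) : maxOver f ≤ c :=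
  Finset.sup'_le _ _ fun a _ => h a

/-- Nonexpansiveness of the maximum is the source of the Lipschitz dependence of the regression
targets on the next-stage parameter. -/
theorem abs_maxOver_sub_le {f g : A → ℝ} {c : ℝ} (h : ∀ a, |f a - g a| ≤ c) :
    |maxOver f - maxOver g| ≤ c := by
  rw [abs_sub_le_iff]
  constructor
  · have : maxOver f ≤ c + maxOver g := maxOver_le fun a => by
      have := (abs_sub_le_iff.1 (h a)).1
      have := le_maxOver g a
      linarith
    linarith
  · have : maxOver g ≤ c + maxOver f := maxOver_le fun a => by
      have := (abs_sub_le_iff.1 (h a)).2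
      have := le_maxOver f a
      linarith
    linarith

theorem maxOver_zero : maxOver (fun _ : A => (0 : ℝ)) = 0 := Finset.sup'_const _ _

theorem abs_maxOver_le {f : A → ℝ} {c : ℝ} (h : ∀ a, |f a| ≤ c) : |maxOver f| ≤ c := by
  simpa [maxOver_zero] using abs_maxOver_sub_le (f := f) (g := fun _ => 0) (by simpa using h)

theorem measurable_maxOver {X : Type*} [MeasurableSpace X] {f : X → A → ℝ}
    (hf : ∀ a, Measurable fun x => f x a) : Measurable fun x => maxOver (f x) := by
  have := Finset.measurable_sup' (Finset.univ_nonempty (α := A)) (f := fun a x => f x a)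
    fun a _ => hf a
  convert this using 1
  ext x
  simp [maxOver, Finset.sup'_apply]

end MaxOver

/-! ### Path sums, value functions and the unrolled Bellman recursion. -/

section Decomposition

variable {S A : Type*} [MeasurableSpace S] [MeasurableSpace A]

/-- The functions `f k` with `k < N` are measurable and uniformly bounded. -/
def BddMeasurable (N : ℕ) (f : ℕ → S → A → ℝ) : Prop :=
  ∃ B : ℝ, ∀ k < N, (Measurable fun x : S × A => f k x.1 x.2) ∧ ∀ s a, |f k s a| ≤ B

namespace BddMeasurable

variable {N : ℕ} {f g : ℕ → S → A → ℝ}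

theorem add (hf : BddMeasurable N f) (hg : BddMeasurable N g) :
    BddMeasurable N fun k s a => f k s a + g k s a := by
  obtain ⟨B, hB⟩ := hf
  obtain ⟨C, hC⟩ := hg
  exact ⟨B + C, fun k hk => ⟨(hB k hk).1.add (hC k hk).1, fun s a =>
    (abs_add_le _ _).trans (add_le_add ((hB k hk).2 s a) ((hC k hk).2 s a))⟩⟩

theorem neg (hf : BddMeasurable N f) : BddMeasurable N fun k s a => -f k s a := by
  obtain ⟨B, hB⟩ := hf
  exact ⟨B, fun k hk => ⟨(hB k hk).1.neg, fun s a => by simpa using (hB k hk).2 s a⟩⟩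

theorem sub (hf : BddMeasurable N f) (hg : BddMeasurable N g) :
    BddMeasurable N fun k s a => f k s a - g k s a := by
  simpa [sub_eq_add_neg] using hf.add hg.neg

end BddMeasurable

instance Policy.isMarkovKernel_kernel (p : Policy S A) (h : ℕ) : IsMarkovKernel (p.kernel h) := by
  unfold Policy.kernel; infer_instance

namespace MDP

/-- Expected sum of `f` over the `n` steps from stage `h` on. -/
noncomputable def pathSum (M : MDP S A) (κ : ℕ → Kernel S A) (f : ℕ → S → A → ℝ) (n h : ℕ)
    (s : S) : ℝ :=
  ∫ τ, ∑ i : Fin n, f (h + i) (τ i).1 (τ i).2.1 ∂(M.rollout κ n h s)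

theorem measurable_sum_path {f : ℕ → S → A → ℝ} {n h N : ℕ} (hN : h + n ≤ N)
    (hf : BddMeasurable N f) :
    Measurable fun τ : Fin n → Step S A => ∑ i : Fin n, f (h + i) (τ i).1 (τ i).2.1 := by
  obtain ⟨B, hB⟩ := hf
  refine Finset.measurable_sum _ fun i _ => ?_
  exact (hB (h + i) (by omega)).1.comp
    (by fun_prop : Measurable fun τ : Fin n → Step S A => ((τ i).1, (τ i).2.1))

theorem abs_sum_path_le {f : ℕ → S → A → ℝ} {n h N : ℕ} (hN : h + n ≤ N) {B : ℝ}
    (hB : ∀ k < N, ∀ s a, |f k s a| ≤ B) (τ : Fin n → Step S A) :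
    |∑ i : Fin n, f (h + i) (τ i).1 (τ i).2.1| ≤ n * B := by
  refine (Finset.abs_sum_le_sum_abs _ _).trans ?_
  refine (Finset.sum_le_sum fun (i : Fin n) _ => hB (h + i) (by have := i.2; omega) _ _).trans ?_
  simp

theorem measurable_pathSum (M : MDP S A) (κ : ℕ → Kernel S A) {f : ℕ → S → A → ℝ} {n h N : ℕ}
    (hN : h + n ≤ N) (hf : BddMeasurable N f) : Measurable (M.pathSum κ f n h) :=
  ((measurable_sum_path hN hf).stronglyMeasurable.integral_kernel).measurable

theorem abs_pathSum_le (M : MDP S A) (κ : ℕ → Kernel S A) [∀ h, IsMarkovKernel (κ h)]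
    {f : ℕ → S → A → ℝ} {n h N : ℕ} (hN : h + n ≤ N) {B : ℝ}
    (hB : ∀ k < N, ∀ s a, |f k s a| ≤ B) (s : S) : |M.pathSum κ f n h s| ≤ n * B := by
  have := norm_integral_le_of_norm_le_const (μ := M.rollout κ n h s) (C := n * B)
    (f := fun τ => ∑ i : Fin n, f (h + i) (τ i).1 (τ i).2.1)
    (Filter.Eventually.of_forall fun τ => abs_sum_path_le hN hB τ)
  simpa [pathSum] using this

theorem integral_outcome_snd (M : MDP S A) (h : ℕ) (x : S × A) {g : S → ℝ} (hg : Measurable g) :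
    ∫ p, g p.2 ∂(M.outcome h x) = ∫ t, g t ∂(M.trans h x) := by
  have : (M.outcome h x).map Prod.snd = M.trans h x := by
    rw [outcome, Kernel.prod_apply, Measure.map_snd_prod]; simp
  rw [← this, integral_map (by fun_prop) hg.aestronglyMeasurable]

theorem pathSum_zero (M : MDP S A) (κ : ℕ → Kernel S A) (f : ℕ → S → A → ℝ) (h : ℕ) (s : S) :
    M.pathSum κ f 0 h s = 0 := by
  simp [pathSum]

/-- The Markov property for path sums. For a deterministic policy the average over actions is
evaluation at the chosen action; the reward drawn in the step does not enter. -/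
theorem pathSum_succ [DiscreteMeasurableSpace A] (M : MDP S A) (p : Policy S A)
    {f : ℕ → S → A → ℝ} {n h N : ℕ} (hN : h + (n + 1) ≤ N) (hf : BddMeasurable N f) (s : S) :
    M.pathSum p.kernel f (n + 1) h s = f h s (p.act h s) +
      ∫ t, M.pathSum p.kernel f n (h + 1) t ∂(M.trans h (s, p.act h s)) := by
  have hm := measurable_pathSum M p.kernel (by omega : h + 1 + n ≤ N) hf
  have hms := measurable_sum_path (by omega : h + 1 + n ≤ N) hf
  have hms' := measurable_sum_path (by omega : h + (n + 1) ≤ N) hf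
  obtain ⟨B, hB⟩ := hf
  have hB' : ∀ k < N, ∀ s a, |f k s a| ≤ B := fun k hk => (hB k hk).2
  have hb := abs_pathSum_le M p.kernel (by omega : h + 1 + n ≤ N) hB'
  -- Given the first step, its summand is constant, and the remaining ones form the path sum from
  -- the next state.
  have key : ∀ x : Step S A, ∫ τ, (∑ i : Fin (n + 1), f (h + i)
      ((Fin.cons x τ : Fin (n + 1) → Step S A) i).1
      ((Fin.cons x τ : Fin (n + 1) → Step S A) i).2.1) ∂(M.rollout p.kernel n (h + 1) x.2.2.2) =
      f h x.1 x.2.1 + M.pathSum p.kernel f n (h + 1) x.2.2.2 := by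
    intro x
    simp only [Fin.sum_univ_succ, Fin.cons_zero, Fin.cons_succ, Fin.val_zero, add_zero,
      Fin.val_succ]
    rw [integral_add (integrable_const _)]
    · simp only [integral_const, probReal_univ, smul_eq_mul, one_mul, pathSum, add_comm,
        add_left_comm]
    · refine Integrable.of_bound ?_ (n * B) (Filter.Eventually.of_forall fun τ => ?_)
      · simpa only [add_assoc, add_comm, add_left_comm] using hms.aestronglyMeasurable
      · simpa only [add_assoc, add_comm, add_left_comm, Real.norm_eq_abs] using
          abs_sum_path_le (by omega : h + 1 + n ≤ N) hB' τ
  have hmG : Measurable fun x : Step S A =>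
      f h x.1 x.2.1 + M.pathSum p.kernel f n (h + 1) x.2.2.2 :=
    ((hB h (by omega)).1.comp (by fun_prop : Measurable fun x : Step S A => (x.1, x.2.1))).add
      (hm.comp (by fun_prop))
  rw [pathSum, integral_rollout_succ _ _ _ _ _ hms' (abs_sum_path_le hN hB')]
  simp_rw [key]
  rw [integral_stepKernel _ _ _ _ hmG (C := B + n * B) fun x =>
    (abs_add_le _ _).trans (add_le_add ((hB h (by omega)).2 _ _) (hb _))]
  rw [Policy.kernel, Kernel.deterministic_apply, integral_dirac]
  dsimp only
  rw [integral_add (integrable_const _), integral_outcome_snd _ _ _ hm]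
  · simp
  exact Integrable.of_bound (hm.comp measurable_snd).aestronglyMeasurable (n * B)
    (Filter.Eventually.of_forall fun q => hb _)

theorem expSum_eq (M : MDP S A) (κ : ℕ → Kernel S A) [∀ h, IsMarkovKernel (κ h)]
    {f : ℕ → S → A → ℝ} (hf : BddMeasurable M.H f) :
    M.expSum κ f = ∫ s, M.pathSum κ f M.H 0 s ∂M.start := by
  have hms := measurable_sum_path (by omega : 0 + M.H ≤ M.H) hf
  obtain ⟨B, hB⟩ := hf
  have hb := abs_sum_path_le (by omega : 0 + M.H ≤ M.H) fun k hk => (hB k hk).2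
  simp only [zero_add] at hms hb
  unfold expSum pathSum trajLaw
  rw [integral_bind_kernel]
  · simp
  · exact Integrable.of_bound hms.aestronglyMeasurable (M.H * B)
      (Filter.Eventually.of_forall hb)

theorem integrable_traj_sum (M : MDP S A) (κ : ℕ → Kernel S A) [∀ h, IsMarkovKernel (κ h)]
    {f : ℕ → S → A → ℝ} (hf : BddMeasurable M.H f) :
    Integrable (fun τ : Fin M.H → Step S A => ∑ h : Fin M.H, f h (τ h).1 (τ h).2.1)
      (M.trajLaw κ) := by
  have hms := measurable_sum_path (by omega : 0 + M.H ≤ M.H) hf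
  obtain ⟨B, hB⟩ := hf
  have hb := abs_sum_path_le (by omega : 0 + M.H ≤ M.H) fun k hk => (hB k hk).2
  simp only [zero_add] at hms hb
  exact Integrable.of_bound hms.aestronglyMeasurable (M.H * B) (Filter.Eventually.of_forall hb)

theorem expSum_add (M : MDP S A) (κ : ℕ → Kernel S A) [∀ h, IsMarkovKernel (κ h)]
    {f g : ℕ → S → A → ℝ} (hf : BddMeasurable M.H f) (hg : BddMeasurable M.H g) :
    M.expSum κ (fun h s a => f h s a + g h s a) = M.expSum κ f + M.expSum κ g := by
  unfold expSum
  rw [← integral_add (M.integrable_traj_sum κ hf) (M.integrable_traj_sum κ hg)]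
  simp [Finset.sum_add_distrib]

theorem expSum_mono (M : MDP S A) (κ : ℕ → Kernel S A) [∀ h, IsMarkovKernel (κ h)]
    {f g : ℕ → S → A → ℝ} (hf : BddMeasurable M.H f) (hg : BddMeasurable M.H g)
    (hle : ∀ h < M.H, ∀ s a, f h s a ≤ g h s a) : M.expSum κ f ≤ M.expSum κ g := by
  unfold expSum
  exact integral_mono (M.integrable_traj_sum κ hf) (M.integrable_traj_sum κ hg) fun τ =>
    Finset.sum_le_sum fun h _ => hle h h.2 _ _

theorem expSum_neg (M : MDP S A) (κ : ℕ → Kernel S A) (f : ℕ → S → A → ℝ) :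
    M.expSum κ (fun h s a => -f h s a) = -M.expSum κ f := by
  unfold expSum
  rw [← integral_neg]
  simp [Finset.sum_neg_distrib]

theorem abs_meanReward_le (M : MDP S A) (hM : M.BoundedRewards) {h : ℕ} (hh : h < M.H) (s : S)
    (a : A) : |M.meanReward h s a| ≤ 1 := by
  have := norm_integral_le_of_norm_le_const (μ := M.rewardDist h (s, a)) (f := fun x => x)
    (C := 1) (hM h hh s a)
  simpa [meanReward] using this

theorem bddMeasurable_meanReward (M : MDP S A) (hM : M.BoundedRewards) :
    BddMeasurable M.H M.meanReward :=
  ⟨1, fun k hk => ⟨(stronglyMeasurable_id.integral_kernel (κ := M.rewardDist k)).measurable,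
    M.abs_meanReward_le hM hk⟩⟩

theorem value_eq (M : MDP S A) (p : Policy S A) {n h : ℕ} (hn : h + n = M.H) (s : S) :
    M.value p h s = M.pathSum p.kernel M.meanReward n h s := by
  obtain rfl : n = M.H - h := by omega
  rfl

theorem abs_value_le (M : MDP S A) (hM : M.BoundedRewards) (p : Policy S A) {h : ℕ}
    (hh : h ≤ M.H) (s : S) : |M.value p h s| ≤ M.H := by
  rw [M.value_eq p (n := M.H - h) (by omega)]
  refine (abs_pathSum_le M p.kernel (N := M.H) (by omega) (B := 1) (fun k hk s a =>
    M.abs_meanReward_le hM hk s a) s).trans ?_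
  rw [mul_one]
  exact_mod_cast Nat.sub_le _ _

/-- Bounded rewards make the family of values bounded above, without which the real supremum in
`optValue` would carry no information. -/
theorem value_le_optValue (M : MDP S A) (hM : M.BoundedRewards) (p : Policy S A) {h : ℕ}
    (hh : h ≤ M.H) (s : S) : M.value p h s ≤ M.optValue h s :=
  le_ciSup (f := fun p : Policy S A => M.value p h s)
    ⟨M.H, by rintro _ ⟨q, rfl⟩; exact (abs_le.1 (M.abs_value_le hM q hh s)).2⟩ p

theorem measurable_value (M : MDP S A) (hM : M.BoundedRewards) (p : Policy S A) {h : ℕ}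
    (hh : h ≤ M.H) : Measurable (M.value p h) :=
  M.measurable_pathSum p.kernel (by omega : h + (M.H - h) ≤ M.H) (M.bddMeasurable_meanReward hM)

end MDP

section Bellman

variable [Fintype A] [Nonempty A]

namespace MDP

theorem bddMeasurable_bellman (M : MDP S A) (hM : M.BoundedRewards) {Q : ℕ → S → A → ℝ}
    (hQ : BddMeasurable (M.H + 1) Q) :
    BddMeasurable M.H fun h s a => M.bellman h (Q (h + 1)) s a := by
  refine (M.bddMeasurable_meanReward hM).add ?_
  obtain ⟨B, hB⟩ := hQ
  refine ⟨B, fun k hk => ⟨?_, fun s a => ?_⟩⟩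
  · exact ((measurable_maxOver fun a => ((hB (k + 1) (by omega)).1.comp
      measurable_prodMk_right)).stronglyMeasurable.integral_kernel (κ := M.trans k)).measurable
  · have := norm_integral_le_of_norm_le_const (μ := M.trans k (s, a))
      (f := fun t => maxOver (Q (k + 1) t)) (C := B) (Filter.Eventually.of_forall fun t =>
        abs_maxOver_le fun a => (hB (k + 1) (by omega)).2 t a)
    simpa using this

variable [DiscreteMeasurableSpace A]

/-- Along a policy, the sum of the Bellman errors bounds from below the difference between the
predicted value and the value of the policy, with equality for greedy policies. -/
theorem pathSum_bellmanError (M : MDP S A) (hM : M.BoundedRewards) {Q : ℕ → S → A → ℝ}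
    (hQ : BddMeasurable (M.H + 1) Q) (hQ0 : ∀ s a, Q M.H s a = 0) (p : Policy S A) :
    ∀ (n h : ℕ) (s : S), h + n = M.H →
      M.pathSum p.kernel (fun h s a => Q h s a - M.bellman h (Q (h + 1)) s a) n h s ≤
        maxOver (Q h s) - M.value p h s ∧
      ((∀ h < M.H, ∀ s a, Q h s a ≤ Q h s (p.act h s)) →
        M.pathSum p.kernel (fun h s a => Q h s a - M.bellman h (Q (h + 1)) s a) n h s =
          maxOver (Q h s) - M.value p h s) := by
  have hf : BddMeasurable M.H fun h s a => Q h s a - M.bellman h (Q (h + 1)) s a := by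
    refine BddMeasurable.sub ?_ (M.bddMeasurable_bellman hM hQ)
    obtain ⟨B, hB⟩ := hQ
    exact ⟨B, fun k hk => hB k (by omega)⟩
  intro n
  induction n with
  | zero =>
    intro h s hn
    obtain rfl : h = M.H := by omega
    rw [M.value_eq p (n := 0) (by omega), pathSum_zero, pathSum_zero,
      show Q M.H s = fun _ => 0 from funext (hQ0 s), maxOver_zero]
    simp
  | succ n ih =>
    intro h s hn
    have hV : M.value p h s = M.meanReward h s (p.act h s) +
        ∫ t, M.value p (h + 1) t ∂(M.trans h (s, p.act h s)) := by
      rw [M.value_eq p hn, M.pathSum_succ p hn.le (M.bddMeasurable_meanReward hM)]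
      simp_rw [M.value_eq p (n := n) (h := h + 1) (by omega)]
    rw [M.pathSum_succ p hn.le hf]
    have hmJ := M.measurable_pathSum p.kernel (by omega : h + 1 + n ≤ M.H) hf
    have hiJ : Integrable (M.pathSum p.kernel
        (fun h s a => Q h s a - M.bellman h (Q (h + 1)) s a) n (h + 1))
        (M.trans h (s, p.act h s)) := by
      obtain ⟨B, hB⟩ := hf
      exact Integrable.of_bound hmJ.aestronglyMeasurable (n * B)
        (Filter.Eventually.of_forall fun t => M.abs_pathSum_le p.kernel
          (by omega : h + 1 + n ≤ M.H) (fun k hk => (hB k hk).2) t)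
    have hiV : Integrable (M.value p (h + 1)) (M.trans h (s, p.act h s)) :=
      Integrable.of_bound (M.measurable_value hM p (by omega)).aestronglyMeasurable M.H
        (Filter.Eventually.of_forall fun t => M.abs_value_le hM p (by omega) t)
    have hiQ : Integrable (fun t => maxOver (Q (h + 1) t)) (M.trans h (s, p.act h s)) := by
      obtain ⟨B, hB⟩ := hQ
      exact Integrable.of_bound (measurable_maxOver fun a => (hB (h + 1) (by omega)).1.comp
        measurable_prodMk_right).aestronglyMeasurable B
        (Filter.Eventually.of_forall fun t => abs_maxOver_le fun a =>
          (hB (h + 1) (by omega)).2 t a)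
    have hs := integral_sub hiQ hiV
    constructor
    -- The expected maximum at the next stage appears both in the integrated induction hypothesis
    -- and in `bellman`, and cancels. Passing from the chosen action to the maximum only enlarges
    -- the right-hand side.
    · have h1 := integral_mono hiJ (hiQ.sub hiV) fun t => (ih (h + 1) t (by omega)).1
      simp only [Pi.sub_apply] at h1
      have h2 := le_maxOver (Q h s) (p.act h s)
      rw [hV, bellman]
      linarith
    -- Greediness removes the only two losses: the maximum is attained by the chosen action, and the
    -- induction hypothesis is an equality.
    · intro hg
      have h1 : ∫ t, M.pathSum p.kernel
          (fun h s a => Q h s a - M.bellman h (Q (h + 1)) s a) n (h + 1) t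
            ∂(M.trans h (s, p.act h s)) =
          ∫ t, (maxOver (Q (h + 1) t) - M.value p (h + 1) t) ∂(M.trans h (s, p.act h s)) :=
        integral_congr_ae (Filter.Eventually.of_forall fun t => (ih (h + 1) t (by omega)).2 hg)
      have h2 : maxOver (Q h s) = Q h s (p.act h s) :=
        le_antisymm (maxOver_le fun a => hg h (by omega) s a) (le_maxOver _ _)
      rw [h1, hs, hV, bellman, h2]
      ring

/-- The performance bounds that follow from a pointwise bound `U` on the distance between `Q` and
approximate Bellman backups `F`, whose summed errors are at most `ε`. -/
theorem performance_bounds (M : MDP S A) (hM : M.BoundedRewards) (hH : 1 ≤ M.H)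
    {Q F U : ℕ → S → A → ℝ} (hQ : BddMeasurable (M.H + 1) Q) (hQ0 : ∀ s a, Q M.H s a = 0)
    (hF : BddMeasurable M.H F) (hU : BddMeasurable M.H U) {ε : ℝ}
    (hQF : ∀ h < M.H, ∀ s a, |Q h s a - F h s a| ≤ U h s a)
    (hε : ∀ p : Policy S A,
      |M.expSum p.kernel fun h s a => F h s a - M.bellman h (Q (h + 1)) s a| ≤ ε)
    {greedy opt : Policy S A} (hg : ∀ h < M.H, ∀ s a, Q h s a ≤ Q h s (greedy.act h s))
    (ho : M.IsOptimal opt) :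
    -M.expSum opt.kernel U - ε ≤ ∫ s, (maxOver (Q 0 s) - M.optValue 0 s) ∂M.start ∧
      ∫ s, (maxOver (Q 0 s) - M.optValue 0 s) ∂M.start ≤ M.expSum greedy.kernel U + ε := by
  have hT := M.bddMeasurable_bellman hM hQ
  have hQ' : BddMeasurable M.H Q := by
    obtain ⟨B, hB⟩ := hQ
    exact ⟨B, fun k hk => hB k (by omega)⟩
  have hf := hQ'.sub hT
  have hd := hF.sub hT
  have hopt : ∀ s, M.optValue 0 s = M.value opt 0 s := fun s => (ho 0 hH s).symm
  simp_rw [hopt]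
  have hiV : ∀ p, Integrable (M.value p 0) M.start := fun p =>
    Integrable.of_bound (M.measurable_value hM p (by omega)).aestronglyMeasurable M.H
      (Filter.Eventually.of_forall fun t => M.abs_value_le hM p (by omega) t)
  have hiQ : Integrable (fun t => maxOver (Q 0 t)) M.start := by
    obtain ⟨B, hB⟩ := hQ
    exact Integrable.of_bound (measurable_maxOver fun a => (hB 0 (by omega)).1.comp
      measurable_prodMk_right).aestronglyMeasurable B
      (Filter.Eventually.of_forall fun t => abs_maxOver_le fun a => (hB 0 (by omega)).2 t a)
  have hiJ : ∀ p : Policy S A, Integrable (M.pathSum p.kernel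
      (fun h s a => Q h s a - M.bellman h (Q (h + 1)) s a) M.H 0) M.start := by
    intro p
    have hmJ := M.measurable_pathSum p.kernel (by omega : 0 + M.H ≤ M.H) hf
    obtain ⟨B, hB⟩ := hf
    exact Integrable.of_bound hmJ.aestronglyMeasurable (M.H * B)
      (Filter.Eventually.of_forall fun t => M.abs_pathSum_le p.kernel
        (by omega : 0 + M.H ≤ M.H) (fun k hk => (hB k hk).2) t)
  -- The estimation error `Q - F` is controlled pointwise, the approximation error `F - TQ` only in
  -- expectation along policies.
  have hsplit : ∀ p : Policy S A,
      M.expSum p.kernel (fun h s a => Q h s a - M.bellman h (Q (h + 1)) s a) =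
        M.expSum p.kernel (fun h s a => Q h s a - F h s a) +
          M.expSum p.kernel fun h s a => F h s a - M.bellman h (Q (h + 1)) s a := by
    intro p
    rw [← M.expSum_add p.kernel (hQ'.sub hF) hd]
    simp
  constructor
  -- The inequality for arbitrary policies suffices here, as the optimal policy need not be greedy
  -- for `Q`.
  · have h1 : M.expSum opt.kernel (fun h s a => Q h s a - M.bellman h (Q (h + 1)) s a) ≤
        ∫ s, (maxOver (Q 0 s) - M.value opt 0 s) ∂M.start := by
      rw [M.expSum_eq opt.kernel hf]
      exact integral_mono (hiJ opt) (hiQ.sub (hiV opt)) fun s =>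
        (M.pathSum_bellmanError hM hQ hQ0 opt M.H 0 s (by omega)).1
    have h2 := M.expSum_mono opt.kernel hU.neg (hQ'.sub hF) fun h hh s a =>
      (abs_le.1 (hQF h hh s a)).1
    rw [expSum_neg] at h2
    have h3 := (abs_le.1 (hε opt)).1
    rw [hsplit] at h1
    linarith
  -- Here the equality for greedy policies is needed, combined with the fact that the value of the
  -- greedy policy is at most the optimal one.
  · have h1 : ∫ s, (maxOver (Q 0 s) - M.value opt 0 s) ∂M.start ≤
        M.expSum greedy.kernel (fun h s a => Q h s a - M.bellman h (Q (h + 1)) s a) := by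
      rw [M.expSum_eq greedy.kernel hf]
      refine integral_mono (hiQ.sub (hiV opt)) (hiJ greedy) fun s => ?_
      have e := (M.pathSum_bellmanError hM hQ hQ0 greedy M.H 0 s (by omega)).2 hg
      have := M.value_le_optValue hM greedy (h := 0) (by omega) s
      rw [hopt] at this
      rw [e]
      linarith
    have h2 := M.expSum_mono greedy.kernel (hQ'.sub hF) hU fun h hh s a =>
      (abs_le.1 (hQF h hh s a)).2
    have h3 := (abs_le.1 (hε greedy)).2
    rw [hsplit] at h1
    linarith

end MDP

end Bellman

end Decomposition

/-! ### Uniform one-sided concentration for least squares -/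

section Net

theorem norm_le_of_abs_le {d : ℕ} {x y : EuclideanSpace ℝ (Fin d)} (h : ∀ i, |x i| ≤ |y i|) :
    ‖x‖ ≤ ‖y‖ := by
  rw [EuclideanSpace.norm_eq, EuclideanSpace.norm_eq]
  exact Real.sqrt_le_sqrt (Finset.sum_le_sum fun i _ => by
    rw [Real.norm_eq_abs, Real.norm_eq_abs]
    exact pow_le_pow_left₀ (abs_nonneg _) (h i) 2)

/-- The factor `√d` would be sharp; `d` keeps the mesh of the net rational, and it matters only
inside a logarithm. -/
theorem norm_le_card_mul {d : ℕ} {x : EuclideanSpace ℝ (Fin d)} {c : ℝ} (hc : 0 ≤ c)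
    (h : ∀ i, |x i| ≤ c) : ‖x‖ ≤ d * c := by
  rw [EuclideanSpace.norm_eq]
  refine Real.sqrt_le_iff.2 ⟨by positivity, ?_⟩
  have h1 : ∑ i, ‖x i‖ ^ 2 ≤ ∑ _i : Fin d, c ^ 2 := Finset.sum_le_sum fun i _ => by
    rw [Real.norm_eq_abs]; gcongr; exact h i
  refine h1.trans ?_
  have hd : (d : ℝ) ≤ (d : ℝ) ^ 2 := by
    exact_mod_cast Nat.le_self_pow two_ne_zero d
  simp only [Finset.sum_const, Finset.card_univ, Fintype.card_fin, nsmul_eq_mul]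
  rw [mul_pow]
  gcongr

/-- Rounding towards zero. -/
theorem exists_int_abs_le (x : ℝ) : ∃ k : ℤ, |(k : ℝ)| ≤ |x| ∧ |x - k| ≤ 1 := by
  rcases le_total 0 x with hx | hx
  · refine ⟨⌊x⌋, ?_, ?_⟩
    · rw [abs_of_nonneg hx, abs_of_nonneg (by exact_mod_cast Int.floor_nonneg.2 hx)]
      exact Int.floor_le x
    · rw [abs_le]
      constructor <;> linarith [Int.floor_le x, Int.lt_floor_add_one x]
  · refine ⟨⌈x⌉, ?_, ?_⟩
    · rw [abs_of_nonpos hx, abs_of_nonpos (by exact_mod_cast Int.ceil_nonpos.2 hx)]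
      linarith [Int.le_ceil x]
    · rw [abs_le]
      constructor <;> linarith [Int.le_ceil x, Int.ceil_lt_add_one x]

/-- A finite `1 / N`-net of the Euclidean unit ball. -/
theorem exists_net_unitBall (d N : ℕ) (hd : 1 ≤ d) (hN : 1 ≤ N) :
    ∃ T : Finset (EuclideanSpace ℝ (Fin d)), (T.card : ℝ) ≤ (3 * N * d) ^ d ∧
      (∀ t ∈ T, ‖t‖ ≤ 1) ∧ ∀ θ : EuclideanSpace ℝ (Fin d), ‖θ‖ ≤ 1 → ∃ t ∈ T, ‖θ - t‖ ≤ 1 / N := by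
  classical
  -- Mesh `1 / m` per coordinate: the norm of the rounding error is at most `d / m = 1 / N`.
  set m : ℕ := N * d with hm
  have hm1 : 1 ≤ m := Nat.mul_pos hN hd
  have hm0 : (0 : ℝ) < m := by exact_mod_cast hm1
  let I : Finset (Fin d → ℤ) := Fintype.piFinset fun _ => Finset.Icc (-(m : ℤ)) m
  let g : (Fin d → ℤ) → EuclideanSpace ℝ (Fin d) := fun k => WithLp.toLp 2 fun i => (k i : ℝ) / m
  refine ⟨(I.image g).filter fun t => ‖t‖ ≤ 1, ?_, fun t ht => (Finset.mem_filter.1 ht).2, ?_⟩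
  · have h1 : ((I.image g).filter fun t => ‖t‖ ≤ 1).card ≤ (3 * N * d) ^ d := by
      -- Each coordinate takes `2 m + 1 ≤ 3 m` values.
      refine (Finset.card_filter_le _ _).trans (Finset.card_image_le.trans ?_)
      rw [Fintype.card_piFinset]
      simp only [Int.card_Icc, Finset.prod_const, Finset.card_univ, Fintype.card_fin]
      refine Nat.pow_le_pow_left ?_ d
      have : 3 * N * d = 3 * m := by rw [hm]; ring
      omega
    exact_mod_cast h1
  · intro θ hθ
    -- Rounding towards zero shrinks every coordinate in absolute value, so the net point stays in
    -- the unit ball.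
    choose k hk1 hk2 using fun i => exists_int_abs_le (m * θ i)
    have hki : ∀ i, |g k i| ≤ |θ i| := by
      intro i
      change |(k i : ℝ) / m| ≤ _
      rw [abs_div, abs_of_pos hm0, div_le_iff₀ hm0]
      have := hk1 i
      rw [abs_mul, abs_of_pos hm0] at this
      linarith
    have hg : ‖g k‖ ≤ 1 := (norm_le_of_abs_le hki).trans hθ
    refine ⟨g k, Finset.mem_filter.2 ⟨Finset.mem_image.2 ⟨k, ?_, rfl⟩, hg⟩, ?_⟩
    · refine Fintype.mem_piFinset.2 fun i => ?_
      have h1 : |(k i : ℝ)| ≤ m := by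
        refine (hk1 i).trans ?_
        rw [abs_mul, abs_of_pos hm0]
        have : |θ i| ≤ 1 := (by simpa using PiLp.norm_apply_le θ i : |θ i| ≤ ‖θ‖).trans hθ
        nlinarith
      rw [abs_le] at h1
      exact Finset.mem_Icc.2 ⟨by exact_mod_cast h1.1, by exact_mod_cast h1.2⟩
    · have : ‖θ - g k‖ ≤ d * (1 / m) := by
        refine norm_le_card_mul (by positivity) fun i => ?_
        change |θ i - (k i : ℝ) / m| ≤ _
        have : θ i - (k i : ℝ) / m = (m * θ i - k i) / m := by field_simp
        rw [this, abs_div, abs_of_pos hm0]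
        gcongr
        exact hk2 i
      refine this.trans (le_of_eq ?_)
      rw [hm]
      have : (d : ℝ) ≠ 0 := by positivity
      have : (N : ℝ) ≠ 0 := by positivity
      push_cast
      field_simp

end Net

/-! ### Exponential inequalities for excess losses. -/

section Concentration

variable {Z : Type*} {d : ℕ}

/-- Excess squared loss of the linear predictor `θ` over `ϑ`, for the target `y w`. -/
noncomputable def excessLoss (f : Z → EuclideanSpace ℝ (Fin d))
    (y : EuclideanSpace ℝ (Fin d) → Z → ℝ) (w θ ϑ : EuclideanSpace ℝ (Fin d)) (z : Z) : ℝ :=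
  (y w z - inner ℝ (f z) θ) ^ 2 - (y w z - inner ℝ (f z) ϑ) ^ 2

theorem excessLoss_eq (f : Z → EuclideanSpace ℝ (Fin d)) (y : EuclideanSpace ℝ (Fin d) → Z → ℝ)
    (w θ ϑ : EuclideanSpace ℝ (Fin d)) (z : Z) :
    excessLoss f y w θ ϑ z =
      -inner ℝ (f z) (θ - ϑ) * (2 * y w z - inner ℝ (f z) θ - inner ℝ (f z) ϑ) := by
  rw [excessLoss, inner_sub_right]; ring

/-- A regression problem with features of norm at most one, and targets that are bounded by `2` and
depend on a parameter in a `1`-Lipschitz way. -/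
structure IsRegression [MeasurableSpace Z] (f : Z → EuclideanSpace ℝ (Fin d))
    (y : EuclideanSpace ℝ (Fin d) → Z → ℝ) : Prop where
  measurable_feature : Measurable f
  measurable_target : ∀ w, Measurable (y w)
  norm_feature_le : ∀ z, ‖f z‖ ≤ 1
  abs_target_le : ∀ w z, ‖w‖ ≤ 1 → |y w z| ≤ 2
  abs_target_sub_le : ∀ w v z, |y w z - y v z| ≤ ‖w - v‖

theorem exp_le_one_add_add_sq {x : ℝ} (hx : |x| ≤ 1) : Real.exp x ≤ 1 + x + x ^ 2 := by
  have := (abs_le.1 (Real.abs_exp_sub_one_sub_id_le hx)).2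
  linarith

/-- Integrate `exp x ≤ 1 + x + x ^ 2` and use `1 + t ≤ exp t`. The second moment in the exponent is
what allows fluctuations to be absorbed by the curvature of the squared loss. -/
theorem integral_exp_le {Z : Type*} [MeasurableSpace Z] {ν : Measure Z} [IsProbabilityMeasure ν]
    {X : Z → ℝ} (hX : Measurable X) (hb : ∀ z, |X z| ≤ 1) :
    ∫ z, Real.exp (X z) ∂ν ≤ Real.exp (∫ z, X z ∂ν + ∫ z, X z ^ 2 ∂ν) := by
  have hi : Integrable X ν := Integrable.of_bound hX.aestronglyMeasurable 1
    (Filter.Eventually.of_forall hb)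
  have hi2 : Integrable (fun z => X z ^ 2) ν := Integrable.of_bound
    (hX.pow_const 2).aestronglyMeasurable 1 (Filter.Eventually.of_forall fun z => by
      rw [Real.norm_eq_abs, abs_pow]; exact pow_le_one₀ (abs_nonneg _) (hb z))
  have hie : Integrable (fun z => Real.exp (X z)) ν := Integrable.of_bound
    (Real.measurable_exp.comp hX).aestronglyMeasurable (Real.exp 1)
    (Filter.Eventually.of_forall fun z => by
      rw [Real.norm_eq_abs, Real.abs_exp]
      exact Real.exp_le_exp.2 ((le_abs_self _).trans (hb z)))
  calc ∫ z, Real.exp (X z) ∂ν ≤ ∫ z, ((1 + X z) + X z ^ 2) ∂ν :=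
        integral_mono hie (((integrable_const 1).add hi).add hi2) fun z =>
          exp_le_one_add_add_sq (hb z)
    _ = (∫ z, X z ∂ν + ∫ z, X z ^ 2 ∂ν) + 1 := by
        have h1 : Integrable (fun z => 1 + X z) ν := (integrable_const 1).add hi
        rw [integral_add h1 hi2, integral_add (integrable_const 1) hi]
        simp; ring
    _ ≤ _ := Real.add_one_le_exp _

namespace IsRegression

variable [MeasurableSpace Z] {f : Z → EuclideanSpace ℝ (Fin d)}
  {y : EuclideanSpace ℝ (Fin d) → Z → ℝ}

theorem abs_inner_le (hr : IsRegression f y) (u : EuclideanSpace ℝ (Fin d)) (z : Z) :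
    |(inner ℝ (f z) u : ℝ)| ≤ ‖u‖ :=
  (abs_real_inner_le_norm _ _).trans
    (mul_le_of_le_one_left (norm_nonneg u) (hr.norm_feature_le z))

theorem measurable_inner (hr : IsRegression f y) (u : EuclideanSpace ℝ (Fin d)) :
    Measurable fun z => (inner ℝ (f z) u : ℝ) :=
  hr.measurable_feature.inner_const

theorem measurable_excessLoss (hr : IsRegression f y) (w θ ϑ : EuclideanSpace ℝ (Fin d)) :
    Measurable (excessLoss f y w θ ϑ) :=
  (((hr.measurable_target w).sub (hr.measurable_inner θ)).pow_const 2).sub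
    (((hr.measurable_target w).sub (hr.measurable_inner ϑ)).pow_const 2)

/-- In the factored difference of squares the second factor is at most `2 * 2 + 1 + 1 = 6`. Keeping
the first factor relates the second moment of the excess loss to that of `⟨f, θ - ϑ⟩`. -/
theorem abs_excessLoss_le (hr : IsRegression f y) {w θ ϑ : EuclideanSpace ℝ (Fin d)}
    (hw : ‖w‖ ≤ 1) (hθ : ‖θ‖ ≤ 1) (hϑ : ‖ϑ‖ ≤ 1) (z : Z) :
    |excessLoss f y w θ ϑ z| ≤ 6 * |inner ℝ (f z) (θ - ϑ)| := by
  rw [excessLoss_eq, abs_mul, abs_neg, mul_comm]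
  have h1 := abs_le.1 (hr.abs_target_le w z hw)
  have h2 := abs_le.1 ((hr.abs_inner_le θ z).trans hθ)
  have h3 := abs_le.1 ((hr.abs_inner_le ϑ z).trans hϑ)
  gcongr
  rw [abs_le]
  constructor <;> linarith [h1.1, h1.2, h2.1, h2.2, h3.1, h3.2]

theorem abs_inner_sub_le (hr : IsRegression f y) {θ ϑ : EuclideanSpace ℝ (Fin d)}
    (hθ : ‖θ‖ ≤ 1) (hϑ : ‖ϑ‖ ≤ 1) (z : Z) : |(inner ℝ (f z) (θ - ϑ) : ℝ)| ≤ 2 :=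
  (hr.abs_inner_le _ z).trans ((norm_sub_le _ _).trans (by linarith))

theorem integrable_excessLoss (hr : IsRegression f y) (ν : Measure Z) [IsProbabilityMeasure ν]
    {w θ ϑ : EuclideanSpace ℝ (Fin d)} (hw : ‖w‖ ≤ 1) (hθ : ‖θ‖ ≤ 1) (hϑ : ‖ϑ‖ ≤ 1) :
    Integrable (excessLoss f y w θ ϑ) ν :=
  Integrable.of_bound (hr.measurable_excessLoss w θ ϑ).aestronglyMeasurable 12
    (Filter.Eventually.of_forall fun z => (hr.abs_excessLoss_le hw hθ hϑ z).trans (by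
      linarith [hr.abs_inner_sub_le hθ hϑ z]))

theorem integrable_inner_sq (hr : IsRegression f y) (ν : Measure Z) [IsProbabilityMeasure ν]
    (u : EuclideanSpace ℝ (Fin d)) : Integrable (fun z => (inner ℝ (f z) u : ℝ) ^ 2) ν :=
  Integrable.of_bound ((hr.measurable_inner u).pow_const 2).aestronglyMeasurable (‖u‖ ^ 2)
    (Filter.Eventually.of_forall fun z => by
      rw [Real.norm_eq_abs, abs_pow]; gcongr; exact hr.abs_inner_le u z)

/-- The lower confidence level for the sum of `N` excess losses, up to additive terms. -/
noncomputable def level (ν : Measure Z) (f : Z → EuclideanSpace ℝ (Fin d))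
    (y : EuclideanSpace ℝ (Fin d) → Z → ℝ) (w θ ϑ : EuclideanSpace ℝ (Fin d)) : ℝ :=
  ∫ z, excessLoss f y w θ ϑ z ∂ν - (∫ z, (inner ℝ (f z) (θ - ϑ) : ℝ) ^ 2 ∂ν) / 2

/-- The rate `1 / 72` is chosen so that the squared exponent is at most `36 / 72 ^ 2 = 1 / 144`
times `⟨f, θ - ϑ⟩ ^ 2`. This is `1 / 72` times one half of that square, the correction in `level`.
As the excess loss is at most `12` in absolute value, the exponent also lies in `[-1, 1]`. -/
theorem integral_exp_excessLoss_le (hr : IsRegression f y) (ν : Measure Z)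
    [IsProbabilityMeasure ν] {w θ ϑ : EuclideanSpace ℝ (Fin d)} (hw : ‖w‖ ≤ 1) (hθ : ‖θ‖ ≤ 1)
    (hϑ : ‖ϑ‖ ≤ 1) :
    ∫ z, Real.exp (-(1 / 72) * excessLoss f y w θ ϑ z) ∂ν ≤
      Real.exp (-(1 / 72) * level ν f y w θ ϑ) := by
  have hb : ∀ z, |-(1 / 72) * excessLoss f y w θ ϑ z| ≤ 1 := by
    intro z
    rw [abs_mul]
    have h1 := hr.abs_excessLoss_le hw hθ hϑ z
    have h2 := hr.abs_inner_sub_le hθ hϑ z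
    rw [show |(-(1 / 72) : ℝ)| = 1 / 72 by norm_num [abs_of_nonneg]]
    linarith
  refine (integral_exp_le ((hr.measurable_excessLoss w θ ϑ).const_mul _) hb).trans ?_
  rw [Real.exp_le_exp, integral_const_mul, level]
  have hsq : ∫ z, (-(1 / 72) * excessLoss f y w θ ϑ z) ^ 2 ∂ν ≤
      ∫ z, (1 / 144) * (inner ℝ (f z) (θ - ϑ) : ℝ) ^ 2 ∂ν := by
    refine integral_mono (Integrable.of_bound
      (((hr.measurable_excessLoss w θ ϑ).const_mul _).pow_const 2).aestronglyMeasurable 1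
      (Filter.Eventually.of_forall fun z => ?_)) ((hr.integrable_inner_sq ν _).const_mul _)
      fun z => ?_
    · rw [Real.norm_eq_abs, abs_pow]; exact pow_le_one₀ (abs_nonneg _) (hb z)
    · have h1 := pow_le_pow_left₀ (abs_nonneg _) (hr.abs_excessLoss_le hw hθ hϑ z) 2
      rw [sq_abs, mul_pow, sq_abs] at h1
      simp only [mul_pow]
      linarith
  rw [integral_const_mul] at hsq
  linarith

/-- Chernoff's method at the fixed rate `1 / 72`: the moment generating function of the negated sum
factorizes by independence, and the deviation `72 * L` costs the factor `exp (-L)`. -/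
theorem measure_sum_excessLoss_le (hr : IsRegression f y) (ν : Measure Z)
    [IsProbabilityMeasure ν] {Ω : Type*} [MeasurableSpace Ω] (P : Measure Ω)
    [IsProbabilityMeasure P] (X : ℕ → Ω → Z) (hX : ∀ k, Measurable (X k))
    (hlaw : ∀ k, P.map (X k) = ν) (hind : iIndepFun X P)
    {w θ ϑ : EuclideanSpace ℝ (Fin d)} (hw : ‖w‖ ≤ 1) (hθ : ‖θ‖ ≤ 1) (hϑ : ‖ϑ‖ ≤ 1)
    (I : Finset ℕ) (L : ℝ) :
    P {ω | ∑ k ∈ I, excessLoss f y w θ ϑ (X k ω) ≤ I.card * level ν f y w θ ϑ - 72 * L} ≤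
      ENNReal.ofReal (Real.exp (-L)) := by
  set Y : ℕ → Ω → ℝ := fun k ω => -excessLoss f y w θ ϑ (X k ω) with hY
  have hYm : ∀ k, Measurable (Y k) := fun k =>
    ((hr.measurable_excessLoss w θ ϑ).comp (hX k)).neg
  have hYi : iIndepFun Y P := hind.comp (fun _ z => -excessLoss f y w θ ϑ z) fun _ =>
    (hr.measurable_excessLoss w θ ϑ).neg
  have hmgf : ∀ k, mgf (Y k) P (1 / 72) ≤ Real.exp (-(1 / 72) * level ν f y w θ ϑ) := by
    intro k
    have : mgf (Y k) P (1 / 72) =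
        ∫ z, Real.exp (-(1 / 72) * excessLoss f y w θ ϑ z) ∂ν := by
      rw [← hlaw k, integral_map (hX k).aemeasurable]
      · simp [mgf, hY]
      · exact (Real.measurable_exp.comp
          ((hr.measurable_excessLoss w θ ϑ).const_mul _)).aestronglyMeasurable
    rw [this]
    exact hr.integral_exp_excessLoss_le ν hw hθ hϑ
  have hYb : ∀ k ω, |Y k ω| ≤ 12 := fun k ω => by
    rw [hY, abs_neg]
    exact (hr.abs_excessLoss_le hw hθ hϑ _).trans (by linarith [hr.abs_inner_sub_le hθ hϑ (X k ω)])
  have hint : Integrable (fun ω => Real.exp (1 / 72 * (∑ k ∈ I, Y k) ω)) P := by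
    refine hYi.integrable_exp_mul_sum hYm fun k _ => ?_
    refine Integrable.of_bound (Real.measurable_exp.comp
      ((hYm k).const_mul _)).aestronglyMeasurable (Real.exp 12)
      (Filter.Eventually.of_forall fun ω => ?_)
    rw [Real.norm_eq_abs, Real.abs_exp, Real.exp_le_exp]
    have := abs_le.1 (hYb k ω)
    linarith [this.1, this.2]
  have hc := measure_ge_le_exp_mul_mgf (μ := P) (X := ∑ k ∈ I, Y k)
    (-(I.card * level ν f y w θ ϑ - 72 * L)) (by norm_num : (0 : ℝ) ≤ 1 / 72) hint
  rw [hYi.mgf_sum hYm] at hc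
  have hp : ∏ k ∈ I, mgf (Y k) P (1 / 72) ≤ Real.exp (-(1 / 72) * level ν f y w θ ϑ) ^ I.card :=
    (Finset.prod_le_prod (fun k _ => mgf_nonneg) fun k _ => hmgf k).trans_eq
      (Finset.prod_const _)
  rw [← Real.exp_nat_mul] at hp
  have hfin : P.real {ω | -(I.card * level ν f y w θ ϑ - 72 * L) ≤ (∑ k ∈ I, Y k) ω} ≤
      Real.exp (-L) := by
    refine hc.trans ((mul_le_mul_of_nonneg_left hp (Real.exp_pos _).le).trans (le_of_eq ?_))
    rw [← Real.exp_add]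
    ring_nf
  have hset : {ω | ∑ k ∈ I, excessLoss f y w θ ϑ (X k ω) ≤
      I.card * level ν f y w θ ϑ - 72 * L} =
      {ω | -(I.card * level ν f y w θ ϑ - 72 * L) ≤ (∑ k ∈ I, Y k) ω} := by
    ext ω
    simp only [Set.mem_ofPred_eq, Finset.sum_apply, hY, Finset.sum_neg_distrib, neg_le_neg_iff]
  rw [hset, ← ofReal_measureReal]
  exact ENNReal.ofReal_le_ofReal hfin

theorem abs_excessLoss_sub_le (hr : IsRegression f y) {w θ ϑ w' θ' ϑ' : EuclideanSpace ℝ (Fin d)}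
    {r : ℝ} (hw : ‖w‖ ≤ 1) (hθ : ‖θ‖ ≤ 1) (hϑ : ‖ϑ‖ ≤ 1) (hθ' : ‖θ'‖ ≤ 1)
    (hϑ' : ‖ϑ'‖ ≤ 1) (h1 : ‖w - w'‖ ≤ r) (h2 : ‖θ - θ'‖ ≤ r) (h3 : ‖ϑ - ϑ'‖ ≤ r) (z : Z) :
    |excessLoss f y w θ ϑ z - excessLoss f y w' θ' ϑ' z| ≤ 20 * r := by
  have hr0 : 0 ≤ r := (norm_nonneg _).trans h1
  have a1 := (hr.abs_target_sub_le w w' z).trans h1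
  have a2 := (hr.abs_inner_le (θ - θ') z).trans h2
  have a3 := (hr.abs_inner_le (ϑ - ϑ') z).trans h3
  rw [inner_sub_right] at a2 a3
  have b1 := hr.abs_target_le w z hw
  have b2 := (hr.abs_inner_le θ z).trans hθ
  have b3 := (hr.abs_inner_le ϑ z).trans hϑ
  have b2' := (hr.abs_inner_le θ' z).trans hθ'
  have b3' := (hr.abs_inner_le ϑ' z).trans hϑ'
  rw [excessLoss_eq, excessLoss_eq, inner_sub_right, inner_sub_right]
  set p : ℝ := inner ℝ (f z) θ
  set q : ℝ := inner ℝ (f z) ϑ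
  set p' : ℝ := inner ℝ (f z) θ'
  set q' : ℝ := inner ℝ (f z) ϑ'
  -- Changing one factor of the product at a time gives `2 r * 6 + 2 * 4 r = 20 r`.
  have e : -(p - q) * (2 * y w z - p - q) - -(p' - q') * (2 * y w' z - p' - q') =
      -((p - p') - (q - q')) * (2 * y w z - p - q) +
        -(p' - q') * (2 * (y w z - y w' z) - (p - p') - (q - q')) := by ring
  rw [e]
  refine (abs_add_le _ _).trans ?_
  rw [abs_mul, abs_mul, abs_neg, abs_neg]
  rw [abs_le] at a1 a2 a3 b1 b2 b3 b2' b3'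
  have c1 : |p - p' - (q - q')| ≤ 2 * r := by rw [abs_le]; constructor <;> linarith
  have c2 : |2 * y w z - p - q| ≤ 6 := by rw [abs_le]; constructor <;> linarith
  have c3 : |p' - q'| ≤ 2 := by rw [abs_le]; constructor <;> linarith
  have c4 : |2 * (y w z - y w' z) - (p - p') - (q - q')| ≤ 4 * r := by
    rw [abs_le]; constructor <;> linarith
  have := mul_le_mul c1 c2 (abs_nonneg _) (by linarith)
  have := mul_le_mul c3 c4 (abs_nonneg _) (by linarith)
  linarith

/-- The excess loss contributes `20 r`, and half of the squared inner product contributes `4 r`. -/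
theorem abs_level_sub_le (hr : IsRegression f y) (ν : Measure Z) [IsProbabilityMeasure ν]
    {w θ ϑ w' θ' ϑ' : EuclideanSpace ℝ (Fin d)}
    {r : ℝ} (hw : ‖w‖ ≤ 1) (hθ : ‖θ‖ ≤ 1) (hϑ : ‖ϑ‖ ≤ 1) (hw' : ‖w'‖ ≤ 1) (hθ' : ‖θ'‖ ≤ 1)
    (hϑ' : ‖ϑ'‖ ≤ 1) (h1 : ‖w - w'‖ ≤ r) (h2 : ‖θ - θ'‖ ≤ r) (h3 : ‖ϑ - ϑ'‖ ≤ r) :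
    |level ν f y w θ ϑ - level ν f y w' θ' ϑ'| ≤ 24 * r := by
  have e : level ν f y w θ ϑ - level ν f y w' θ' ϑ' =
      ∫ z, ((excessLoss f y w θ ϑ z - excessLoss f y w' θ' ϑ' z) -
        ((inner ℝ (f z) (θ - ϑ) : ℝ) ^ 2 / 2 - (inner ℝ (f z) (θ' - ϑ') : ℝ) ^ 2 / 2)) ∂ν := by
    have i1 := hr.integrable_excessLoss ν hw hθ hϑ
    have i2 := hr.integrable_excessLoss ν hw' hθ' hϑ'
    have i3 := (hr.integrable_inner_sq ν (θ - ϑ)).div_const 2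
    have i4 := (hr.integrable_inner_sq ν (θ' - ϑ')).div_const 2
    have i5 : Integrable (fun z => excessLoss f y w θ ϑ z - excessLoss f y w' θ' ϑ' z) ν :=
      i1.sub i2
    have i6 : Integrable (fun z => (inner ℝ (f z) (θ - ϑ) : ℝ) ^ 2 / 2 -
        (inner ℝ (f z) (θ' - ϑ') : ℝ) ^ 2 / 2) ν := i3.sub i4
    rw [integral_sub i5 i6, integral_sub i1 i2, integral_sub i3 i4,
      integral_div, integral_div, level, level]
    ring
  rw [e]
  have hb := norm_integral_le_of_norm_le_const (μ := ν) (C := 24 * r)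
    (f := fun z => (excessLoss f y w θ ϑ z - excessLoss f y w' θ' ϑ' z) -
        ((inner ℝ (f z) (θ - ϑ) : ℝ) ^ 2 / 2 - (inner ℝ (f z) (θ' - ϑ') : ℝ) ^ 2 / 2))
    (Filter.Eventually.of_forall fun z => by
      have hr0 : 0 ≤ r := (norm_nonneg _).trans h1
      have c0 := hr.abs_excessLoss_sub_le hw hθ hϑ hθ' hϑ' h1 h2 h3 z
      have c1 := hr.abs_inner_sub_le hθ hϑ z
      have c2 := hr.abs_inner_sub_le hθ' hϑ' z
      have c3 : |(inner ℝ (f z) (θ - ϑ) : ℝ) - inner ℝ (f z) (θ' - ϑ')| ≤ 2 * r := by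
        rw [← inner_sub_right]
        refine (hr.abs_inner_le _ z).trans ?_
        rw [show θ - ϑ - (θ' - ϑ') = (θ - θ') - (ϑ - ϑ') by abel]
        exact (norm_sub_le _ _).trans (by linarith)
      set p : ℝ := inner ℝ (f z) (θ - ϑ)
      set q : ℝ := inner ℝ (f z) (θ' - ϑ')
      have c4 : |p ^ 2 / 2 - q ^ 2 / 2| ≤ 4 * r := by
        rw [show p ^ 2 / 2 - q ^ 2 / 2 = (p - q) * ((p + q) / 2) by ring, abs_mul]
        have c5 : |(p + q) / 2| ≤ 2 := by
          rw [abs_le] at c1 c2 ⊢; constructor <;> linarith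
        have := mul_le_mul c3 c5 (abs_nonneg _) (by linarith)
        linarith
      rw [Real.norm_eq_abs]
      refine (abs_sub _ _).trans ?_
      linarith)
  simpa using hb

/-- With high probability, the sums of the excess losses are bounded from below, uniformly over the
parameters of target and predictors. -/
theorem exists_uniform_event (hr : IsRegression f y) (hd : 1 ≤ d) (ν : Measure Z)
    [IsProbabilityMeasure ν] {Ω : Type*} [MeasurableSpace Ω] (P : Measure Ω)
    [IsProbabilityMeasure P] (X : ℕ → Ω → Z) (hX : ∀ k, Measurable (X k))
    (hlaw : ∀ k, P.map (X k) = ν) (hind : iIndepFun X P) (I : Finset ℕ) (hI : 1 ≤ I.card)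
    {p : ℝ} (hp : 0 < p) :
    ∃ B : Set Ω, MeasurableSet B ∧ P B ≤ ENNReal.ofReal p ∧ ∀ ω ∉ B,
      ∀ w θ ϑ : EuclideanSpace ℝ (Fin d), ‖w‖ ≤ 1 → ‖θ‖ ≤ 1 → ‖ϑ‖ ≤ 1 →
        I.card * level ν f y w θ ϑ -
          (72 * (3 * d * Real.log (3 * I.card * d) + Real.log (1 / p)) + 44) ≤
          ∑ k ∈ I, excessLoss f y w θ ϑ (X k ω) := by
  obtain ⟨T, hT, hT1, hTn⟩ := exists_net_unitBall d I.card hd hI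
  set N : ℝ := (I.card : ℝ) with hN
  have hN0 : 0 < N := by rw [hN]; exact_mod_cast hI
  -- This makes `exp (-L)` equal to `p / ((3 N d) ^ d) ^ 3`, which pays for the union over all
  -- triples of net points.
  set L : ℝ := 3 * d * Real.log (3 * N * d) + Real.log (1 / p) with hL
  let bad : (EuclideanSpace ℝ (Fin d) × EuclideanSpace ℝ (Fin d) × EuclideanSpace ℝ (Fin d)) →
      Set Ω := fun q => {ω | ∑ k ∈ I, excessLoss f y q.1 q.2.1 q.2.2 (X k ω) ≤
        N * level ν f y q.1 q.2.1 q.2.2 - 72 * L}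
  refine ⟨⋃ q ∈ T ×ˢ T ×ˢ T, bad q, ?_, ?_, ?_⟩
  · refine Finset.measurableSet_biUnion _ fun q _ => ?_
    exact measurableSet_le (Finset.measurable_sum _ fun k _ =>
      (hr.measurable_excessLoss _ _ _).comp (hX k)) measurable_const
  · refine (measure_biUnion_finset_le _ _).trans ?_
    have h1 : ∀ q ∈ T ×ˢ T ×ˢ T, P (bad q) ≤ ENNReal.ofReal (Real.exp (-L)) := by
      intro q hq
      simp only [Finset.mem_product] at hq
      exact hr.measure_sum_excessLoss_le ν P X hX hlaw hind (hT1 _ hq.1) (hT1 _ hq.2.1)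
        (hT1 _ hq.2.2) I L
    refine (Finset.sum_le_card_nsmul _ _ _ h1).trans ?_
    rw [nsmul_eq_mul, ← ENNReal.ofReal_natCast, ← ENNReal.ofReal_mul (by positivity)]
    refine ENNReal.ofReal_le_ofReal ?_
    have h3 : (0 : ℝ) < 3 * N * d := by positivity
    have h2 : Real.exp (-L) = p / ((3 * N * d) ^ d) ^ 3 := by
      rw [hL, neg_add, Real.exp_add, ← Real.log_inv, Real.exp_log (by positivity), Real.exp_neg,
        show 3 * d * Real.log (3 * N * d) = Real.log (((3 * N * d) ^ d) ^ 3) by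
          rw [Real.log_pow, Real.log_pow]; push_cast; ring, Real.exp_log (by positivity)]
      field_simp
    rw [h2, mul_div_assoc', div_le_iff₀ (by positivity), mul_comm]
    gcongr
    rw [Finset.card_product, Finset.card_product]
    push_cast
    calc (T.card : ℝ) * (T.card * T.card) = (T.card : ℝ) ^ 3 := by ring
      _ ≤ _ := by gcongr
  · intro ω hω w θ ϑ hw hθ hϑ
    obtain ⟨w', hw'T, hw'⟩ := hTn w hw
    obtain ⟨θ', hθ'T, hθ'⟩ := hTn θ hθ
    obtain ⟨ϑ', hϑ'T, hϑ'⟩ := hTn ϑ hϑ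
    have hgood : N * level ν f y w' θ' ϑ' - 72 * L <
        ∑ k ∈ I, excessLoss f y w' θ' ϑ' (X k ω) := by
      by_contra hcon
      refine hω (Set.mem_iUnion₂.2 ⟨(w', θ', ϑ'), ?_, not_lt.1 hcon⟩)
      simp [hw'T, hθ'T, hϑ'T]
    -- As the mesh is `1 / N`, moving from the net to arbitrary parameters costs `20` in the sum of
    -- `N` excess losses and `24` in `N` times the level, hence the constant `44`.
    have h1 := abs_le.1 (hr.abs_level_sub_le ν hw hθ hϑ (hT1 _ hw'T) (hT1 _ hθ'T) (hT1 _ hϑ'T)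
      hw' hθ' hϑ')
    have h2 : ∑ k ∈ I, (excessLoss f y w' θ' ϑ' (X k ω) - 20 * (1 / N)) ≤
        ∑ k ∈ I, excessLoss f y w θ ϑ (X k ω) := Finset.sum_le_sum fun k _ => by
      have := abs_le.1 (hr.abs_excessLoss_sub_le hw hθ hϑ (hT1 _ hθ'T) (hT1 _ hϑ'T)
        hw' hθ' hϑ' (X k ω))
      linarith [this.1]
    rw [Finset.sum_sub_distrib, Finset.sum_const, nsmul_eq_mul, ← hN,
      show N * (20 * (1 / N)) = 20 by field_simp] at h2
    have h3 : N * (level ν f y w θ ϑ - level ν f y w' θ' ϑ') ≤ N * (24 * (1 / N)) :=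
      mul_le_mul_of_nonneg_left h1.2 hN0.le
    rw [show N * (24 * (1 / N)) = 24 by field_simp] at h3
    linarith

/-- Best fits in the unit ball have no larger excess loss than the variance term. -/
theorem integral_inner_sq_le_excess (hr : IsRegression f y) (ν : Measure Z)
    [IsProbabilityMeasure ν] {w θ ϑ : EuclideanSpace ℝ (Fin d)} (hw : ‖w‖ ≤ 1) (hθ : ‖θ‖ ≤ 1)
    (hϑ : ‖ϑ‖ ≤ 1) {g : Z → ℝ} (hg : Measurable g) {B : ℝ} (hgB : ∀ z, |g z| ≤ B)
    (hcond : ∀ u : EuclideanSpace ℝ (Fin d),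
      ∫ z, inner ℝ (f z) u * y w z ∂ν = ∫ z, inner ℝ (f z) u * g z ∂ν)
    (hmin : IsMinOn (fun u : EuclideanSpace ℝ (Fin d) => ∫ z, (inner ℝ (f z) u - g z) ^ 2 ∂ν)
      (Metric.closedBall 0 1) ϑ) :
    ∫ z, (inner ℝ (f z) (θ - ϑ) : ℝ) ^ 2 ∂ν ≤ ∫ z, excessLoss f y w θ ϑ z ∂ν := by
  set D : ℝ := ∫ z, (inner ℝ (f z) (θ - ϑ) : ℝ) ^ 2 ∂ν with hD
  set c : ℝ := ∫ z, inner ℝ (f z) (θ - ϑ) * (inner ℝ (f z) ϑ - g z) ∂ν with hc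
  have bdd : ∀ {F : Z → ℝ}, Measurable F → (∃ C, ∀ z, |F z| ≤ C) → Integrable F ν :=
    fun hF ⟨C, hC⟩ => Integrable.of_bound hF.aestronglyMeasurable C
      (Filter.Eventually.of_forall hC)
  have mi := hr.measurable_inner
  have my := hr.measurable_target w
  have ib := hr.abs_inner_le
  have mulb : ∀ {F G : Z → ℝ} {C C' : ℝ}, (∀ z, |F z| ≤ C) → (∀ z, |G z| ≤ C') →
      ∀ z, |F z * G z| ≤ C * C' := fun hF hG z => by
    rw [abs_mul]
    exact mul_le_mul (hF z) (hG z) (abs_nonneg _) ((abs_nonneg _).trans (hF z))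
  have i1 : Integrable (fun z => (inner ℝ (f z) (θ - ϑ) : ℝ) * inner ℝ (f z) ϑ) ν :=
    bdd ((mi _).mul (mi _)) ⟨_, mulb (ib _) (ib _)⟩
  have i2 : Integrable (fun z => (inner ℝ (f z) (θ - ϑ) : ℝ) * g z) ν :=
    bdd ((mi _).mul hg) ⟨_, mulb (ib _) hgB⟩
  have i3 : Integrable (fun z => (inner ℝ (f z) (θ - ϑ) : ℝ) * y w z) ν :=
    bdd ((mi _).mul my) ⟨_, mulb (ib _) fun z => hr.abs_target_le w z hw⟩
  have i4 := hr.integrable_inner_sq ν (θ - ϑ)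
  have i5 : Integrable (fun z => ((inner ℝ (f z) ϑ : ℝ) - g z) ^ 2) ν := by
    refine bdd (((mi _).sub hg).pow_const 2) ⟨(‖ϑ‖ + B) ^ 2, fun z => ?_⟩
    rw [abs_pow]
    gcongr
    exact (abs_sub _ _).trans (add_le_add (ib _ z) (hgB z))
  have ic : Integrable (fun z => (inner ℝ (f z) (θ - ϑ) : ℝ) * (inner ℝ (f z) ϑ - g z)) ν := by
    simp only [mul_sub]
    exact i1.sub i2
  -- The target enters the cross term only through integrals against linear functions, where it may
  -- be replaced by `g`.
  have hexc : ∫ z, excessLoss f y w θ ϑ z ∂ν = D + 2 * c := by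
    have e : ∀ z, excessLoss f y w θ ϑ z = (inner ℝ (f z) (θ - ϑ) : ℝ) ^ 2 +
        2 * ((inner ℝ (f z) (θ - ϑ) : ℝ) * inner ℝ (f z) ϑ - inner ℝ (f z) (θ - ϑ) * y w z) := by
      intro z
      rw [excessLoss, inner_sub_right]
      ring
    have e2 : c = ∫ z, (inner ℝ (f z) (θ - ϑ) : ℝ) * inner ℝ (f z) ϑ ∂ν -
        ∫ z, inner ℝ (f z) (θ - ϑ) * g z ∂ν := by
      rw [hc, ← integral_sub i1 i2]
      simp only [mul_sub]
    have i6 : Integrable (fun z => 2 * ((inner ℝ (f z) (θ - ϑ) : ℝ) * inner ℝ (f z) ϑ -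
        inner ℝ (f z) (θ - ϑ) * y w z)) ν := (i1.sub i3).const_mul 2
    simp_rw [e]
    rw [integral_add i4 i6, integral_const_mul, integral_sub i1 i3,
      hcond, e2]
  -- First variation at the minimizer: the segment from `ϑ` to `θ` stays in the ball, and moving
  -- along it changes the loss by `t (t D + 2 c)`.
  have hvar : ∀ t : ℝ, 0 < t → t ≤ 1 → 0 ≤ t * D + 2 * c := by
    intro t ht0 ht1
    have hmem : ϑ + t • (θ - ϑ) ∈ Metric.closedBall (0 : EuclideanSpace ℝ (Fin d)) 1 := by
      have := (convex_closedBall (0 : EuclideanSpace ℝ (Fin d)) 1).add_smul_sub_mem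
        (by simpa using hϑ) (by simpa using hθ) ⟨ht0.le, ht1⟩
      exact this
    have h1 : ∫ z, ((inner ℝ (f z) ϑ : ℝ) - g z) ^ 2 ∂ν ≤
        ∫ z, ((inner ℝ (f z) (ϑ + t • (θ - ϑ)) : ℝ) - g z) ^ 2 ∂ν := hmin hmem
    have e : ∀ z, ((inner ℝ (f z) (ϑ + t • (θ - ϑ)) : ℝ) - g z) ^ 2 =
        ((inner ℝ (f z) ϑ : ℝ) - g z) ^ 2 + (t ^ 2 * (inner ℝ (f z) (θ - ϑ) : ℝ) ^ 2 +
          2 * t * ((inner ℝ (f z) (θ - ϑ) : ℝ) * (inner ℝ (f z) ϑ - g z))) := by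
      intro z
      rw [inner_add_right, inner_smul_right]
      ring
    have i6 : Integrable (fun z => t ^ 2 * (inner ℝ (f z) (θ - ϑ) : ℝ) ^ 2 +
        2 * t * ((inner ℝ (f z) (θ - ϑ) : ℝ) * (inner ℝ (f z) ϑ - g z))) ν :=
      (i4.const_mul _).add (ic.const_mul _)
    simp_rw [e] at h1
    rw [integral_add i5 i6,
      integral_add (i4.const_mul _) (ic.const_mul _), integral_const_mul, integral_const_mul] at h1
    have h2 : 0 ≤ t * (t * D + 2 * c) := by rw [hD, hc]; linarith
    exact nonneg_of_mul_nonneg_right h2 ht0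
  have hc0 : 0 ≤ c := by
    by_contra hcon
    push Not at hcon
    have hD0 : 0 ≤ D := integral_nonneg fun z => sq_nonneg _
    -- For this `t` one has `t D ≤ -c`, so a negative `c` would give `t D + 2 c ≤ c < 0`. The
    -- denominator `D + 1` covers the case `D = 0`.
    have ht : 0 < min 1 (-c / (D + 1)) := lt_min one_pos (div_pos (by linarith) (by linarith))
    have h1 := hvar _ ht (min_le_left _ _)
    have h2 : min 1 (-c / (D + 1)) * D ≤ -c / (D + 1) * (D + 1) :=
      mul_le_mul (min_le_right _ _) (by linarith) hD0
        (div_nonneg (by linarith) (by linarith))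
    rw [div_mul_cancel₀ _ (by linarith)] at h2
    linarith
  rw [hexc]
  linarith

end IsRegression

end Concentration

/-! ### Recursive ridge regression and its projection -/

section Ridge

variable {d : ℕ}

/-- `P` and `θ` are the inverse of `M` and the solution of `M θ = b`. -/
def IsRidge (M : Matrix (Fin d) (Fin d) ℝ) (b : Fin d → ℝ) (P : Matrix (Fin d) (Fin d) ℝ)
    (θ : EuclideanSpace ℝ (Fin d)) : Prop :=
  M.PosDef ∧ P = M⁻¹ ∧ M *ᵥ θ.ofLp = b

/-- The Sherman-Morrison step. -/
theorem IsRidge.update {M : Matrix (Fin d) (Fin d) ℝ} {b : Fin d → ℝ}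
    {P : Matrix (Fin d) (Fin d) ℝ} {θ : EuclideanSpace ℝ (Fin d)} (h : IsRidge M b P θ)
    (f : EuclideanSpace ℝ (Fin d)) (y : ℝ) :
    IsRidge (M + Matrix.vecMulVec f.ofLp f.ofLp) (b + y • f.ofLp)
      (P - (1 + quadForm P f)⁻¹ • Matrix.vecMulVec (P *ᵥ f.ofLp) (f.ofLp ᵥ* P))
      (θ + ((y - inner ℝ f θ) / (1 + quadForm P f)) • WithLp.toLp 2 (P *ᵥ f.ofLp)) := by
  obtain ⟨hM, hP, hθ⟩ := h
  have hMP : M * P = 1 := by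
    rw [hP, Matrix.mul_nonsing_inv _ ((Matrix.isUnit_iff_isUnit_det _).1 hM.isUnit)]
  have hPd : P.PosDef := hP ▸ hM.inv
  have hq : 0 ≤ quadForm P f := by
    have := hPd.posSemidef.dotProduct_mulVec_nonneg f.ofLp
    simpa [quadForm] using this
  set q := quadForm P f with hqd
  have hq1 : (1 + q) ≠ 0 := by positivity
  have hPf : M *ᵥ (P *ᵥ f.ofLp) = f.ofLp := by rw [Matrix.mulVec_mulVec, hMP, Matrix.one_mulVec]
  have hdot : f.ofLp ⬝ᵥ (P *ᵥ f.ofLp) = q := rfl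
  refine ⟨?_, ?_, ?_⟩
  · refine hM.add_posSemidef ?_
    simpa using Matrix.posSemidef_vecMulVec_self_star f.ofLp
  · symm
    refine Matrix.inv_eq_right_inv ?_
    rw [Matrix.add_mul, Matrix.mul_sub, Matrix.mul_sub, hMP, Matrix.mul_smul, Matrix.mul_smul,
      Matrix.mul_vecMulVec, hPf, Matrix.vecMulVec_mul, Matrix.vecMulVec_mul_vecMulVec, hdot]
    rw [Matrix.vecMulVec_smul, smul_smul]
    set V := Matrix.vecMulVec f.ofLp (f.ofLp ᵥ* P)
    -- In the product of the new matrix with its claimed inverse, the multiples of `V` have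
    -- coefficients `1`, `-(1 + q)⁻¹` and `-(1 + q)⁻¹ * q`, and they cancel.
    have : (1 + q)⁻¹ • V + ((1 + q)⁻¹ * q) • V = V := by
      rw [← add_smul, show (1 + q)⁻¹ + (1 + q)⁻¹ * q = 1 by field_simp, one_smul]
    ext i j
    have hij := congrFun (congrFun this i) j
    simp only [Matrix.add_apply, Matrix.sub_apply, Matrix.smul_apply, smul_eq_mul] at hij ⊢
    linarith
  · have hin : (inner ℝ f θ : ℝ) = f.ofLp ⬝ᵥ θ.ofLp := by
      rw [EuclideanSpace.inner_eq_star_dotProduct, dotProduct_comm]; simp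
    rw [WithLp.ofLp_add, WithLp.ofLp_smul, Matrix.mulVec_add, Matrix.add_mulVec, Matrix.add_mulVec,
      hθ, Matrix.mulVec_smul, Matrix.mulVec_smul, hPf, Matrix.vecMulVec_mulVec,
      Matrix.vecMulVec_mulVec, hdot, hin]
    ext i
    simp
    field_simp
    ring

/-- The regularized squared loss of a finite data set. -/
noncomputable def ridgeLoss (lam : ℝ) (I : Finset ℕ) (f : ℕ → EuclideanSpace ℝ (Fin d)) (y : ℕ → ℝ)
    (θ : EuclideanSpace ℝ (Fin d)) : ℝ :=
  ∑ k ∈ I, (y k - inner ℝ (f k) θ) ^ 2 + lam * ‖θ‖ ^ 2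

/-- The regularized empirical second moment matrix. -/
def gram (lam : ℝ) (I : Finset ℕ) (f : ℕ → EuclideanSpace ℝ (Fin d)) :
    Matrix (Fin d) (Fin d) ℝ :=
  lam • 1 + ∑ k ∈ I, Matrix.vecMulVec (f k).ofLp (f k).ofLp

theorem inner_eq_dotProduct (x y : EuclideanSpace ℝ (Fin d)) :
    (inner ℝ x y : ℝ) = x.ofLp ⬝ᵥ y.ofLp := by
  rw [EuclideanSpace.inner_eq_star_dotProduct, dotProduct_comm]; simp

theorem norm_sq_eq_dotProduct (x : EuclideanSpace ℝ (Fin d)) : ‖x‖ ^ 2 = x.ofLp ⬝ᵥ x.ofLp := by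
  rw [← inner_eq_dotProduct, real_inner_self_eq_norm_sq]

theorem quadForm_gram (lam : ℝ) (I : Finset ℕ) (f : ℕ → EuclideanSpace ℝ (Fin d))
    (θ : EuclideanSpace ℝ (Fin d)) :
    quadForm (gram lam I f) θ = lam * ‖θ‖ ^ 2 + ∑ k ∈ I, (inner ℝ (f k) θ : ℝ) ^ 2 := by
  rw [quadForm, gram, Matrix.add_mulVec, dotProduct_add, Matrix.smul_mulVec, Matrix.one_mulVec,
    dotProduct_smul, ← norm_sq_eq_dotProduct, smul_eq_mul, Matrix.sum_mulVec, dotProduct_sum]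
  congr 1
  refine Finset.sum_congr rfl fun k _ => ?_
  rw [Matrix.vecMulVec_mulVec, inner_eq_dotProduct]
  simp [dotProduct_comm θ.ofLp (f k).ofLp, sq]

theorem quadForm_sub {M : Matrix (Fin d) (Fin d) ℝ} (hM : M.IsHermitian)
    (u v : EuclideanSpace ℝ (Fin d)) :
    quadForm M (u - v) = quadForm M u - 2 * (u.ofLp ⬝ᵥ (M *ᵥ v.ofLp)) + quadForm M v := by
  have hs : v.ofLp ⬝ᵥ (M *ᵥ u.ofLp) = u.ofLp ⬝ᵥ (M *ᵥ v.ofLp) := by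
    rw [Matrix.dotProduct_mulVec, ← Matrix.mulVec_transpose, dotProduct_comm]
    have : Mᵀ = M := by simpa [Matrix.IsHermitian] using hM
    rw [this]
  simp only [quadForm, WithLp.ofLp_sub, Matrix.mulVec_sub, dotProduct_sub, sub_dotProduct, hs]
  ring

/-- Completing the square: by the normal equations, the weighted distance to the unconstrained
solution and the ridge loss differ by a term without `θ`. So projecting in this norm is the same as
constrained ridge regression. -/
theorem quadForm_sub_eq_ridgeLoss {lam : ℝ} {I : Finset ℕ} {f : ℕ → EuclideanSpace ℝ (Fin d)}
    {y : ℕ → ℝ} {P : Matrix (Fin d) (Fin d) ℝ} {x : EuclideanSpace ℝ (Fin d)}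
    (h : IsRidge (gram lam I f) (∑ k ∈ I, y k • (f k).ofLp) P x) (θ : EuclideanSpace ℝ (Fin d)) :
    quadForm (gram lam I f) (θ - x) =
      ridgeLoss lam I f y θ + (quadForm (gram lam I f) x - ∑ k ∈ I, y k ^ 2) := by
  rw [quadForm_sub h.1.isHermitian, h.2.2, quadForm_gram, dotProduct_sum, ridgeLoss]
  have : ∑ k ∈ I, (y k - (inner ℝ (f k) θ : ℝ)) ^ 2 = ∑ k ∈ I, y k ^ 2 -
      2 * ∑ k ∈ I, θ.ofLp ⬝ᵥ (y k • (f k).ofLp) + ∑ k ∈ I, (inner ℝ (f k) θ : ℝ) ^ 2 := by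
    rw [Finset.mul_sum, ← Finset.sum_sub_distrib, ← Finset.sum_add_distrib]
    refine Finset.sum_congr rfl fun k _ => ?_
    rw [dotProduct_smul, dotProduct_comm, ← inner_eq_dotProduct, smul_eq_mul]
    ring
  rw [this]
  ring

/-- Compactness of the ball yields a minimizer for every matrix, so the choice operator in
`projBall` always returns one. -/
theorem projBall_spec (M : Matrix (Fin d) (Fin d) ℝ) (x : EuclideanSpace ℝ (Fin d)) :
    ‖projBall M x‖ ≤ 1 ∧ ∀ ϑ : EuclideanSpace ℝ (Fin d), ‖ϑ‖ ≤ 1 →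
      quadForm M (projBall M x - x) ≤ quadForm M (ϑ - x) := by
  have hc : Continuous fun θ : EuclideanSpace ℝ (Fin d) => quadForm M (θ - x) := by
    unfold quadForm dotProduct Matrix.mulVec dotProduct
    fun_prop
  obtain ⟨θ, hθ, hmin⟩ := (isCompact_closedBall (0 : EuclideanSpace ℝ (Fin d)) 1).exists_isMinOn
    ⟨0, by simp⟩ hc.continuousOn
  exact Classical.epsilon_spec (p := fun θ : EuclideanSpace ℝ (Fin d) =>
    ‖θ‖ ≤ 1 ∧ ∀ ϑ : EuclideanSpace ℝ (Fin d), ‖ϑ‖ ≤ 1 → quadForm M (θ - x) ≤ quadForm M (ϑ - x))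
    ⟨θ, by simpa using hθ, fun ϑ hϑ => hmin (by simpa using hϑ)⟩

theorem IsRidge.projBall_le {lam : ℝ} {I : Finset ℕ} {f : ℕ → EuclideanSpace ℝ (Fin d)}
    {y : ℕ → ℝ} {P : Matrix (Fin d) (Fin d) ℝ} {x : EuclideanSpace ℝ (Fin d)}
    (h : IsRidge (gram lam I f) (∑ k ∈ I, y k • (f k).ofLp) P x) {ϑ : EuclideanSpace ℝ (Fin d)}
    (hϑ : ‖ϑ‖ ≤ 1) : ridgeLoss lam I f y (projBall P⁻¹ x) ≤ ridgeLoss lam I f y ϑ := by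
  have hP : P⁻¹ = gram lam I f := by
    rw [h.2.1, Matrix.nonsing_inv_nonsing_inv]
    exact (Matrix.isUnit_iff_isUnit_det _).1 h.1.isUnit
  have := (projBall_spec P⁻¹ x).2 ϑ hϑ
  rw [hP, quadForm_sub_eq_ridgeLoss h, quadForm_sub_eq_ridgeLoss h] at this
  rw [hP]
  linarith

end Ridge

/-! ### What the algorithm computes -/

namespace S3State

variable {S A : Type*} {d : ℕ} [Fintype A] [Nonempty A]

/-- The predicted value of the next state, when the next network has the parameter `w`. -/
noncomputable def nextMax (H : ℕ) (φ : Feature S A d) (h : ℕ) (w : EuclideanSpace ℝ (Fin d))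
    (s : S) : ℝ :=
  maxOver fun a => if h + 1 < H then inner ℝ (φ (h + 1) s a) w else 0

theorem maxOver_linQ (H : ℕ) (φ : Feature S A d) (θ : ℕ → EuclideanSpace ℝ (Fin d)) (h : ℕ)
    (s : S) : maxOver (linQ H φ θ (h + 1) s) = nextMax H φ h (θ (h + 1)) s := rfl

/-- The updates of one trajectory touch only `theta` and `covInv`, each stage once. -/
theorem foldl_update (H : ℕ) (φ : Feature S A d) (τ : Fin H → Step S A) (l : List (Fin H))
    (hl : l.Nodup) : ∀ st : S3State d,
    let st' := l.foldl (fun (st : S3State d) (h : Fin H) => update H φ h (τ h) st) st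
    (st'.epochs = st.epochs ∧ st'.level = st.level ∧ st'.count = st.count ∧
      st'.target = st.target ∧ st'.best = st.best) ∧
    (∀ h ∈ l, st'.theta h = (update H φ h (τ h) st).theta h ∧
      st'.covInv h = (update H φ h (τ h) st).covInv h) ∧
    (∀ h : ℕ, (∀ j ∈ l, (j : ℕ) ≠ h) → st'.theta h = st.theta h ∧ st'.covInv h = st.covInv h) := by
  induction l with
  | nil => intro st; simp
  | cons j l ih =>
    intro st
    obtain ⟨hj, hl⟩ := List.nodup_cons.1 hl
    obtain ⟨h1, h2, h3⟩ := ih hl (update H φ j (τ j) st)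
    refine ⟨h1, ?_, ?_⟩
    · intro h hh
      rcases List.mem_cons.1 hh with rfl | hh
      · exact h3 h fun i hi hne => hj (by rwa [← Fin.ext hne])
      · have hne : (h : ℕ) ≠ j := fun e => hj (by rwa [← Fin.ext e])
        have := h2 h hh
        simp only [List.foldl_cons]
        rw [this.1, this.2]
        simp [update, Function.update_of_ne hne]
    · intro h hh
      have := h3 h fun i hi => hh i (List.mem_cons_of_mem _ hi)
      have hne : h ≠ j := fun e => hh j List.mem_cons_self e.symm
      simp only [List.foldl_cons]
      rw [this.1, this.2]
      simp [update, Function.update_of_ne hne]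

variable {H : ℕ}

/-- The feature vector at stage `h` of the trajectory `k`. -/
def dataFeature (φ : Feature S A d) (τ : ℕ → Fin H → Step S A) (h : Fin H) (k : ℕ) :
    EuclideanSpace ℝ (Fin d) :=
  φ h (τ k h).1 (τ k h).2.1

/-- The regression target at stage `h` of the trajectory `k`. -/
noncomputable def dataTarget (φ : Feature S A d) (τ : ℕ → Fin H → Step S A) (h : Fin H)
    (w : EuclideanSpace ℝ (Fin d)) (k : ℕ) : ℝ :=
  (τ k h).2.2.1 + nextMax H φ h w (τ k h).2.2.2

/-- `θ` minimizes the regularized loss over the unit ball. -/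
def IsFitted (φ : Feature S A d) (lam : ℝ) (τ : ℕ → Fin H → Step S A) (I : Finset ℕ) (h : Fin H)
    (w θ : EuclideanSpace ℝ (Fin d)) : Prop :=
  ∀ ϑ : EuclideanSpace ℝ (Fin d), ‖ϑ‖ ≤ 1 →
    ridgeLoss lam I (dataFeature φ τ h) (dataTarget φ τ h w) θ ≤
      ridgeLoss lam I (dataFeature φ τ h) (dataTarget φ τ h w) ϑ

/-- The index of the first trajectory that is played at level `h` of epoch `e`. -/
def batchStart (H e h : ℕ) : ℕ := H * (2 ^ e - 2) + (H - 1 - h) * 2 ^ e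

/-- The trajectories that are played at level `h` of epoch `e`. -/
def batch (H e h : ℕ) : Finset ℕ := Finset.Ico (batchStart H e h) (batchStart H e h + 2 ^ e)

theorem card_batch (H e h : ℕ) : (batch H e h).card = 2 ^ e := by simp [batch]

theorem batchStart_pred (H e l : ℕ) (hl : l < H) (h0 : l ≠ 0) :
    batchStart H e (l - 1) = batchStart H e l + 2 ^ e := by
  rw [batchStart, batchStart, show H - 1 - (l - 1) = (H - 1 - l) + 1 by omega]
  ring

theorem batchStart_succ (H e : ℕ) (hH : 1 ≤ H) :
    batchStart H (e + 2) (H - 1) = batchStart H (e + 1) 0 + 2 ^ (e + 1) := by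
  -- The substitution removes the truncated subtractions in `batchStart`.
  obtain ⟨q, hq⟩ : ∃ q, 2 ^ (e + 1) = q + 2 := ⟨2 ^ (e + 1) - 2, by
    have : 2 ^ 1 ≤ 2 ^ (e + 1) := Nat.pow_le_pow_right (by norm_num) (by omega)
    omega⟩
  obtain ⟨m, rfl⟩ : ∃ m, H = m + 1 := ⟨H - 1, by omega⟩
  rw [batchStart, batchStart, show 2 ^ (e + 2) = 2 * 2 ^ (e + 1) by ring, hq]
  simp only [Nat.add_sub_cancel, Nat.sub_self, Nat.sub_zero]
  rw [show 2 * (q + 2) - 2 = 2 * q + 2 by omega]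
  ring

/-- The state of the algorithm between two trajectories. -/
structure Invariant (φ : Feature S A d) (lam : ℝ) (τ : ℕ → Fin H → Step S A) (K : ℕ)
    (st : S3State d) : Prop where
  level_lt : st.level < H
  count_lt : st.count < 2 ^ (st.epochs + 1)
  index_eq : K = batchStart H (st.epochs + 1) st.level + st.count
  norm_target_le : ∀ h, ‖st.target h‖ ≤ 1
  norm_best_le : ∀ h, ‖st.best h‖ ≤ 1
  target_fitted : ∀ h : Fin H, st.level < h →
    IsFitted φ lam τ (batch H (st.epochs + 1) h) h (st.target (h + 1)) (st.target h)
  best_fitted : 1 ≤ st.epochs → ∀ h : Fin H,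
    IsFitted φ lam τ (batch H st.epochs h) h (st.best (h + 1)) (st.best h)
  ridge : 0 < st.count → IsRidge
    (gram lam (Finset.Ico (K - st.count) K) (dataFeature φ τ ⟨st.level, level_lt⟩))
    (∑ k ∈ Finset.Ico (K - st.count) K,
      dataTarget φ τ ⟨st.level, level_lt⟩ (st.target (st.level + 1)) k •
        (dataFeature φ τ ⟨st.level, level_lt⟩ k).ofLp)
    (st.covInv st.level) (st.theta st.level)

theorem isRidge_empty {lam : ℝ} (hlam : 0 < lam) :
    IsRidge (lam • (1 : Matrix (Fin d) (Fin d) ℝ)) 0 (lam⁻¹ • 1) 0 := by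
  refine ⟨Matrix.PosDef.one.smul hlam, ?_, by simp⟩
  symm
  refine Matrix.inv_eq_right_inv ?_
  rw [Matrix.smul_mul, Matrix.mul_smul, smul_smul, mul_inv_cancel₀ hlam.ne']
  simp

theorem Invariant.start {φ : Feature S A d} {lam : ℝ} {τ : ℕ → Fin H → Step S A} (hH : 1 ≤ H) :
    Invariant φ lam τ 0 (S3State.start d H lam) where
  level_lt := by simp only [S3State.start]; omega
  count_lt := by simp [S3State.start]
  index_eq := by simp [S3State.start, batchStart]
  norm_target_le := by simp [S3State.start]
  norm_best_le := by simp [S3State.start]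
  target_fitted := by
    intro h hh
    simp only [S3State.start] at hh
    omega
  best_fitted := by simp [S3State.start]
  ridge := by simp [S3State.start]

/-- While a batch is played the targets are frozen, so the network of the current level undergoes
Sherman-Morrison updates for one fixed regression problem. The networks of the other stages also
move, but nothing is claimed about them, because a level is reset before its own batch. A full batch
is turned into a constrained minimizer by the projection, and levels fitted earlier in the epoch
remain fitted since neither their parameters nor those of their next stages are overwritten. -/
theorem Invariant.step {φ : Feature S A d} {lam : ℝ} (hlam : 0 < lam)
    {τ : ℕ → Fin H → Step S A} {K : ℕ} {st : S3State d} (hi : Invariant φ lam τ K st) :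
    Invariant φ lam τ (K + 1) (trajectory φ lam (τ K) st) := by
  have hH : 1 ≤ H := by have := hi.level_lt; omega
  have hlev := hi.level_lt
  have hKc : st.count ≤ K := by rw [hi.index_eq]; exact Nat.le_add_left _ _
  set L : Fin H := ⟨st.level, hlev⟩ with hL
  set st₀ := if st.count = 0 then reset lam st else st with hst₀
  have h₀ : st₀.epochs = st.epochs ∧ st₀.level = st.level ∧ st₀.count = st.count ∧
      st₀.target = st.target ∧ st₀.best = st.best := by
    rw [hst₀]; split_ifs <;> simp [reset]
  have hr₀ : IsRidge (gram lam (Finset.Ico (K - st.count) K) (dataFeature φ τ L))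
      (∑ k ∈ Finset.Ico (K - st.count) K, dataTarget φ τ L (st.target (st.level + 1)) k •
        (dataFeature φ τ L k).ofLp) (st₀.covInv st.level) (st₀.theta st.level) := by
    -- At count zero the variables of the level are stale, and the reset makes them the ridge
    -- solution of the empty data set.
    by_cases hc : st.count = 0
    · rw [hst₀, if_pos hc, hc]
      simpa [reset, gram] using isRidge_empty hlam
    · rw [hst₀, if_neg hc]
      exact hi.ridge (Nat.pos_of_ne_zero hc)
  set st₁ := (List.finRange H).foldl
    (fun (st : S3State d) (h : Fin H) => update H φ h (τ K h) st) st₀ with hst₁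
  obtain ⟨h₁, h₂, -⟩ := foldl_update H φ (τ K) _ (List.nodup_finRange H) st₀
  rw [← hst₁] at h₁ h₂
  obtain ⟨e1, e2, e3, e4, e5⟩ := h₁
  obtain ⟨z1, z2, z3, z4, z5⟩ := h₀
  rw [z1] at e1; rw [z2] at e2; rw [z3] at e3; rw [z4] at e4; rw [z5] at e5
  have hr₁ : IsRidge (gram lam (Finset.Ico (K - st.count) (K + 1)) (dataFeature φ τ L))
      (∑ k ∈ Finset.Ico (K - st.count) (K + 1),
        dataTarget φ τ L (st.target (st.level + 1)) k • (dataFeature φ τ L k).ofLp)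
      (st₁.covInv st.level) (st₁.theta st.level) := by
    have hu := hr₀.update (dataFeature φ τ L K) (dataTarget φ τ L (st.target (st.level + 1)) K)
    have hL2 := h₂ L (List.mem_finRange L)
    have eqL : (L : ℕ) = st.level := rfl
    rw [eqL] at hL2
    rw [hL2.1, hL2.2]
    rw [gram, Finset.sum_Ico_succ_top (by omega), Finset.sum_Ico_succ_top (by omega), ← add_assoc]
    simp only [update, Function.update_self, maxOver_linQ, z4]
    exact hu
  have htraj : trajectory φ lam (τ K) st = finish H st₁ := rfl
  rw [htraj, finish, e1, e2, e3, e4]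
  split_ifs with hc hl
  · refine ⟨by simpa [e2] using hlev, by simpa [e1] using hc, ?_, ?_, ?_, ?_, ?_, ?_⟩
    · rw [hi.index_eq]; ring
    · simpa [e4] using hi.norm_target_le
    · simpa [e5] using hi.norm_best_le
    · simpa [e1, e2, e4] using hi.target_fitted
    · simpa [e1, e5] using hi.best_fitted
    · intro _
      rw [show K + 1 - (st.count + 1) = K - st.count by omega]
      exact hr₁
  all_goals
    have hcount : st.count + 1 = 2 ^ (st.epochs + 1) := by have := hi.count_lt; omega
    -- The trajectories since the reset, including the present one, are exactly the prescribed
    -- batch.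
    have hI : Finset.Ico (K - st.count) (K + 1) = batch H (st.epochs + 1) st.level := by
      rw [batch, ← hcount]
      congr 1 <;> have := hi.index_eq <;> omega
    rw [hI] at hr₁
    set t : ℕ → EuclideanSpace ℝ (Fin d) := Function.update st.target st.level
      (projBall (st₁.covInv st.level)⁻¹ (st₁.theta st.level)) with ht
    have htn : ∀ h, ‖t h‖ ≤ 1 := by
      intro h
      by_cases hh : h = st.level
      · subst hh; rw [ht, Function.update_self]; exact (projBall_spec _ _).1
      · rw [ht, Function.update_of_ne hh]; exact hi.norm_target_le h
    have htf : ∀ h : Fin H, st.level ≤ h →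
        IsFitted φ lam τ (batch H (st.epochs + 1) h) h (t (h + 1)) (t h) := by
      intro h hh
      -- Only the target at `st.level ≤ h` is overwritten, so the next-stage target used in the fit
      -- is still in place.
      have e6 : t (h + 1) = st.target (h + 1) := by rw [ht, Function.update_of_ne (by omega)]
      rw [e6]
      rcases hh.eq_or_lt with hh | hh
      · obtain rfl : L = h := Fin.ext hh
        intro ϑ hϑ
        change _ ≤ ridgeLoss lam (batch H (st.epochs + 1) st.level) _
          (dataTarget φ τ L (st.target (st.level + 1))) ϑ
        have e7 : t (L : ℕ) = projBall (st₁.covInv st.level)⁻¹ (st₁.theta st.level) := by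
          rw [ht]; exact Function.update_self _ _ _
        rw [e7]
        exact hr₁.projBall_le hϑ
      · have e7 : t h = st.target h := by rw [ht, Function.update_of_ne (by omega)]
        rw [e7]
        exact hi.target_fitted h hh
  · refine ⟨by simp only; omega, by simp, ?_, htn, htn, ?_, ?_, by simp⟩
    · simp only [add_zero]
      rw [batchStart_succ H st.epochs hH, hi.index_eq, hl, ← hcount]
      ring
    · intro h hh
      simp only at hh
      omega
    · intro _ h
      exact htf h (by omega)
  · refine ⟨by simp only; omega, by simp, ?_, htn, by simpa [e5] using hi.norm_best_le,
      ?_, by simpa [e1, e5] using hi.best_fitted, by simp⟩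
    · simp only [add_zero]
      rw [batchStart_pred H _ _ hlev hl, hi.index_eq, ← hcount]
      ring
    · intro h hh
      simp only at hh
      simpa using htf h (by omega)

theorem invariant_run {φ : Feature S A d} {lam : ℝ} (hlam : 0 < lam) (hH : 1 ≤ H)
    (τ : ℕ → Fin H → Step S A) (K : ℕ) : Invariant φ lam τ K (run φ lam τ K) := by
  induction K with
  | zero => exact Invariant.start hH
  | succ K ih => exact ih.step hlam

/-- The size of the batches of the last completed epoch is comparable with `n = K / (4 H)`. -/
theorem Invariant.size_bounds {φ : Feature S A d} {lam : ℝ} {τ : ℕ → Fin H → Step S A} {K : ℕ}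
    {st : S3State d} (hi : Invariant φ lam τ K st) (hK : 2 * H < K) :
    1 ≤ st.epochs ∧ (K : ℝ) ≤ 4 * H * 2 ^ st.epochs ∧ (H : ℝ) * 2 ^ st.epochs ≤ K := by
  have hlev := hi.level_lt
  have hc := hi.count_lt
  have hidx := hi.index_eq
  rw [batchStart] at hidx
  have h2 : 2 ≤ 2 ^ (st.epochs + 1) := by
    have : 2 ^ 1 ≤ 2 ^ (st.epochs + 1) := Nat.pow_le_pow_right (by norm_num) (by omega)
    omega
  have hlt : (H - 1 - st.level) * 2 ^ (st.epochs + 1) + 2 ^ (st.epochs + 1) ≤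
      H * 2 ^ (st.epochs + 1) := by
    rw [← Nat.succ_mul]
    exact Nat.mul_le_mul_right _ (by omega)
  have hmul : H * (2 ^ (st.epochs + 1) - 2) + H * 2 = H * 2 ^ (st.epochs + 1) := by
    rw [← Nat.mul_add, Nat.sub_add_cancel h2]
  -- The first epoch consists of `2 H` trajectories, so it is complete when `K > 2 H`.
  have he : 1 ≤ st.epochs := by
    by_contra h0
    have h0 : st.epochs = 0 := by omega
    rw [h0] at hidx hlt hc
    norm_num at hidx hlt hc
    omega
  -- The unfinished epoch has fewer than `H * 2 ^ (st.epochs + 1)` trajectories so far, and the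
  -- completed ones together have no more than that.
  have hup : K ≤ 2 * (H * 2 ^ (st.epochs + 1)) := by omega
  refine ⟨he, ?_, ?_⟩
  · have : (K : ℝ) ≤ 2 * (H * 2 ^ (st.epochs + 1)) := by exact_mod_cast hup
    refine this.trans (le_of_eq ?_)
    ring
  · have hlow : H * 2 ^ (st.epochs) ≤ K := by
      have e1 : H * 2 ^ (st.epochs + 1) = H * 2 ^ st.epochs + H * 2 ^ st.epochs := by ring
      have e2 : H * 2 ≤ H * 2 ^ st.epochs := Nat.mul_le_mul_left _ (by
        calc 2 = 2 ^ 1 := rfl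
          _ ≤ _ := Nat.pow_le_pow_right (by norm_num) he)
      omega
    exact_mod_cast hlow

end S3State

/-! ### Guarantees for the learned action-value functions -/

section CauchySchwarz

variable {d : ℕ}

/-- The quadratic polynomial `t ↦ quadForm M (u - t • M⁻¹ x)` is nonnegative, so its discriminant is
nonpositive. -/
theorem abs_inner_le_weightedNorm_mul {M : Matrix (Fin d) (Fin d) ℝ} (hM : M.PosDef)
    (x u : EuclideanSpace ℝ (Fin d)) :
    |(inner ℝ x u : ℝ)| ≤ weightedNorm M⁻¹ x * √(quadForm M u) := by
  have hdet := (Matrix.isUnit_iff_isUnit_det _).1 hM.isUnit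
  set g : EuclideanSpace ℝ (Fin d) := WithLp.toLp 2 (M⁻¹ *ᵥ x.ofLp) with hg
  have hMg : M *ᵥ g.ofLp = x.ofLp := by
    rw [hg, Matrix.mulVec_mulVec, Matrix.mul_nonsing_inv _ hdet, Matrix.one_mulVec]
  have hgg : quadForm M g = quadForm M⁻¹ x := by
    rw [quadForm, hMg, dotProduct_comm]; rfl
  have hpos : ∀ v, 0 ≤ quadForm M v := fun v => by
    simpa [quadForm] using hM.posSemidef.dotProduct_mulVec_nonneg v.ofLp
  have key : ∀ t : ℝ, 0 ≤ quadForm M⁻¹ x * (t * t) + (-2 * inner ℝ x u) * t + quadForm M u := by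
    intro t
    have h := hpos (u - t • g)
    rw [quadForm_sub hM.isHermitian, WithLp.ofLp_smul, Matrix.mulVec_smul, hMg, dotProduct_smul,
      dotProduct_comm, ← inner_eq_dotProduct] at h
    have h2 : quadForm M (t • g) = t * t * quadForm M g := by
      simp only [quadForm, WithLp.ofLp_smul, Matrix.mulVec_smul, dotProduct_smul,
        smul_dotProduct, smul_eq_mul]
      ring
    rw [h2, hgg, smul_eq_mul] at h
    linarith
  have hd := discrim_le_zero key
  rw [discrim] at hd
  rw [weightedNorm, ← Real.sqrt_mul (hgg ▸ hpos g)]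
  refine Real.abs_le_sqrt ?_
  linarith

theorem posDef_smul_add {G : Matrix (Fin d) (Fin d) ℝ} (hS : G.IsHermitian)
    (hq : ∀ x : EuclideanSpace ℝ (Fin d), 0 ≤ quadForm G x) {n lam : ℝ} (hn : 0 ≤ n)
    (hlam : 0 < lam) : (n • G + lam • (1 : Matrix (Fin d) (Fin d) ℝ)).PosDef := by
  refine Matrix.PosDef.posSemidef_add ?_ (Matrix.PosDef.one.smul hlam)
  refine Matrix.PosSemidef.smul (Matrix.PosSemidef.of_dotProduct_mulVec_nonneg hS fun x => ?_) hn
  simpa [quadForm] using hq (WithLp.toLp 2 x)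

theorem quadForm_smul_add (G : Matrix (Fin d) (Fin d) ℝ) (n lam : ℝ)
    (x : EuclideanSpace ℝ (Fin d)) :
    quadForm (n • G + lam • (1 : Matrix (Fin d) (Fin d) ℝ)) x =
      n * quadForm G x + lam * ‖x‖ ^ 2 := by
  rw [norm_sq_eq_dotProduct]
  simp [quadForm, Matrix.add_mulVec, Matrix.smul_mulVec, dotProduct_add, dotProduct_smul]

end CauchySchwarz

/-! ### The regression problem of a single stage. -/

section Stage

variable {S A : Type*} [MeasurableSpace S] [MeasurableSpace A] [DiscreteMeasurableSpace A]
  [Fintype A] [Nonempty A] {d : ℕ}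

theorem measurable_uncurry_of_discrete {E : Type*} [MeasurableSpace E] {g : S → A → E}
    (hg : ∀ a, Measurable fun s => g s a) : Measurable fun x : S × A => g x.1 x.2 :=
  measurable_from_prod_countable_left hg

/-- The reward, truncated to `[-1, 1]`. -/
def truncate (x : ℝ) : ℝ := max (-1) (min x 1)

theorem abs_truncate_le (x : ℝ) : |truncate x| ≤ 1 := by
  rw [abs_le, truncate]
  exact ⟨le_max_left _ _, max_le (by norm_num) (min_le_right _ _)⟩

theorem truncate_of_abs_le {x : ℝ} (hx : |x| ≤ 1) : truncate x = x := by
  rw [abs_le] at hx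
  rw [truncate, min_eq_left hx.2, max_eq_right hx.1]

theorem measurable_truncate : Measurable truncate := by
  unfold truncate; fun_prop

namespace MDP

open S3State

/-- The feature of a time step. -/
def stepFeature (φ : Feature S A d) (h : ℕ) (z : Step S A) : EuclideanSpace ℝ (Fin d) :=
  φ h z.1 z.2.1

/-- The regression target of a time step, with truncated reward. -/
noncomputable def stepTarget (H : ℕ) (φ : Feature S A d) (h : ℕ) (w : EuclideanSpace ℝ (Fin d))
    (z : Step S A) : ℝ :=
  truncate z.2.2.1 + nextMax H φ h w z.2.2.2

variable {φ : Feature S A d}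

section

variable {H : ℕ} (hφ : ∀ h < H, ∀ a, Measurable fun s => φ h s a)
  (hφ1 : ∀ h < H, ∀ s a, ‖φ h s a‖ ≤ 1)

include hφ in
theorem measurable_nextMax (h : ℕ) (w : EuclideanSpace ℝ (Fin d)) :
    Measurable (nextMax H φ h w) := by
  unfold nextMax
  refine measurable_maxOver fun a => ?_
  split_ifs with hh
  · exact (hφ _ hh a).inner_const
  · exact measurable_const

include hφ1 in
theorem abs_nextMax_sub_le (h : ℕ) (w v : EuclideanSpace ℝ (Fin d)) (s : S) :
    |nextMax H φ h w s - nextMax H φ h v s| ≤ ‖w - v‖ := by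
  unfold nextMax
  refine abs_maxOver_sub_le fun a => ?_
  split_ifs with hh
  · rw [← inner_sub_right]
    exact (abs_real_inner_le_norm _ _).trans
      (mul_le_of_le_one_left (norm_nonneg _) (hφ1 _ hh s a))
  · simp

theorem nextMax_zero (h : ℕ) (s : S) : nextMax H φ h 0 s = 0 := by
  simp [nextMax, maxOver_zero]

include hφ hφ1 in
-- Rewards are bounded only almost surely, whereas `IsRegression` asks for bounds everywhere; hence
-- the truncated target. Its bound `2` is the reward bound plus `‖w‖`.
theorem isRegression_step {h : ℕ} (hh : h < H) :
    IsRegression (stepFeature φ h) (stepTarget H φ h) where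
  measurable_feature := (measurable_uncurry_of_discrete (hφ h hh)).comp
    (by fun_prop : Measurable fun z : Step S A => (z.1, z.2.1))
  measurable_target w := by
    have := measurable_nextMax hφ h w
    have := measurable_truncate
    unfold stepTarget
    fun_prop
  norm_feature_le z := hφ1 h hh _ _
  abs_target_le w z hw := by
    have h1 := abs_truncate_le z.2.2.1
    have h2 := abs_nextMax_sub_le hφ1 h w 0 z.2.2.2
    rw [nextMax_zero, sub_zero, sub_zero] at h2
    refine (abs_add_le _ _).trans ?_
    linarith
  abs_target_sub_le w v z := by
    rw [stepTarget, stepTarget, add_sub_add_left_eq_sub]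
    exact abs_nextMax_sub_le hφ1 h w v _

end

theorem bddMeasurable_of_forall {N : ℕ} {f : ℕ → S → A → ℝ}
    (hf : ∀ k < N, (∀ a, Measurable fun s => f k s a) ∧ ∃ B, ∀ s a, |f k s a| ≤ B) :
    BddMeasurable N f := by
  choose! B hB using fun k hk => (hf k hk).2
  refine ⟨∑ k ∈ Finset.range N, |B k|, fun k hk =>
    ⟨measurable_uncurry_of_discrete (hf k hk).1, fun s a => ?_⟩⟩
  exact (hB k hk s a).trans ((le_abs_self _).trans
    (Finset.single_le_sum (f := fun k => |B k|) (fun i _ => abs_nonneg _)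
      (Finset.mem_range.2 hk)))

variable (M : MDP S A) (hφ : ∀ h < M.H, ∀ a, Measurable fun s => φ h s a)
  (hφ1 : ∀ h < M.H, ∀ s a, ‖φ h s a‖ ≤ 1)

include hφ hφ1 in
theorem bddMeasurable_inner {N : ℕ} (hN : N ≤ M.H) {v : ℕ → EuclideanSpace ℝ (Fin d)} :
    BddMeasurable N fun h s a => (inner ℝ (φ h s a) (v h) : ℝ) :=
  bddMeasurable_of_forall fun k hk => ⟨fun a => (hφ k (by omega) a).inner_const, ‖v k‖,
    fun s a => (abs_real_inner_le_norm _ _).trans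
      (mul_le_of_le_one_left (norm_nonneg _) (hφ1 k (by omega) s a))⟩

include hφ hφ1 in
theorem bddMeasurable_linQ (N : ℕ) (θ : ℕ → EuclideanSpace ℝ (Fin d)) :
    BddMeasurable N (linQ M.H φ θ) :=
  bddMeasurable_of_forall fun k _ => by
    by_cases hk : k < M.H
    · refine ⟨fun a => ?_, ‖θ k‖, fun s a => ?_⟩
      · simp only [linQ, if_pos hk]
        exact (hφ k hk a).inner_const
      · simp only [linQ, if_pos hk]
        exact (abs_real_inner_le_norm _ _).trans
          (mul_le_of_le_one_left (norm_nonneg _) (hφ1 k hk s a))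
    · refine ⟨fun a => ?_, 0, fun s a => ?_⟩
      · simp only [linQ, if_neg hk]
        exact measurable_const
      · simp [linQ, hk]

include hφ hφ1 in
-- The weighted norm is continuous in the feature vector, hence measurable, and bounded on the
-- compact unit ball. Nothing about the matrix is needed.
theorem bddMeasurable_uncertainty (κ : ℕ → Kernel S A) (lam c δ : ℝ) (K e : ℕ) :
    BddMeasurable M.H (uncertainty M φ κ lam c δ K e) := by
  refine bddMeasurable_of_forall fun k hk => ?_
  simp only [uncertainty, dif_pos hk]
  set G := (((K : ℝ) / (4 * M.H)) • M.covariance φ κ ⟨k, hk⟩ +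
    lam • (1 : Matrix (Fin d) (Fin d) ℝ))⁻¹
  set α := alphaCoeff c d e M.H lam (K / (4 * M.H)) (δ / (2 * M.H * e ^ 2 * d))
  have hc : Continuous fun x : EuclideanSpace ℝ (Fin d) => α * weightedNorm G x := by
    unfold weightedNorm quadForm dotProduct Matrix.mulVec dotProduct
    fun_prop
  refine ⟨fun a => hc.measurable.comp (hφ k hk a), ?_⟩
  obtain ⟨B, hB⟩ :=
    (isCompact_closedBall (0 : EuclideanSpace ℝ (Fin d)) 1).exists_bound_of_continuousOn
    hc.continuousOn
  exact ⟨B, fun s a => hB _ (by simpa using hφ1 k hk s a)⟩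

variable (κ : ℕ → Kernel S A) [∀ h, IsMarkovKernel (κ h)] (h : Fin M.H)

include hφ hφ1 in
-- This identifies the matrix quantity in the uncertainty with the second moment that the excess
-- loss controls.
theorem quadForm_covariance (u : EuclideanSpace ℝ (Fin d)) :
    quadForm (M.covariance φ κ h) u =
      ∫ z, (inner ℝ (stepFeature φ h z) u : ℝ) ^ 2 ∂(M.stepLaw κ h) := by
  have hr := isRegression_step hφ hφ1 h.2
  have hm : ∀ i, Measurable fun z : Step S A => stepFeature φ h z i := fun i =>
    (by fun_prop : Measurable fun x : EuclideanSpace ℝ (Fin d) => x i).comp hr.measurable_feature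
  have hb : ∀ i z, |stepFeature φ h z i| ≤ 1 := fun i z =>
    (by simpa using PiLp.norm_apply_le (stepFeature φ h z) i :
      |stepFeature φ h z i| ≤ ‖stepFeature φ h z‖).trans (hr.norm_feature_le z)
  have hint : ∀ i j, Integrable (fun z => stepFeature φ h z i * stepFeature φ h z j)
      (M.stepLaw κ h) := fun i j =>
    Integrable.of_bound ((hm i).mul (hm j)).aestronglyMeasurable 1
      (Filter.Eventually.of_forall fun z => by
        rw [Real.norm_eq_abs, abs_mul]
        exact mul_le_one₀ (hb i z) (abs_nonneg _) (hb j z))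
  have hcov : ∀ i j, M.covariance φ κ h i j =
      ∫ z, stepFeature φ h z i * stepFeature φ h z j ∂(M.stepLaw κ h) := fun i j => by
    exact (integral_map (μ := M.trajLaw κ) (measurable_pi_apply h).aemeasurable
      ((hm i).mul (hm j)).aestronglyMeasurable).symm
  have hsq : ∀ z, (inner ℝ (stepFeature φ h z) u : ℝ) ^ 2 =
      ∑ i, ∑ j, u i * (u j * (stepFeature φ h z i * stepFeature φ h z j)) := by
    intro z
    rw [inner_eq_dotProduct, sq, dotProduct, Finset.sum_mul_sum]
    refine Finset.sum_congr rfl fun i _ => Finset.sum_congr rfl fun j _ => ?_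
    ring
  simp_rw [hsq]
  rw [integral_finsetSum _ fun i _ => integrable_finsetSum _ fun j _ =>
    ((hint i j).const_mul _).const_mul _]
  simp only [quadForm, dotProduct, Matrix.mulVec]
  refine Finset.sum_congr rfl fun i _ => ?_
  rw [integral_finsetSum _ fun j _ => ((hint i j).const_mul _).const_mul _, Finset.mul_sum]
  refine Finset.sum_congr rfl fun j _ => ?_
  rw [integral_const_mul, integral_const_mul, hcov]
  ring

theorem isHermitian_covariance (φ : Feature S A d) (κ : ℕ → Kernel S A) :
    (M.covariance φ κ h).IsHermitian := by
  ext i j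
  simp [covariance, mul_comm]

/-- The Bellman backup is the conditional mean of the regression target. -/
theorem integral_inner_mul_stepTarget (hM : M.BoundedRewards)
    (hφ : ∀ h < M.H, ∀ a, Measurable fun s => φ h s a) (hφ1 : ∀ h < M.H, ∀ s a, ‖φ h s a‖ ≤ 1)
    (θ : ℕ → EuclideanSpace ℝ (Fin d)) (hθ : ‖θ (h + 1)‖ ≤ 1) (u : EuclideanSpace ℝ (Fin d)) :
    ∫ z, inner ℝ (stepFeature φ h z) u * stepTarget M.H φ h (θ (h + 1)) z ∂(M.stepLaw κ h) =
      ∫ z, inner ℝ (stepFeature φ h z) u * M.bellman h (linQ M.H φ θ (h + 1)) z.1 z.2.1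
        ∂(M.stepLaw κ h) := by
  have hr := isRegression_step hφ hφ1 h.2
  have hmF : Measurable fun z : Step S A =>
      (inner ℝ (stepFeature φ h z) u : ℝ) * stepTarget M.H φ h (θ (h + 1)) z :=
    (hr.measurable_inner u).mul (hr.measurable_target _)
  -- Reward and next state are resampled given state and action. The inner product depends only on
  -- the latter and leaves the inner integral.
  rw [M.integral_stepLaw κ h hmF]
  · refine integral_congr_ae (Filter.Eventually.of_forall fun z => ?_)
    simp only [stepFeature, stepTarget]
    rw [integral_const_mul]
    congr 1
    have hn := measurable_nextMax hφ (h : ℕ) (θ (h + 1))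
    have i1 : Integrable (fun p : ℝ × S => truncate p.1) (M.outcome h (z.1, z.2.1)) :=
      Integrable.of_bound (measurable_truncate.comp measurable_fst).aestronglyMeasurable 1
        (Filter.Eventually.of_forall fun p => abs_truncate_le _)
    have i2 : Integrable (fun p : ℝ × S => nextMax M.H φ h (θ (h + 1)) p.2)
        (M.outcome h (z.1, z.2.1)) :=
      Integrable.of_bound (hn.comp measurable_snd).aestronglyMeasurable 1
        (Filter.Eventually.of_forall fun p => by
          have := abs_nextMax_sub_le hφ1 h (θ (h + 1)) 0 p.2
          rw [nextMax_zero, sub_zero, sub_zero] at this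
          exact this.trans hθ)
    rw [integral_add i1 i2, integral_outcome_snd _ _ _ hn, bellman]
    congr 1
    have hfst : (M.outcome h (z.1, z.2.1)).map Prod.fst = M.rewardDist h (z.1, z.2.1) := by
      rw [outcome, Kernel.prod_apply, Measure.map_fst_prod]; simp
    rw [meanReward, ← integral_map (φ := Prod.fst) (f := truncate) (by fun_prop)
      measurable_truncate.aestronglyMeasurable, hfst]
    refine integral_congr_ae ?_
    filter_upwards [hM h h.2 z.1 z.2.1] with x hx using truncate_of_abs_le hx
  · refine Integrable.of_bound hmF.aestronglyMeasurable (‖u‖ * 2)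
      (Filter.Eventually.of_forall fun z => ?_)
    rw [Real.norm_eq_abs, abs_mul]
    exact mul_le_mul (hr.abs_inner_le u z) (hr.abs_target_le _ z hθ) (abs_nonneg _)
      (norm_nonneg u)

/-- The distance of a constrained least squares solution to the best fit, from the uniform
concentration inequality. -/
theorem covariance_error_le (hM : M.BoundedRewards)
    (hφ : ∀ h < M.H, ∀ a, Measurable fun s => φ h s a) (hφ1 : ∀ h < M.H, ∀ s a, ‖φ h s a‖ ≤ 1)
    {θ : ℕ → EuclideanSpace ℝ (Fin d)} (hθ : ∀ h, ‖θ h‖ ≤ 1) {ϑ : EuclideanSpace ℝ (Fin d)}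
    (hfit : M.IsBestFit φ κ h (linQ M.H φ θ (h + 1)) ϑ) {lam R : ℝ} (hlam : 0 < lam)
    {I : Finset ℕ} {τ : ℕ → Fin M.H → Step S A} (hrew : ∀ k, |(τ k h).2.2.1| ≤ 1)
    (hI : IsFitted φ lam τ I h (θ (h + 1)) (θ h))
    (hgood : ∀ w θ ϑ : EuclideanSpace ℝ (Fin d), ‖w‖ ≤ 1 → ‖θ‖ ≤ 1 → ‖ϑ‖ ≤ 1 →
      I.card * IsRegression.level (M.stepLaw κ h) (stepFeature φ h) (stepTarget M.H φ h) w θ ϑ -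
          R ≤ ∑ k ∈ I, excessLoss (stepFeature φ h) (stepTarget M.H φ h) w θ ϑ (τ k h)) :
    I.card * quadForm (M.covariance φ κ h) (θ h - ϑ) ≤ 2 * lam + 2 * R := by
  have hr := isRegression_step hφ hφ1 h.2
  have hϑ : ‖ϑ‖ ≤ 1 := by simpa using hfit.2
  obtain ⟨B, hB⟩ := M.bddMeasurable_bellman hM (M.bddMeasurable_linQ hφ hφ1 (M.H + 1) θ)
  have hmb : Measurable fun z : Step S A => M.bellman h (linQ M.H φ θ (h + 1)) z.1 z.2.1 :=
    (hB h h.2).1.comp (by fun_prop : Measurable fun z : Step S A => (z.1, z.2.1))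
  have hmin : IsMinOn (fun u : EuclideanSpace ℝ (Fin d) =>
      ∫ z, (inner ℝ (stepFeature φ h z) u - M.bellman h (linQ M.H φ θ (h + 1)) z.1 z.2.1) ^ 2
        ∂(M.stepLaw κ h)) (Metric.closedBall 0 1) ϑ := by
    convert hfit.1 using 2 with u
    exact integral_map (μ := M.trajLaw κ) (measurable_pi_apply h).aemeasurable
      (((hr.measurable_inner u).sub hmb).pow_const 2).aestronglyMeasurable
  have hvar := hr.integral_inner_sq_le_excess (M.stepLaw κ h) (hθ (h + 1)) (hθ h) hϑ hmb
    (fun z => (hB h h.2).2 _ _)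
    (M.integral_inner_mul_stepTarget κ h hM hφ hφ1 θ (hθ _)) hmin
  have hg := hgood _ _ _ (hθ (h + 1)) (hθ h) hϑ
  rw [IsRegression.level] at hg
  rw [M.quadForm_covariance hφ hφ1]
  set D := ∫ z, (inner ℝ (stepFeature φ h z) (θ h - ϑ) : ℝ) ^ 2 ∂(M.stepLaw κ h)
  have htar : ∀ k, dataTarget φ τ h (θ (h + 1)) k = stepTarget M.H φ h (θ (h + 1)) (τ k h) :=
    fun k => by rw [dataTarget, stepTarget, truncate_of_abs_le (hrew k)]
  -- The best fit is a competitor in the constrained ridge problem; its penalty is at most `lam`,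
  -- and the penalty of the minimizer is dropped.
  have hsum : ∑ k ∈ I, excessLoss (stepFeature φ h) (stepTarget M.H φ h) (θ (h + 1)) (θ h) ϑ
      (τ k h) ≤ lam := by
    have := hI ϑ hϑ
    rw [ridgeLoss, ridgeLoss] at this
    simp only [htar] at this
    have h1 : lam * ‖ϑ‖ ^ 2 ≤ lam :=
      mul_le_of_le_one_right hlam.le (pow_le_one₀ (norm_nonneg _) hϑ)
    have h2 : 0 ≤ lam * ‖θ h‖ ^ 2 := by positivity
    simp only [excessLoss, Finset.sum_sub_distrib]
    simp only [dataFeature] at this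
    simp only [stepFeature]
    linarith
  have hN : (0 : ℝ) ≤ I.card := by positivity
  -- With `N` samples, `N * D / 2 - R` is at most `N` times the level minus `R`, hence at most the
  -- empirical excess loss, hence at most `lam`.
  have := mul_le_mul_of_nonneg_left hvar hN
  nlinarith

end MDP

end Stage

/-! ### Constants in the confidence width. -/

section Budget

/-- The deviation terms are dominated by the square of the confidence width. -/
theorem deviation_le_log {d e H n N δ : ℝ} (hd : 1 ≤ d) (he : 1 ≤ e) (hH : 1 ≤ H) (hδ : 0 < δ)
    (hδ1 : δ < 1) (hn : 2 * H + 1 ≤ n * (4 * H)) (hN : 1 ≤ N) (hNn : N ≤ 4 * n) :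
    0 ≤ Real.log (d * n * e * H / (δ / (2 * H * e ^ 2 * d))) ∧
    72 * (3 * d * Real.log (3 * N * d) + Real.log (1 / (δ / (H * N)))) + 44 ≤
      2220 * (d * Real.log (d * n * e * H / (δ / (2 * H * e ^ 2 * d)))) := by
  have hn0 : 0 < n := by
    by_contra hcon
    have := mul_nonneg_of_nonpos_of_nonpos (not_lt.1 hcon) (by linarith : -(4 * H) ≤ 0)
    linarith
  set a := d * n * e * H / (δ / (2 * H * e ^ 2 * d)) with ha
  have haeq : a = (n * H) * (2 * H * e ^ 3 * d ^ 2) * δ⁻¹ := by rw [ha]; field_simp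
  have hδi : 1 ≤ δ⁻¹ := (one_le_inv₀ hδ).2 hδ1.le
  have he3 : 1 ≤ e ^ 3 := one_le_pow₀ he
  have hd2 : 1 ≤ d ^ 2 := one_le_pow₀ hd
  have hf : 1 ≤ H * e ^ 3 * d ^ 2 := one_le_mul_of_one_le_of_one_le
    (one_le_mul_of_one_le_of_one_le hH he3) hd2
  -- From `K > 2 H` one gets `4 n H ≥ 2 H + 1 ≥ 3`, so `n H ≥ 3 / 4`. A lower bound above `1` lets
  -- `Real.log a` absorb additive constants.
  have ha15 : 3 / 2 ≤ a := by
    have h1 : 3 / 4 ≤ n * H := by linarith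
    calc (3 / 2 : ℝ) = 3 / 4 * (2 * 1) * 1 := by norm_num
      _ ≤ (n * H) * (2 * (H * e ^ 3 * d ^ 2)) * δ⁻¹ := by gcongr
      _ = a := by rw [haeq]; ring
  have ha0 : 0 < a := by linarith
  have hlog13 : 1 / 3 ≤ Real.log a := by
    have h1 := Real.one_sub_inv_le_log_of_pos (by norm_num : (0 : ℝ) < 3 / 2)
    have h2 := Real.log_le_log (by norm_num) ha15
    norm_num at h1
    linarith
  -- Numerical factors cost multiples of `Real.log a`, because `3 / 2 ≤ a`. Below, `12 ≤ (3 / 2) ^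
  -- 7` and `4 ≤ (3 / 2) ^ 4` give the multiples `8` and `5`.
  have hscale : ∀ (x : ℝ) (m : ℕ), 0 < x → x ≤ (3 / 2) ^ m * a →
      Real.log x ≤ (m + 1) * Real.log a := by
    intro x m hx hxa
    refine (Real.log_le_log hx hxa).trans ?_
    rw [Real.log_mul (by positivity) ha0.ne', Real.log_pow]
    have := mul_le_mul_of_nonneg_left (Real.log_le_log (by norm_num) ha15)
      (Nat.cast_nonneg (α := ℝ) m)
    linarith
  have h1 : Real.log (3 * N * d) ≤ 8 * Real.log a := by
    have hnd : n * d ≤ a := by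
      have h2 : d ≤ 2 * H * e ^ 3 * d ^ 2 := by
        calc d ≤ 1 * d ^ 2 := by rw [one_mul]; exact le_self_pow₀ hd two_ne_zero
          _ ≤ (2 * (H * e ^ 3)) * d ^ 2 := by
              gcongr
              linarith [one_le_mul_of_one_le_of_one_le hH he3]
          _ = 2 * H * e ^ 3 * d ^ 2 := by ring
      rw [haeq]
      calc n * d = n * 1 * d * 1 := by ring
        _ ≤ (n * H) * (2 * H * e ^ 3 * d ^ 2) * δ⁻¹ := by gcongr
    have := hscale (3 * N * d) 7 (by positivity) (by
      calc 3 * N * d ≤ 3 * (4 * n) * d := by gcongr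
        _ = 12 * (n * d) := by ring
        _ ≤ (3 / 2) ^ 7 * a := by
            refine mul_le_mul (by norm_num) hnd (by positivity) (by positivity))
    norm_num at this
    exact this
  have h2 : Real.log (1 / (δ / (H * N))) ≤ 5 * Real.log a := by
    have hnd : n * H * δ⁻¹ ≤ a := by
      rw [haeq]
      have : 1 ≤ 2 * H * e ^ 3 * d ^ 2 := by linarith
      exact mul_le_mul_of_nonneg_right (le_mul_of_one_le_right (by positivity) this)
        (by positivity)
    have := hscale (1 / (δ / (H * N))) 4 (by positivity) (by
      calc 1 / (δ / (H * N)) = H * N * δ⁻¹ := by field_simp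
        _ ≤ H * (4 * n) * δ⁻¹ := by gcongr
        _ = 4 * (n * H * δ⁻¹) := by ring
        _ ≤ (3 / 2) ^ 4 * a := by
            refine mul_le_mul (by norm_num) hnd (by positivity) (by positivity))
    norm_num at this ⊢
    exact this
  have hla : 0 ≤ Real.log a := by linarith
  refine ⟨hla, ?_⟩
  -- The total is `72 * (3 * 8 + 5) + 44 * 3 = 2220`, where the last term uses `1 / 3 ≤ Real.log a`.
  have h3 : 3 * d * Real.log (3 * N * d) ≤ 3 * d * (8 * Real.log a) := by gcongr
  have h4 : Real.log a ≤ d * Real.log a := le_mul_of_one_le_left hla hd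
  linarith

end Budget

/-! ### The good event and the performance guarantee. -/

section Performance

open S3State MDP

variable {S A Ω : Type*} [MeasurableSpace S] [MeasurableSpace A] [DiscreteMeasurableSpace A]
  [Fintype A] [Nonempty A] [MeasurableSpace Ω]

/-- The event on which the regressions of all levels and all epochs concentrate. -/
theorem exists_concentration_event (M : MDP S A) {d : ℕ} {φ : Feature S A d}
    {κ : ℕ → Kernel S A} [∀ h, IsMarkovKernel (κ h)] {δ : ℝ} {P : Measure Ω}
    [IsProbabilityMeasure P] {X : ℕ → Ω → Fin M.H → Step S A} (hH : 1 ≤ M.H) (hd : 1 ≤ d)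
    (hδ : 0 < δ) (hM : M.BoundedRewards)
    (hφ : ∀ h < M.H, ∀ a, Measurable fun s => φ h s a) (hφ1 : ∀ h < M.H, ∀ s a, ‖φ h s a‖ ≤ 1)
    (hX : ∀ k, Measurable (X k)) (hlaw : ∀ k, P.map (X k) = M.trajLaw κ) (hind : iIndepFun X P) :
    ∃ E : Set Ω, MeasurableSet E ∧ ENNReal.ofReal (1 - δ) ≤ P E ∧ ∀ ω ∈ E,
      (∀ k (h : Fin M.H), |(X k ω h).2.2.1| ≤ 1) ∧
      ∀ e, 1 ≤ e → ∀ h : Fin M.H,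
        ∀ w θ ϑ : EuclideanSpace ℝ (Fin d), ‖w‖ ≤ 1 → ‖θ‖ ≤ 1 → ‖ϑ‖ ≤ 1 →
          (batch M.H e h).card *
              IsRegression.level (M.stepLaw κ h) (stepFeature φ h) (stepTarget M.H φ h) w θ ϑ -
            (72 * (3 * d * Real.log (3 * 2 ^ e * d) + Real.log (1 / (δ / (M.H * 2 ^ e)))) + 44) ≤
          ∑ k ∈ batch M.H e h,
            excessLoss (stepFeature φ h) (stepTarget M.H φ h) w θ ϑ (X k ω h) := by
  have hH0 : (0 : ℝ) < M.H := by exact_mod_cast hH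
  have hXh : ∀ (h : Fin M.H) k, Measurable fun ω => X k ω h := fun h k =>
    (measurable_pi_apply h).comp (hX k)
  have hlawh : ∀ (h : Fin M.H) k, P.map (fun ω => X k ω h) = M.stepLaw κ h := fun h k => by
    rw [stepLaw, ← hlaw k, Measure.map_map (measurable_pi_apply h) (hX k)]
    rfl
  have hindh : ∀ h : Fin M.H, iIndepFun (fun k ω => X k ω h) P := fun h =>
    hind.comp (fun _ τ => τ h) fun _ => measurable_pi_apply h
  -- The failure probability for epoch `e = j + 1` and each level is `δ / (H 2 ^ e)`, which sums to
  -- `δ` over all epochs and levels. Thus the event does not depend on the stopping time.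
  have hex : ∀ (j : ℕ) (h : Fin M.H), ∃ B : Set Ω, MeasurableSet B ∧
      P B ≤ ENNReal.ofReal (δ / (M.H * 2 ^ (j + 1))) ∧ ∀ ω ∉ B,
        ∀ w θ ϑ : EuclideanSpace ℝ (Fin d), ‖w‖ ≤ 1 → ‖θ‖ ≤ 1 → ‖ϑ‖ ≤ 1 →
          (batch M.H (j + 1) h).card *
              IsRegression.level (M.stepLaw κ h) (stepFeature φ h) (stepTarget M.H φ h) w θ ϑ -
            (72 * (3 * d * Real.log (3 * 2 ^ (j + 1) * d) +
              Real.log (1 / (δ / (M.H * 2 ^ (j + 1))))) + 44) ≤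
          ∑ k ∈ batch M.H (j + 1) h,
            excessLoss (stepFeature φ h) (stepTarget M.H φ h) w θ ϑ (X k ω h) := by
    intro j h
    have := (isRegression_step hφ hφ1 h.2).exists_uniform_event hd (M.stepLaw κ h) P
      (fun k ω => X k ω h) (hXh h) (hlawh h) (hindh h) (batch M.H (j + 1) h)
      (by rw [card_batch]; exact Nat.one_le_two_pow)
      (p := δ / (M.H * 2 ^ (j + 1))) (by positivity)
    rw [card_batch] at this ⊢
    push_cast at this ⊢
    exact this
  choose B hBm hBP hB using hex
  -- On this set of full measure the truncated rewards are the observed ones, in all trajectories at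
  -- once.
  set R : Set Ω := ⋂ k, ⋂ h : Fin M.H, {ω | |(X k ω h).2.2.1| ≤ 1} with hR
  have hRm : MeasurableSet R := MeasurableSet.iInter fun k => MeasurableSet.iInter fun h =>
    measurableSet_le ((by fun_prop : Measurable fun z : Step S A => |z.2.2.1|).comp (hXh h k))
      measurable_const
  have hRP : ∀ᵐ ω ∂P, ω ∈ R := by
    simp only [hR, Set.mem_iInter]
    refine ae_all_iff.2 fun k => ae_all_iff.2 fun h => ?_
    have := M.ae_stepLaw_reward hM κ h
    rw [← hlawh h k] at this
    exact ae_of_ae_map (hXh h k).aemeasurable this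
  set U : Set Ω := ⋃ j, ⋃ h, B j h with hU
  have hUm : MeasurableSet U := MeasurableSet.iUnion fun j => MeasurableSet.iUnion fun h => hBm j h
  have hUP : P U ≤ ENNReal.ofReal δ := by
    have h1 : ∀ j, P (⋃ h, B j h) ≤ ENNReal.ofReal (δ / 2 / 2 ^ j) := by
      intro j
      refine (measure_iUnion_fintype_le _ _).trans ?_
      refine (Finset.sum_le_card_nsmul _ _ _ fun h _ => hBP j h).trans (le_of_eq ?_)
      rw [nsmul_eq_mul, ← ENNReal.ofReal_natCast, ← ENNReal.ofReal_mul (by positivity)]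
      congr 1
      simp only [Finset.card_univ, Fintype.card_fin]
      rw [pow_succ]
      field_simp
    refine (measure_iUnion_le _).trans ((ENNReal.tsum_le_tsum h1).trans (le_of_eq ?_))
    rw [← ENNReal.ofReal_tsum_of_nonneg (fun j => by positivity) (summable_geometric_two' δ),
      tsum_geometric_two']
  refine ⟨Uᶜ ∩ R, hUm.compl.inter hRm, ?_, fun ω hω => ⟨?_, ?_⟩⟩
  · have : P (Uᶜ ∩ R) = P Uᶜ := measure_congr (by
      filter_upwards [hRP] with ω hω
      simp only [eq_iff_iff]
      exact ⟨fun h => h.1, fun h => ⟨h, hω⟩⟩)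
    rw [this, prob_compl_eq_one_sub hUm, ENNReal.ofReal_sub _ hδ.le, ENNReal.ofReal_one]
    exact tsub_le_tsub_left hUP 1
  · intro k h
    have := hω.2
    simp only [hR, Set.mem_iInter] at this
    exact this k h
  · intro e he h
    obtain ⟨j, rfl⟩ : ∃ j, e = j + 1 := ⟨e - 1, by omega⟩
    refine hB j h ω fun hcon => hω.1 ?_
    exact Set.mem_iUnion.2 ⟨j, Set.mem_iUnion.2 ⟨h, hcon⟩⟩

/-- The performance guarantee, with an explicit constant. -/
theorem performance_guarantee (M : MDP S A) (d : ℕ) (φ : Feature S A d) (κ : ℕ → Kernel S A)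
    (fit : ℕ → (S → A → ℝ) → EuclideanSpace ℝ (Fin d)) (lam ε δ : ℝ)
    (P : Measure Ω) (X : ℕ → Ω → Fin M.H → Step S A) (hH : 1 ≤ M.H) (hd : 1 ≤ d) (hlam : 0 < lam)
    (hδ : 0 < δ) (hδ1 : δ < 1) (hM : M.BoundedRewards)
    (hφ : ∀ h < M.H, ∀ a, Measurable fun s => φ h s a) (hφ1 : ∀ h < M.H, ∀ s a, ‖φ h s a‖ ≤ 1)
    (hκ : ∀ h, IsMarkovKernel (κ h)) (hfit : M.IsBestFitRule φ κ fit)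
    (hmis : M.Misspecified φ fit ε) (hP : IsProbabilityMeasure P)
    (hX : ∀ k, Measurable (X k)) (hlaw : ∀ k, P.map (X k) = M.trajLaw κ) (hind : iIndepFun X P) :
    ∃ E : Set Ω, MeasurableSet E ∧ ENNReal.ofReal (1 - δ) ≤ P E ∧
      ∀ ω ∈ E, ∀ K : ℕ, 2 * M.H < K →
        let st : S3State d := S3State.run φ lam (fun k => X k ω) K
        let Q : ℕ → S → A → ℝ := linQ M.H φ st.best
        let U : ℕ → S → A → ℝ := uncertainty M φ κ lam 67 δ K st.epochs
        (∀ h < M.H, ‖st.best h‖ ≤ 1) ∧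
        (∀ h < M.H, ∀ s a,
          |(Q h s a - M.bellman h (Q (h + 1)) s a) +
            (M.bellman h (Q (h + 1)) s a - inner ℝ (φ h s a) (fit h (Q (h + 1))))|
            ≤ U h s a) ∧
        ∀ greedy opt : Policy S A,
          (∀ h < M.H, ∀ s a, Q h s a ≤ Q h s (greedy.act h s)) → M.IsOptimal opt →
          -M.expSum opt.kernel U - ε ≤ ∫ s, (maxOver (Q 0 s) - M.optValue 0 s) ∂M.start ∧
          ∫ s, (maxOver (Q 0 s) - M.optValue 0 s) ∂M.start ≤ M.expSum greedy.kernel U + ε := by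
  obtain ⟨E, hEm, hEP, hE⟩ := exists_concentration_event M hH hd hδ hM hφ hφ1 hX hlaw hind
  refine ⟨E, hEm, hEP, fun ω hω K hK => ?_⟩
  obtain ⟨hrew, hgood⟩ := hE ω hω
  intro st Q U
  have hinv : Invariant φ lam (fun k => X k ω) K st := invariant_run hlam hH _ K
  obtain ⟨he, hKu, hKl⟩ := hinv.size_bounds hK
  have hbest := hinv.norm_best_le
  have hHr : (1 : ℝ) ≤ M.H := by exact_mod_cast hH
  have hdr : (1 : ℝ) ≤ d := by exact_mod_cast hd
  have her : (1 : ℝ) ≤ st.epochs := by exact_mod_cast he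
  set n : ℝ := (K : ℝ) / (4 * M.H) with hn
  have hn4 : n * (4 * M.H) = K := by rw [hn]; field_simp
  have hn0 : 0 ≤ n := by positivity
  have hnN : n ≤ 2 ^ st.epochs := by rw [hn, div_le_iff₀ (by positivity)]; linarith
  have hNn : (2 : ℝ) ^ st.epochs ≤ 4 * n := by
    have : (M.H : ℝ) * 2 ^ st.epochs ≤ M.H * (4 * n) := by linarith
    exact le_of_mul_le_mul_left this (by linarith)
  have hK1 : 2 * (M.H : ℝ) + 1 ≤ n * (4 * M.H) := by rw [hn4]; exact_mod_cast hK
  obtain ⟨hlog0, hdev⟩ := deviation_le_log hdr her hHr hδ hδ1 hK1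
    (one_le_pow₀ (by norm_num : (1 : ℝ) ≤ 2)) hNn
  have hQF : ∀ h < M.H, ∀ s a, |Q h s a - inner ℝ (φ h s a) (fit h (Q (h + 1)))| ≤ U h s a := by
    intro h hh s a
    have hbf := hfit st.best hbest ⟨h, hh⟩
    have herr := M.covariance_error_le κ ⟨h, hh⟩ hM hφ hφ1 hbest hbf hlam
      (τ := fun k => X k ω) (fun k => hrew k _) (hinv.best_fitted he ⟨h, hh⟩)
      (hgood st.epochs he ⟨h, hh⟩)
    have hbn : ‖fit h (Q (h + 1))‖ ≤ 1 := by simpa using hbf.2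
    set ϑ := fit h (Q (h + 1)) with hϑ
    change _ * quadForm _ (st.best h - ϑ) ≤ _ at herr
    rw [card_batch, Nat.cast_pow, Nat.cast_ofNat] at herr
    set G := M.covariance φ κ ⟨h, hh⟩ with hG
    have hGq : ∀ u, 0 ≤ quadForm G u := fun u => by
      rw [hG, M.quadForm_covariance hφ hφ1]
      exact integral_nonneg fun z => sq_nonneg _
    have hpd := posDef_smul_add (M.isHermitian_covariance ⟨h, hh⟩ φ κ) hGq hn0 hlam
    have hQh : Q h s a - inner ℝ (φ h s a) ϑ = inner ℝ (φ h s a) (st.best h - ϑ) := by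
      rw [inner_sub_right]
      simp only [Q, linQ, if_pos hh]
    have hUh : U h s a = alphaCoeff 67 d st.epochs M.H lam n
        (δ / (2 * M.H * st.epochs ^ 2 * d)) *
          weightedNorm (n • G + lam • (1 : Matrix (Fin d) (Fin d) ℝ))⁻¹ (φ h s a) := by
      simp only [U, uncertainty, dif_pos hh]
      rfl
    rw [hQh, hUh, mul_comm]
    refine (abs_inner_le_weightedNorm_mul hpd _ _).trans ?_
    refine mul_le_mul_of_nonneg_left ?_ (Real.sqrt_nonneg _)
    rw [quadForm_smul_add, alphaCoeff]
    set L := Real.log (d * n * st.epochs * M.H / (δ / (2 * M.H * st.epochs ^ 2 * d))) with hL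
    have hΔ : ‖st.best h - ϑ‖ ^ 2 ≤ 4 := by
      have : ‖st.best h - ϑ‖ ≤ 2 := (norm_sub_le _ _).trans (by linarith [hbest h])
      nlinarith [norm_nonneg (st.best h - ϑ)]
    have h1 : n * quadForm G (st.best h - ϑ) ≤ 2 ^ st.epochs * quadForm G (st.best h - ϑ) :=
      mul_le_mul_of_nonneg_right hnN (hGq _)
    have h2 : lam * ‖st.best h - ϑ‖ ^ 2 ≤ lam * 4 := mul_le_mul_of_nonneg_left hΔ hlam.le
    refine Real.sqrt_le_iff.2 ⟨by positivity, ?_⟩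
    have s1 : √(d * L) ^ 2 = d * L := Real.sq_sqrt (by positivity)
    have s2 : √lam ^ 2 = lam := Real.sq_sqrt hlam.le
    have s3 : 0 ≤ √(d * L) * √lam := by positivity
    have s4 : 0 ≤ d * L := by positivity
    -- The first term is at most `2 λ + 2 * 2220 * d L`, the second at most `4 λ`; the constant `67`
    -- satisfies `67 ^ 2 = 4489 ≥ 4440`.
    calc n * quadForm G (st.best h - ϑ) + lam * ‖st.best h - ϑ‖ ^ 2
        ≤ 6 * lam + 4440 * (d * L) := by linarith
      _ ≤ 4489 * (√(d * L) ^ 2 + 2 * (√(d * L) * √lam) + √lam ^ 2) := by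
          rw [s1, s2]; linarith
      _ = (67 * (√(d * L) + √lam)) ^ 2 := by ring
  refine ⟨fun h _ => hbest h, fun h hh s a => ?_, fun greedy opt hg ho => ?_⟩
  · rw [sub_add_sub_cancel]
    exact hQF h hh s a
  · exact M.performance_bounds hM hH (M.bddMeasurable_linQ hφ hφ1 _ _)
      (fun s a => by simp [linQ])
      (M.bddMeasurable_inner hφ hφ1 le_rfl (v := fun h => fit h (Q (h + 1))))
      (M.bddMeasurable_uncertainty hφ hφ1 κ lam 67 δ K st.epochs) hQF
      (fun p => hmis p st.best hbest) hg ho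

end Performance

/-! ### Reasoning about programs -/

/-- The cells that the programs below may access. -/
def allowedCells (d H : ℕ) : Set Cell := fun c =>
  match c with
  | .idx x => x < 16
  | .real a i j k => a < 16 ∧ i < H ∧ j < d ∧ k < d
  | .cur => True
  | .nxt => True

section AllowedCells

variable {d H : ℕ}

@[simp] theorem idx_mem_allowedCells {x : ℕ} : Cell.idx x ∈ allowedCells d H ↔ x < 16 := Iff.rfl

@[simp] theorem real_mem_allowedCells {a i j k : ℕ} :
    Cell.real a i j k ∈ allowedCells d H ↔ a < 16 ∧ i < H ∧ j < d ∧ k < d := Iff.rfl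

@[simp] theorem cur_mem_allowedCells : Cell.cur ∈ allowedCells d H := trivial

@[simp] theorem nxt_mem_allowedCells : Cell.nxt ∈ allowedCells d H := trivial

/-- There are `16` registers, `16` arrays of `H d ^ 2` cells and `2` state cells; `1 ≤ d ^ 2 * H`
absorbs the additive `18`. -/
theorem encard_allowedCells_le (hd : 1 ≤ d) (hH : 1 ≤ H) :
    (allowedCells d H).encard ≤ (34 * (d ^ 2 * H) : ℕ) := by
  classical
  let T : Finset Cell := (Finset.range 16).image Cell.idx ∪
    ((Finset.range 16 ×ˢ Finset.range H ×ˢ Finset.range d ×ˢ Finset.range d).image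
      (fun q => Cell.real q.1 q.2.1 q.2.2.1 q.2.2.2) ∪ {Cell.cur, Cell.nxt})
  have hsub : allowedCells d H ⊆ T := by
    intro c hc
    cases c with
    | idx x => simpa [T] using hc
    | real a i j k => simpa [T] using hc
    | cur => simp [T]
    | nxt => simp [T]
  refine (Set.encard_le_encard hsub).trans ?_
  rw [Set.encard_coe_eq_coe_finsetCard]
  have h1 : T.card ≤ 16 + (16 * (H * (d * d)) + 2) := by
    refine (Finset.card_union_le _ _).trans (add_le_add ?_ ?_)
    · exact Finset.card_image_le.trans (by simp)
    · refine (Finset.card_union_le _ _).trans (add_le_add ?_ Finset.card_le_two)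
      exact Finset.card_image_le.trans (by simp [Finset.card_product])
  have h2 : 1 ≤ d ^ 2 * H := Nat.mul_pos (Nat.pow_pos hd) hH
  have h3 : H * (d * d) = d ^ 2 * H := by ring
  rw [h3] at h1
  exact_mod_cast (by omega : T.card ≤ 34 * (d ^ 2 * H))

end AllowedCells

/-- The operand denotes an allowed cell, when the registers contain `ix`. -/
def Ref.InBounds (d H : ℕ) (ix : ℕ → ℕ) (p : Ref) : Prop :=
  (p.arr < 16 ∧ p.i < 16 ∧ p.j < 16 ∧ p.k < 16) ∧ ix p.i < H ∧ ix p.j < d ∧ ix p.k < d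

/-- The instruction accesses only allowed cells, when the registers contain `ix`. -/
def Instr.InBounds (d H : ℕ) (ix : ℕ → ℕ) : Instr → Prop
  | .iconst x _ => x < 16
  | .iadd x y z => x < 16 ∧ y < 16 ∧ z < 16
  | .isub x y z => x < 16 ∧ y < 16 ∧ z < 16
  | .rconst p _ => p.InBounds d H ix
  | .rop _ p q r => p.InBounds d H ix ∧ q.InBounds d H ix ∧ r.InBounds d H ix
  | .feat p _ h a i => p.InBounds d H ix ∧ h < 16 ∧ a < 16 ∧ i < 16

namespace Mem

variable {S : Type*}

@[simp] theorem tick_idx (σ : Mem S) (cs : Set Cell) : (σ.tick cs).idx = σ.idx := rfl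
@[simp] theorem tick_real (σ : Mem S) (cs : Set Cell) : (σ.tick cs).real = σ.real := rfl
@[simp] theorem tick_cur (σ : Mem S) (cs : Set Cell) : (σ.tick cs).cur = σ.cur := rfl
@[simp] theorem tick_nxt (σ : Mem S) (cs : Set Cell) : (σ.tick cs).nxt = σ.nxt := rfl
@[simp] theorem set_idx (σ : Mem S) (p : Ref) (v : ℝ) : (σ.set p v).idx = σ.idx := rfl
@[simp] theorem setIdx_idx (σ : Mem S) (x n : ℕ) :
    (σ.setIdx x n).idx = Function.update σ.idx x n := rfl
@[simp] theorem setIdx_real (σ : Mem S) (x n : ℕ) : (σ.setIdx x n).real = σ.real := rfl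
@[simp] theorem setIdx_cur (σ : Mem S) (x n : ℕ) : (σ.setIdx x n).cur = σ.cur := rfl
@[simp] theorem setIdx_nxt (σ : Mem S) (x n : ℕ) : (σ.setIdx x n).nxt = σ.nxt := rfl

theorem set_real (σ : Mem S) (p : Ref) (v : ℝ) (arr i j k : ℕ) :
    (σ.set p v).real arr i j k =
      if arr = p.arr ∧ i = σ.idx p.i ∧ j = σ.idx p.j ∧ k = σ.idx p.k then v
      else σ.real arr i j k := rfl

theorem cells_subset {d H : ℕ} {σ : Mem S} {p : Ref} (h : p.InBounds d H σ.idx) :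
    σ.cells p ⊆ allowedCells d H := by
  obtain ⟨⟨h1, h2, h3, h4⟩, h5⟩ := h
  simp [cells, Set.insert_subset_iff, h1, h2, h3, h4, h5]

/-- `σ'` differs from `σ` at most in the arrays `ra` and the registers `rx`. -/
structure Frame (ra rx : List ℕ) (σ σ' : Mem S) : Prop where
  real : ∀ a, a ∉ ra → σ'.real a = σ.real a
  idx : ∀ x, x ∉ rx → σ'.idx x = σ.idx x
  cur : σ'.cur = σ.cur
  nxt : σ'.nxt = σ.nxt

namespace Frame

variable {ra rx : List ℕ} {σ σ' σ'' : Mem S}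

theorem refl (ra rx : List ℕ) (σ : Mem S) : Frame ra rx σ σ :=
  ⟨fun _ _ => rfl, fun _ _ => rfl, rfl, rfl⟩

theorem trans (h : Frame ra rx σ σ') (h' : Frame ra rx σ' σ'') : Frame ra rx σ σ'' :=
  ⟨fun a ha => (h'.real a ha).trans (h.real a ha), fun x hx => (h'.idx x hx).trans (h.idx x hx),
    h'.cur.trans h.cur, h'.nxt.trans h.nxt⟩

theorem mono {ra' rx' : List ℕ} (h : Frame ra rx σ σ') (ha : ra ⊆ ra') (hx : rx ⊆ rx') :
    Frame ra' rx' σ σ' :=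
  ⟨fun a h1 => h.real a fun h2 => h1 (ha h2), fun x h1 => h.idx x fun h2 => h1 (hx h2),
    h.cur, h.nxt⟩

theorem tick (cs : Set Cell) (h : Frame ra rx σ σ') : Frame ra rx σ (σ'.tick cs) :=
  ⟨h.real, h.idx, h.cur, h.nxt⟩

theorem setIdx {x : ℕ} (n : ℕ) (hx : x ∈ rx) (h : Frame ra rx σ σ') :
    Frame ra rx σ (σ'.setIdx x n) :=
  ⟨h.real, fun y hy => by
    have hyx : y ≠ x := by rintro rfl; exact hy hx
    rw [setIdx_idx, Function.update_of_ne hyx, h.idx y hy], h.cur, h.nxt⟩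

theorem set {p : Ref} (v : ℝ) (hp : p.arr ∈ ra) (h : Frame ra rx σ σ') :
    Frame ra rx σ (σ'.set p v) :=
  ⟨fun a ha => by
    ext i j k
    have hap : a ≠ p.arr := by rintro rfl; exact ha hp
    rw [set_real, if_neg (fun e => hap e.1), h.real a ha], h.idx, h.cur, h.nxt⟩

/-- Within a loop over the register `x`, the registers are as at the beginning, but for `x`. -/
theorem update_idx {x : ℕ} (h : Frame ra [x] σ σ') (n : ℕ) :
    Function.update σ'.idx x n = Function.update σ.idx x n := by
  ext y
  by_cases hy : y = x
  · subst hy; simp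
  · rw [Function.update_of_ne hy, Function.update_of_ne hy, h.idx y (by simpa using hy)]

end Frame

end Mem

/-! ### Program triples with memory and time bounds. -/

section Sat

variable {S : Type*} {d H : ℕ} {F : ℕ → S → ℕ → ℕ → ℝ}

/-- From the configuration `σ`, the program `c` reaches a configuration with the property `Q`,
accesses only allowed cells, and executes at most `T` instructions. -/
def Sat (d H : ℕ) (F : ℕ → S → ℕ → ℕ → ℝ) (c : Code) (T : ℕ) (σ : Mem S) (Q : Mem S → Prop) :
    Prop :=
  Q (c.exec d F σ) ∧ (σ.used ⊆ allowedCells d H → (c.exec d F σ).used ⊆ allowedCells d H) ∧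
    (c.exec d F σ).time ≤ σ.time + T

namespace Sat

theorem mono {c : Code} {T T' : ℕ} {σ : Mem S} {Q Q' : Mem S → Prop} (h : Sat d H F c T σ Q)
    (hT : T ≤ T') (hQ : ∀ σ', Q σ' → Q' σ') : Sat d H F c T' σ Q' :=
  ⟨hQ _ h.1, h.2.1, h.2.2.trans (by omega)⟩

theorem skip {σ : Mem S} {Q : Mem S → Prop} (h : Q σ) : Sat d H F .skip 0 σ Q :=
  ⟨h, fun h => h, le_rfl⟩

theorem seq {c₁ c₂ : Code} {T₁ T₂ : ℕ} {σ : Mem S} {R Q : Mem S → Prop}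
    (h₁ : Sat d H F c₁ T₁ σ R) (h₂ : ∀ σ', R σ' → Sat d H F c₂ T₂ σ' Q) :
    Sat d H F (.seq c₁ c₂) (T₁ + T₂) σ Q := by
  have h := h₂ _ h₁.1
  exact ⟨h.1, fun hu => h.2.1 (h₁.2.1 hu), h.2.2.trans (by have := h₁.2.2; omega)⟩

theorem instr {i : Instr} {σ : Mem S} {Q : Mem S → Prop} (hi : i.InBounds d H σ.idx)
    (hQ : Q (i.exec F σ)) : Sat d H F (.instr i) 1 σ Q := by
  refine ⟨hQ, fun hu => ?_, ?_⟩
  · change (i.exec F σ).used ⊆ _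
    cases i with
    | iconst x n =>
      exact Set.union_subset hu (by simpa [Instr.InBounds] using hi)
    | iadd x y z =>
      exact Set.union_subset hu (by simpa [Instr.InBounds, Set.insert_subset_iff] using hi)
    | isub x y z =>
      exact Set.union_subset hu (by simpa [Instr.InBounds, Set.insert_subset_iff] using hi)
    | rconst p n => exact Set.union_subset hu (Mem.cells_subset hi)
    | rop op p q r =>
      exact Set.union_subset hu (Set.union_subset (Set.union_subset (Mem.cells_subset hi.1)
        (Mem.cells_subset hi.2.1)) (Mem.cells_subset hi.2.2))
    | feat p next h a i =>
      refine Set.union_subset hu (Set.union_subset (Mem.cells_subset hi.1) ?_)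
      obtain ⟨-, h1, h2, h3⟩ := hi
      cases next <;> simp [Set.insert_subset_iff, h1, h2, h3]
  · change (i.exec F σ).time ≤ _
    cases i <;> exact le_rfl

theorem ifLt {x y : ℕ} {c₁ c₂ : Code} {T : ℕ} {σ : Mem S} {Q : Mem S → Prop} (hx : x < 16)
    (hy : y < 16)
    (h₁ : σ.idx x < σ.idx y → Sat d H F c₁ T (σ.tick {Cell.idx x, Cell.idx y}) Q)
    (h₂ : ¬ σ.idx x < σ.idx y → Sat d H F c₂ T (σ.tick {Cell.idx x, Cell.idx y}) Q) :
    Sat d H F (.ifLt x y c₁ c₂) (1 + T) σ Q := by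
  have hu : σ.used ⊆ allowedCells d H →
      (σ.tick {Cell.idx x, Cell.idx y}).used ⊆ allowedCells d H := fun hu =>
    Set.union_subset hu (by simp [Set.insert_subset_iff, hx, hy])
  by_cases h : σ.idx x < σ.idx y
  · obtain ⟨a, b, c⟩ := h₁ h
    simp only [Sat, Code.exec, if_pos h]
    refine ⟨a, fun h => b (hu h), c.trans ?_⟩
    simp only [Mem.tick]
    omega
  · obtain ⟨a, b, c⟩ := h₂ h
    simp only [Sat, Code.exec, if_neg h]
    refine ⟨a, fun h => b (hu h), c.trans ?_⟩
    simp only [Mem.tick]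
    omega

/-- The number of iterations is read once at the start, which costs one instruction; each iteration
costs one more than its body, for writing the loop register. The invariant `I m` holds before
iteration `m`. -/
theorem loop {x y : ℕ} {c : Code} {T n : ℕ} {σ : Mem S} (I : ℕ → Mem S → Prop) (hx : x < 16)
    (hy : y < 16) (hn : σ.idx y = n) (h0 : I 0 (σ.tick {Cell.idx y}))
    (hstep : ∀ m < n, ∀ σ', I m σ' →
      Sat d H F c T ((σ'.setIdx x m).tick {Cell.idx x, Cell.idx y}) (I (m + 1))) :
    Sat d H F (.loop x y c) (1 + n * (T + 1)) σ (I n) := by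
  subst hn
  set f : Mem S → ℕ → Mem S :=
    fun σ n => c.exec d F ((σ.setIdx x n).tick {Cell.idx x, Cell.idx y}) with hf
  have key : ∀ m ≤ σ.idx y, let σ' := (List.range m).foldl f (σ.tick {Cell.idx y})
      I m σ' ∧ (σ.used ⊆ allowedCells d H → σ'.used ⊆ allowedCells d H) ∧
        σ'.time ≤ σ.time + (1 + m * (T + 1)) := by
    intro m
    induction m with
    | zero =>
      intro _
      refine ⟨h0, fun hu => Set.union_subset hu (by simpa using hy), ?_⟩
      simp [Mem.tick]
    | succ m ih =>
      intro hm
      obtain ⟨i1, i2, i3⟩ := ih (by omega)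
      set σ' := (List.range m).foldl f (σ.tick {Cell.idx y}) with hσ'
      obtain ⟨j1, j2, j3⟩ := hstep m (by omega) σ' i1
      simp only [List.range_succ, List.foldl_append, List.foldl_cons, List.foldl_nil, ← hσ']
      refine ⟨j1, fun hu => j2 (Set.union_subset (i2 hu)
        (by simp [Set.insert_subset_iff, hx, hy])), ?_⟩
      have h3 : ((σ'.setIdx x m).tick {Cell.idx x, Cell.idx y}).time = σ'.time + 1 := rfl
      rw [h3] at j3
      refine j3.trans ?_
      rw [Nat.succ_mul]
      omega
  exact key _ le_rfl

end Sat

/-- A sequence of instructions. -/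
def Code.block : List Instr → Code
  | [] => .skip
  | i :: l => .seq (.instr i) (Code.block l)

/-- Symbolic execution of a sequence of instructions. -/
def BlockSat (d H : ℕ) (F : ℕ → S → ℕ → ℕ → ℝ) : List Instr → Mem S → (Mem S → Prop) → Prop
  | [], σ, Q => Q σ
  | i :: l, σ, Q => i.InBounds d H σ.idx ∧ BlockSat d H F l (i.exec F σ) Q

theorem Sat.block {l : List Instr} {Q : Mem S → Prop} : ∀ {σ : Mem S},
    BlockSat d H F l σ Q → Sat d H F (.block l) l.length σ Q := by
  induction l with
  | nil => exact fun h => Sat.skip h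
  | cons i l ih =>
    intro σ h
    have := Sat.seq (R := fun σ' => σ' = i.exec F σ) (Sat.instr h.1 rfl)
      (fun σ' hσ' => by subst hσ'; exact ih h.2)
    rwa [add_comm] at this

end Sat

/-! ### Subroutines -/

section Subroutines

variable {S : Type*} {d nA H : ℕ} {F : ℕ → S → ℕ → ℕ → ℝ}

/-- The registers with the parameters of the instance, and the zero register. -/
structure Env (d nA H : ℕ) (σ : Mem S) : Prop where
  dim : σ.idx 0 = d
  card : σ.idx 1 = nA
  hor : σ.idx 2 = H
  zero : σ.idx 5 = 0
  dim_pos : 0 < d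
  hor_pos : 0 < H

theorem Env.of_frame {ra rx : List ℕ} {σ σ' : Mem S} (h : Env d nA H σ) (hf : Mem.Frame ra rx σ σ')
    (h0 : 0 ∉ rx) (h1 : 1 ∉ rx) (h2 : 2 ∉ rx) (h5 : 5 ∉ rx) : Env d nA H σ' :=
  ⟨(hf.idx 0 h0).trans h.dim, (hf.idx 1 h1).trans h.card, (hf.idx 2 h2).trans h.hor,
    (hf.idx 5 h5).trans h.zero, h.dim_pos, h.hor_pos⟩

namespace Code

/-- Load the feature vector of stage `h` and action `a` into `arr[0, ·, 0]`. -/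
def load (arr : ℕ) (next : Bool) (h a : ℕ) : Code :=
  .loop 10 0 (block [.feat ⟨arr, 5, 10, 5⟩ next h a 10])

/-- The inner product of two vectors, computed in `14[0, 0, 0]`. -/
def dot (x : ℕ) (p q : Ref) : Code :=
  .seq (block [.rconst ⟨14, 5, 5, 5⟩ 0])
    (.loop x 0 (block [.rop .mul ⟨13, 5, 5, 5⟩ p q,
      .rop .add ⟨14, 5, 5, 5⟩ ⟨14, 5, 5, 5⟩ ⟨13, 5, 5, 5⟩]))

end Code

theorem sat_load {σ : Mem S} (he : Env d nA H σ) {arr h a : ℕ} (next : Bool) (harr : arr < 16)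
    (hh : h < 16) (ha : a < 16) (hh' : h ≠ 10) (ha' : a ≠ 10) {s : S}
    (hs : (if next then σ.nxt else σ.cur) = some s) :
    Sat d H F (.load arr next h a) (1 + d * 2) σ fun σ' => Mem.Frame [arr] [10] σ σ' ∧
      ∀ i < d, σ'.real arr 0 i 0 = F (σ.idx h) s (σ.idx a) i := by
  refine (Sat.loop (T := 1) (n := d) (fun n σ' => Mem.Frame [arr] [10] σ σ' ∧
      ∀ i < n, σ'.real arr 0 i 0 = F (σ.idx h) s (σ.idx a) i) (by norm_num) (by norm_num) he.dim
      ⟨(Mem.Frame.refl _ _ _).tick _, by simp⟩ ?_).mono le_rfl fun _ h => h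
  rintro n hn σ' ⟨hf, hv⟩
  have e5 : σ'.idx 5 = 0 := (hf.idx 5 (by simp)).trans he.zero
  have eh : σ'.idx h = σ.idx h := hf.idx h (by simpa using hh')
  have ea : σ'.idx a = σ.idx a := hf.idx a (by simpa using ha')
  have es : (if next then σ'.nxt else σ'.cur) = some s := by rw [hf.cur, hf.nxt, hs]
  refine Sat.block ⟨?_, ?_, ?_⟩
  · simp [Instr.InBounds, Ref.InBounds, e5, he.hor_pos, he.dim_pos, hn, harr, hh, ha]
  · exact ((hf.setIdx _ (by simp)).tick _ |>.set _ (by simp)).tick _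
  · intro i hi
    simp only [Instr.exec, Mem.tick_real, Mem.set_real, Mem.tick_idx, Mem.setIdx_idx,
      Mem.setIdx_real, Function.update_apply, Mem.tick_nxt, Mem.tick_cur, Mem.setIdx_nxt,
      Mem.setIdx_cur, es, hh', ha', eh, ea]
    by_cases hin : i = n
    · simp [hin, e5]
    · simp [hin, e5, hv i (by omega)]

/-- The operands are addressed through the loop register, so the same code serves for vectors, rows
and columns. They must avoid the arrays `13` and `14`, which hold the product and the running sum.
-/
theorem sat_dot {σ : Mem S} (he : Env d nA H σ) {x : ℕ} (hx : x = 10 ∨ x = 11) {p q : Ref}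
    (hp : ∀ n < d, p.InBounds d H (Function.update σ.idx x n))
    (hq : ∀ n < d, q.InBounds d H (Function.update σ.idx x n))
    (hp' : p.arr ∉ [13, 14]) (hq' : q.arr ∉ [13, 14]) :
    Sat d H F (.dot x p q) (2 + d * 3) σ fun σ' => Mem.Frame [13, 14] [x] σ σ' ∧
      σ'.real 14 0 0 0 = ∑ n ∈ Finset.range d,
        σ.real p.arr (Function.update σ.idx x n p.i) (Function.update σ.idx x n p.j)
          (Function.update σ.idx x n p.k) *
        σ.real q.arr (Function.update σ.idx x n q.i) (Function.update σ.idx x n q.j)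
          (Function.update σ.idx x n q.k) := by
  have hx16 : x < 16 := by omega
  have hx5 : 5 ≠ x := by omega
  have hx0 : 0 ≠ x := by omega
  unfold Code.dot
  refine Sat.mono (T := 1 + (1 + d * 3)) (Sat.seq (R := fun σ' => Mem.Frame [13, 14] [x] σ σ' ∧
    σ'.real 14 0 0 0 = 0) ?_ ?_) (by omega) fun _ h => h
  · refine Sat.block ⟨?_, ?_, ?_⟩
    · simp [Instr.InBounds, Ref.InBounds, he.zero, he.hor_pos, he.dim_pos]
    · exact ((Mem.Frame.refl _ _ _).set _ (by simp)).tick _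
    · simp [Instr.exec, Mem.set_real, he.zero]
  rintro σ₁ ⟨hf₁, hv₁⟩
  refine (Sat.loop (T := 2) (n := d) (fun n σ' => Mem.Frame [13, 14] [x] σ σ' ∧
    σ'.real 14 0 0 0 = ∑ n ∈ Finset.range n,
        σ.real p.arr (Function.update σ.idx x n p.i) (Function.update σ.idx x n p.j)
          (Function.update σ.idx x n p.k) *
        σ.real q.arr (Function.update σ.idx x n q.i) (Function.update σ.idx x n q.j)
          (Function.update σ.idx x n q.k)) hx16 (by norm_num)
      ((hf₁.idx 0 (by simpa using hx0)).trans he.dim) ⟨hf₁.tick _, by simpa using hv₁⟩ ?_)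
  rintro n hn σ' ⟨hf, hv⟩
  have e5 : σ'.idx 5 = 0 := (hf.idx 5 (by simpa using hx5)).trans he.zero
  have ht : ∀ a : ℕ, a < 16 → (⟨a, 5, 5, 5⟩ : Ref).InBounds d H (Function.update σ'.idx x n) :=
    fun a ha => by
      simp [Ref.InBounds, ha, Function.update_of_ne hx5, e5, he.hor_pos, he.dim_pos]
  refine Sat.block ⟨⟨ht 13 (by norm_num), ?_, ?_⟩, ⟨ht 14 (by norm_num), ht 14 (by norm_num),
    ht 13 (by norm_num)⟩, ?_, ?_⟩
  · have := hp n hn; rwa [← hf.update_idx] at this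
  · have := hq n hn; rwa [← hf.update_idx] at this
  · exact ((((hf.setIdx _ (by simp)).tick _ |>.set _ (by simp)).tick _).set _ (by simp)).tick _
  · simp only [List.mem_cons, List.not_mem_nil, or_false, not_or] at hp' hq'
    have hp14 : σ'.real p.arr = σ.real p.arr := hf.real _ (by simp [hp'])
    have hq14 : σ'.real q.arr = σ.real q.arr := hf.real _ (by simp [hq'])
    rw [Finset.sum_range_succ, ← hv]
    simp only [Instr.exec, Mem.tick_real, Mem.set_real, Mem.get, Mem.tick_idx, Mem.setIdx_idx,
      Mem.setIdx_real, Mem.set_idx, RealOp.eval, hf.update_idx, hp14, hq14]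
    simp [Function.update_of_ne hx5, he.zero]

end Subroutines

/-! ### The program -/

namespace Code

/-- The maximum over the actions of the target network at the next stage and the next state, in
`12[0, 0, 0]`; it is `0` at the last stage. -/
def maxNext : Code :=
  .seq (block [.rconst ⟨12, 5, 5, 5⟩ 0, .iadd 13 3 9])
    (.ifLt 13 2
      (.loop 12 1 (.seq (load 15 true 13 12) (.seq (dot 10 ⟨15, 5, 10, 5⟩ ⟨4, 13, 10, 5⟩)
        (.ifLt 5 12 (block [.rop .max ⟨12, 5, 5, 5⟩ ⟨12, 5, 5, 5⟩ ⟨14, 5, 5, 5⟩])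
          (block [.rop .max ⟨12, 5, 5, 5⟩ ⟨14, 5, 5, 5⟩ ⟨14, 5, 5, 5⟩])))))
      .skip)

/-- The temporal difference error, in `9[0, 0, 0]`. -/
def tdError : Code :=
  .seq (dot 10 ⟨6, 5, 10, 5⟩ ⟨2, 3, 10, 5⟩)
    (block [.rop .add ⟨9, 5, 5, 5⟩ ⟨1, 5, 5, 5⟩ ⟨12, 5, 5, 5⟩,
      .rop .sub ⟨9, 5, 5, 5⟩ ⟨9, 5, 5, 5⟩ ⟨14, 5, 5, 5⟩])

/-- The products of the inverse covariance with the feature vector from both sides, in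
`7[0, ·, 0]` and `8[0, ·, 0]`. -/
def products : Code :=
  .loop 10 0 (.seq (dot 11 ⟨3, 3, 10, 11⟩ ⟨6, 5, 11, 5⟩)
    (.seq (block [.rop .max ⟨7, 5, 10, 5⟩ ⟨14, 5, 5, 5⟩ ⟨14, 5, 5, 5⟩])
      (.seq (dot 11 ⟨6, 5, 11, 5⟩ ⟨3, 3, 11, 10⟩)
        (block [.rop .max ⟨8, 5, 10, 5⟩ ⟨14, 5, 5, 5⟩ ⟨14, 5, 5, 5⟩]))))

/-- The denominator of the updates, in `10[0, 0, 0]`, and the scaled error, in `9[0, 0, 0]`. -/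
def denominator : Code :=
  .seq (dot 10 ⟨6, 5, 10, 5⟩ ⟨7, 5, 10, 5⟩)
    (block [.rconst ⟨10, 5, 5, 5⟩ 1, .rop .add ⟨10, 5, 5, 5⟩ ⟨10, 5, 5, 5⟩ ⟨14, 5, 5, 5⟩,
      .rop .div ⟨9, 5, 5, 5⟩ ⟨9, 5, 5, 5⟩ ⟨10, 5, 5, 5⟩])

/-- The update of the network. -/
def updateTheta : Code :=
  .loop 10 0 (block [.rop .mul ⟨13, 5, 5, 5⟩ ⟨9, 5, 5, 5⟩ ⟨7, 5, 10, 5⟩,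
    .rop .add ⟨2, 3, 10, 5⟩ ⟨2, 3, 10, 5⟩ ⟨13, 5, 5, 5⟩])

/-- The update of the inverse covariance. -/
def updateCovInv : Code :=
  .loop 10 0 (.loop 11 0 (block [.rop .mul ⟨13, 5, 5, 5⟩ ⟨7, 5, 10, 5⟩ ⟨8, 5, 11, 5⟩,
    .rop .div ⟨13, 5, 5, 5⟩ ⟨13, 5, 5, 5⟩ ⟨10, 5, 5, 5⟩,
    .rop .sub ⟨3, 3, 10, 11⟩ ⟨3, 3, 10, 11⟩ ⟨13, 5, 5, 5⟩]))

/-- One time step of the algorithm. -/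
def timeStep : Code :=
  .seq (load 6 false 3 4) (.seq maxNext (.seq tdError (.seq products (.seq denominator
    (.seq updateTheta updateCovInv)))))

/-- Reset the network and the inverse covariance of the current level. -/
def resetLevel : Code :=
  .seq (block [.rconst ⟨13, 5, 5, 5⟩ 1, .rop .div ⟨13, 5, 5, 5⟩ ⟨13, 5, 5, 5⟩ ⟨0, 5, 5, 5⟩])
    (.loop 10 0 (.seq (block [.rconst ⟨2, 6, 10, 5⟩ 0])
      (.seq (.loop 11 0 (block [.rconst ⟨3, 6, 10, 11⟩ 0]))
        (block [.rop .max ⟨3, 6, 10, 10⟩ ⟨13, 5, 5, 5⟩ ⟨13, 5, 5, 5⟩]))))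

/-- Initialization; afterwards the level is the last one. -/
def initLevels : Code :=
  .seq (block [.iconst 9 1, .iconst 8 2]) (.loop 6 2 resetLevel)

/-- The beginning of a trajectory. -/
def beginTrajectory : Code :=
  .seq (.ifLt 5 8 .skip initLevels) (.ifLt 5 7 .skip resetLevel)

/-- Save the parameters of the target networks. -/
def saveTarget : Code :=
  .loop 10 2 (.loop 11 0 (block [.rop .max ⟨5, 10, 11, 5⟩ ⟨4, 10, 11, 5⟩ ⟨4, 10, 11, 5⟩]))

/-- The end of a trajectory. -/
def endTrajectory : Code :=
  .seq (block [.iadd 7 7 9]) (.ifLt 7 8 .skip (.seq (block [.iconst 7 0])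
    (.seq (.project 2 3 4 6) (.ifLt 5 6 (block [.isub 6 6 9])
      (.seq (block [.isub 6 2 9, .iadd 8 8 8]) saveTarget)))))

end Code

/-! ### Specifications of the parts of a time step. -/

section StepSpec

variable {S : Type*} {d nA H : ℕ} {F : ℕ → S → ℕ → ℕ → ℝ}

/-- `m` is the maximum of `q 0, …, q (n - 1)`. -/
def IsMaxBelow (n : ℕ) (q : ℕ → ℝ) (m : ℝ) : Prop :=
  (∃ b < n, m = q b) ∧ ∀ b < n, q b ≤ m

/-- The initial `0` in array `12` is the answer at the last stage, but it must not compete with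
negative action values. Hence the first action overwrites it, by taking the maximum of a number with
itself as a copy; only later actions take a genuine maximum. -/
theorem sat_maxNext {σ : Mem S} (he : Env d nA H σ) (h9 : σ.idx 9 = 1) (hnA : 0 < nA)
    {s : S} (hs : σ.nxt = some s) :
    Sat d H F .maxNext (4 + nA * (7 + d * 5)) σ fun σ' =>
      Mem.Frame [12, 13, 14, 15] [10, 12, 13] σ σ' ∧
      if σ.idx 3 + 1 < H then IsMaxBelow nA (fun b => ∑ i ∈ Finset.range d,
          F (σ.idx 3 + 1) s b i * σ.real 4 (σ.idx 3 + 1) i 0) (σ'.real 12 0 0 0)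
      else σ'.real 12 0 0 0 = 0 := by
  set q : ℕ → ℝ := fun b => ∑ i ∈ Finset.range d,
    F (σ.idx 3 + 1) s b i * σ.real 4 (σ.idx 3 + 1) i 0 with hq
  unfold Code.maxNext
  refine Sat.mono (T := 2 + (1 + (1 + nA * (6 + d * 5 + 1)))) (Sat.seq (R := fun σ' =>
    Mem.Frame [12, 13, 14, 15] [10, 12, 13] σ σ' ∧ σ'.real 12 0 0 0 = 0 ∧
      σ'.idx 13 = σ.idx 3 + 1) ?_ ?_) (by ring_nf; omega) fun _ h => h
  · refine Sat.block ⟨?_, ?_, ?_, ?_, ?_⟩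
    · simp [Instr.InBounds, Ref.InBounds, he.zero, he.hor_pos, he.dim_pos]
    · simp [Instr.InBounds]
    · exact ((((Mem.Frame.refl _ _ _).set _ (by simp)).tick _).setIdx _ (by simp)).tick _
    · simp [Instr.exec, Mem.set_real, he.zero]
    · simp [Instr.exec, h9]
  rintro σ₁ ⟨hf₁, hv₁, hi₁⟩
  have he₁ := he.of_frame hf₁ (by simp) (by simp) (by simp) (by simp)
  refine Sat.ifLt (by norm_num) (by norm_num) (fun hlt => ?_) fun hge => ?_
  · rw [hi₁, he₁.hor] at hlt
    simp only [if_pos hlt]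
    refine Sat.mono (Sat.loop (T := 6 + d * 5) (n := nA) (fun n σ' =>
      Mem.Frame [12, 13, 14, 15] [10, 12, 13] σ σ' ∧ σ'.idx 13 = σ.idx 3 + 1 ∧
        (0 < n → IsMaxBelow n q (σ'.real 12 0 0 0))) (by norm_num) (by norm_num) he₁.card
      ⟨hf₁.tick _ |>.tick _, hi₁, by simp⟩ ?_) le_rfl fun σ' h => ⟨h.1, h.2.2 hnA⟩
    rintro n hn σ₂ ⟨hf₂, hi₂, hv₂⟩
    set σ₃ := (σ₂.setIdx 12 n).tick {Cell.idx 12, Cell.idx 1} with hσ₃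
    have hf₃ : Mem.Frame [12, 13, 14, 15] [10, 12, 13] σ σ₃ := (hf₂.setIdx _ (by simp)).tick _
    have he₃ := he.of_frame hf₃ (by simp) (by simp) (by simp) (by simp)
    have hi₃ : σ₃.idx 13 = σ.idx 3 + 1 := by simpa [hσ₃] using hi₂
    have hj₃ : σ₃.idx 12 = n := by simp [hσ₃]
    have hv₃ : 0 < n → IsMaxBelow n q (σ₃.real 12 0 0 0) := hv₂
    refine Sat.mono (T := (1 + d * 2) + ((2 + d * 3) + (1 + 1))) (Sat.seq
      (sat_load he₃ true (by norm_num) (by norm_num) (by norm_num) (by norm_num) (by norm_num)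
        (s := s) (by simpa using hf₃.nxt.trans hs)) ?_) (by omega) fun _ h => h
    rintro σ₄ ⟨hf₄, hv₄⟩
    have he₄ := he₃.of_frame hf₄ (by simp) (by simp) (by simp) (by simp)
    have hi₄ : σ₄.idx 13 = σ.idx 3 + 1 := (hf₄.idx 13 (by simp)).trans hi₃
    refine Sat.seq (sat_dot he₄ (Or.inl rfl) ?_ ?_ (by simp) (by simp)) ?_
    · intro i hi
      simp [Ref.InBounds, he₄.zero, he.hor_pos, he.dim_pos, hi]
    · intro i hi
      simp [Ref.InBounds, he₄.zero, he.dim_pos, hi, hi₄, hlt]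
    rintro σ₅ ⟨hf₅, hv₅⟩
    have he₅ := he₄.of_frame hf₅ (by simp) (by simp) (by simp) (by simp)
    have hF₅ : Mem.Frame [12, 13, 14, 15] [10, 12, 13] σ σ₅ :=
      (hf₃.trans (hf₄.mono (by simp) (by simp))).trans (hf₅.mono (by simp) (by simp))
    have hi₅ : σ₅.idx 13 = σ.idx 3 + 1 := (hf₅.idx 13 (by simp)).trans hi₄
    have hj₅ : σ₅.idx 12 = n :=
      (hf₅.idx 12 (by simp)).trans ((hf₄.idx 12 (by simp)).trans hj₃)
    have hm₅ : σ₅.real 12 0 0 0 = σ₃.real 12 0 0 0 := by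
      rw [hf₅.real 12 (by simp), hf₄.real 12 (by simp)]
    have hq₅ : σ₅.real 14 0 0 0 = q n := by
      rw [hv₅, hq]
      refine Finset.sum_congr rfl fun i hi => ?_
      have hr4 : σ₄.real 4 = σ.real 4 := by rw [hf₄.real 4 (by simp), hf₃.real 4 (by simp)]
      simp [he₄.zero, hi₄, hr4, hv₄ i (Finset.mem_range.1 hi), hi₃, hj₃]
    have hz : ∀ a : ℕ, a < 16 → (⟨a, 5, 5, 5⟩ : Ref).InBounds d H σ₅.idx := fun a ha => by
      simp [Ref.InBounds, ha, he₅.zero, he.hor_pos, he.dim_pos]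
    refine Sat.ifLt (by norm_num) (by norm_num) (fun h0 => ?_) fun h0 => ?_
    · rw [he₅.zero, hj₅] at h0
      refine Sat.block ⟨⟨hz 12 (by norm_num), hz 12 (by norm_num), hz 14 (by norm_num)⟩,
        ((hF₅.tick _).set _ (by simp)).tick _, hi₅, fun _ => ?_⟩
      have hval : (Instr.exec F (.rop .max ⟨12, 5, 5, 5⟩ ⟨12, 5, 5, 5⟩ ⟨14, 5, 5, 5⟩)
          (σ₅.tick {Cell.idx 5, Cell.idx 12})).real 12 0 0 0 =
          max (σ₃.real 12 0 0 0) (q n) := by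
        simp [Instr.exec, Mem.set_real, Mem.get, RealOp.eval, he₅.zero, hm₅, hq₅]
      rw [hval]
      obtain ⟨⟨b, hb, hbm⟩, hmax⟩ := hv₃ h0
      refine ⟨?_, fun b' hb' => ?_⟩
      · rcases max_choice (σ₃.real 12 0 0 0) (q n) with hc | hc
        · exact ⟨b, by omega, hc.trans hbm⟩
        · exact ⟨n, by omega, hc⟩
      · rcases Nat.lt_succ_iff_lt_or_eq.1 hb' with hb' | rfl
        · exact (hmax b' hb').trans (le_max_left _ _)
        · exact le_max_right _ _
    · rw [he₅.zero, hj₅] at h0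
      obtain rfl : n = 0 := by omega
      refine Sat.block ⟨⟨hz 12 (by norm_num), hz 14 (by norm_num), hz 14 (by norm_num)⟩,
        ((hF₅.tick _).set _ (by simp)).tick _, hi₅, fun _ => ?_⟩
      have hval : (Instr.exec F (.rop .max ⟨12, 5, 5, 5⟩ ⟨14, 5, 5, 5⟩ ⟨14, 5, 5, 5⟩)
          (σ₅.tick {Cell.idx 5, Cell.idx 12})).real 12 0 0 0 = q 0 := by
        simp [Instr.exec, Mem.set_real, Mem.get, RealOp.eval, he₅.zero, hq₅]
      rw [hval]
      refine ⟨⟨0, by omega, rfl⟩, fun b hb => ?_⟩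
      obtain rfl : b = 0 := by omega
      exact le_rfl
  · rw [hi₁, he₁.hor] at hge
    simp only [if_neg hge]
    exact Sat.mono (Sat.skip ⟨hf₁.tick _, hv₁⟩) (Nat.zero_le _) fun _ h => h

theorem sat_tdError {σ : Mem S} (he : Env d nA H σ) (h3 : σ.idx 3 < H) :
    Sat d H F .tdError (4 + d * 3) σ fun σ' => Mem.Frame [9, 13, 14] [10] σ σ' ∧
      σ'.real 9 0 0 0 = σ.real 1 0 0 0 + σ.real 12 0 0 0 -
        ∑ i ∈ Finset.range d, σ.real 6 0 i 0 * σ.real 2 (σ.idx 3) i 0 := by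
  unfold Code.tdError
  refine Sat.mono (T := (2 + d * 3) + 2) (Sat.seq (sat_dot he (Or.inl rfl) ?_ ?_ (by simp)
    (by simp)) ?_) (by omega) fun _ h => h
  · intro i hi
    simp [Ref.InBounds, he.zero, he.hor_pos, he.dim_pos, hi]
  · intro i hi
    simp [Ref.InBounds, he.zero, he.dim_pos, hi, h3]
  rintro σ₁ ⟨hf₁, hv₁⟩
  have he₁ := he.of_frame hf₁ (by simp) (by simp) (by simp) (by simp)
  have hz : ∀ a : ℕ, a < 16 → (⟨a, 5, 5, 5⟩ : Ref).InBounds d H σ₁.idx := fun a ha => by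
    simp [Ref.InBounds, ha, he₁.zero, he.hor_pos, he.dim_pos]
  have hF₁ : Mem.Frame [9, 13, 14] [10] σ σ₁ := hf₁.mono (by simp) (by simp)
  refine Sat.block ⟨⟨hz 9 (by norm_num), hz 1 (by norm_num), hz 12 (by norm_num)⟩,
    ⟨hz 9 (by norm_num), hz 9 (by norm_num), hz 14 (by norm_num)⟩,
    ((((hF₁.set _ (by simp)).tick _).set _ (by simp)).tick _), ?_⟩
  have h1 : σ₁.real 1 = σ.real 1 := hf₁.real 1 (by simp)
  have h12 : σ₁.real 12 = σ.real 12 := hf₁.real 12 (by simp)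
  simp [Instr.exec, Mem.set_real, Mem.get, RealOp.eval, he₁.zero, hv₁, h1, h12, he.zero]

/-- Both one-sided products are computed, because symmetry of the stored matrix is not part of what
the memory is known to represent. -/
theorem sat_products {σ : Mem S} (he : Env d nA H σ) (h3 : σ.idx 3 < H) :
    Sat d H F .products (1 + d * (7 + d * 6)) σ fun σ' =>
      Mem.Frame [7, 8, 13, 14] [10, 11] σ σ' ∧ ∀ i < d,
        σ'.real 7 0 i 0 = ∑ j ∈ Finset.range d, σ.real 3 (σ.idx 3) i j * σ.real 6 0 j 0 ∧
        σ'.real 8 0 i 0 = ∑ j ∈ Finset.range d, σ.real 6 0 j 0 * σ.real 3 (σ.idx 3) j i := by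
  unfold Code.products
  refine Sat.mono (Sat.loop (T := (2 + d * 3) + (1 + ((2 + d * 3) + 1))) (n := d) (fun n σ' =>
      Mem.Frame [7, 8, 13, 14] [10, 11] σ σ' ∧ ∀ i < n,
        σ'.real 7 0 i 0 = ∑ j ∈ Finset.range d, σ.real 3 (σ.idx 3) i j * σ.real 6 0 j 0 ∧
        σ'.real 8 0 i 0 = ∑ j ∈ Finset.range d, σ.real 6 0 j 0 * σ.real 3 (σ.idx 3) j i)
    (by norm_num) (by norm_num) he.dim ⟨(Mem.Frame.refl _ _ _).tick _, by simp⟩ ?_)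
    (by apply le_of_eq; ring) fun _ h => h
  rintro n hn σ₁ ⟨hf₁, hv₁⟩
  set σ₂ := (σ₁.setIdx 10 n).tick {Cell.idx 10, Cell.idx 0} with hσ₂
  have hf₂ : Mem.Frame [7, 8, 13, 14] [10, 11] σ σ₂ := (hf₁.setIdx _ (by simp)).tick _
  have he₂ := he.of_frame hf₂ (by simp) (by simp) (by simp) (by simp)
  have h10 : σ₂.idx 10 = n := by simp [hσ₂]
  have h3' : σ₂.idx 3 = σ.idx 3 := hf₂.idx 3 (by simp)
  have hv₂ : ∀ i < n,
      σ₂.real 7 0 i 0 = ∑ j ∈ Finset.range d, σ.real 3 (σ.idx 3) i j * σ.real 6 0 j 0 ∧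
      σ₂.real 8 0 i 0 = ∑ j ∈ Finset.range d, σ.real 6 0 j 0 * σ.real 3 (σ.idx 3) j i := hv₁
  clear_value σ₂
  refine Sat.seq (sat_dot he₂ (Or.inr rfl) ?_ ?_ (by simp) (by simp)) ?_
  · intro i hi
    simp [Ref.InBounds, h3', h3, h10, hn, hi]
  · intro i hi
    simp [Ref.InBounds, he₂.zero, he.hor_pos, he.dim_pos, hi]
  rintro σ₃ ⟨hf₃, hv₃⟩
  have hF₃ : Mem.Frame [7, 8, 13, 14] [10, 11] σ σ₃ := hf₂.trans (hf₃.mono (by simp) (by simp))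
  have he₃ := he.of_frame hF₃ (by simp) (by simp) (by simp) (by simp)
  have h10₃ : σ₃.idx 10 = n := (hf₃.idx 10 (by simp)).trans h10
  have h14 : σ₃.real 14 0 0 0 =
      ∑ j ∈ Finset.range d, σ.real 3 (σ.idx 3) n j * σ.real 6 0 j 0 := by
    rw [hv₃]
    simp [h3', h10, he₂.zero, hf₂.real 3 (by simp), hf₂.real 6 (by simp)]
  have h7₃ : σ₃.real 7 = σ₂.real 7 := hf₃.real 7 (by simp)
  have h8₃ : σ₃.real 8 = σ₂.real 8 := hf₃.real 8 (by simp)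
  refine Sat.seq (R := fun σ' => Mem.Frame [7, 8, 13, 14] [10, 11] σ σ' ∧ σ'.idx 10 = n ∧
    (∀ i, σ'.real 7 0 i 0 = if i = n then
      ∑ j ∈ Finset.range d, σ.real 3 (σ.idx 3) n j * σ.real 6 0 j 0 else σ₂.real 7 0 i 0) ∧
    σ'.real 8 = σ₂.real 8) ?_ ?_
  · refine Sat.block ⟨?_, (hF₃.set _ (by simp)).tick _, h10₃, fun i => ?_, ?_⟩
    · simp [Instr.InBounds, Ref.InBounds, he₃.zero, he.hor_pos, he.dim_pos, h10₃, hn]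
    · simp [Instr.exec, Mem.set_real, Mem.get, RealOp.eval, he₃.zero, h10₃, h14, h7₃]
    · ext i j k
      simp [Instr.exec, Mem.set_real, h8₃]
  rintro σ₄ ⟨hf₄, h10₄, h7₄, h8₄⟩
  have he₄ := he.of_frame hf₄ (by simp) (by simp) (by simp) (by simp)
  have h3₄ : σ₄.idx 3 = σ.idx 3 := hf₄.idx 3 (by simp)
  refine Sat.seq (sat_dot he₄ (Or.inr rfl) ?_ ?_ (by simp) (by simp)) ?_
  · intro i hi
    simp [Ref.InBounds, he₄.zero, he.hor_pos, he.dim_pos, hi]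
  · intro i hi
    simp [Ref.InBounds, h3₄, h3, h10₄, hn, hi]
  rintro σ₅ ⟨hf₅, hv₅⟩
  have hF₅ : Mem.Frame [7, 8, 13, 14] [10, 11] σ σ₅ := hf₄.trans (hf₅.mono (by simp) (by simp))
  have he₅ := he.of_frame hF₅ (by simp) (by simp) (by simp) (by simp)
  have h10₅ : σ₅.idx 10 = n := (hf₅.idx 10 (by simp)).trans h10₄
  have h14₅ : σ₅.real 14 0 0 0 =
      ∑ j ∈ Finset.range d, σ.real 6 0 j 0 * σ.real 3 (σ.idx 3) j n := by
    rw [hv₅]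
    simp [h3₄, h10₄, he₄.zero, hf₄.real 3 (by simp), hf₄.real 6 (by simp)]
  refine Sat.block ⟨?_, (hF₅.set _ (by simp)).tick _, fun i hi => ?_⟩
  · simp [Instr.InBounds, Ref.InBounds, he₅.zero, he.hor_pos, he.dim_pos, h10₅, hn]
  · have h7₅ : σ₅.real 7 = σ₄.real 7 := hf₅.real 7 (by simp)
    have h8₅ : σ₅.real 8 = σ₄.real 8 := hf₅.real 8 (by simp)
    simp only [Instr.exec, Mem.tick_real, Mem.set_real, Mem.get, RealOp.eval, he₅.zero, h10₅, h14₅,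
      h7₅, h7₄, h8₅, h8₄]
    by_cases hin : i = n
    · subst hin; simp
    · have := hv₂ i (by omega)
      simp [hin, this]

theorem sat_denominator {σ : Mem S} (he : Env d nA H σ) :
    Sat d H F .denominator (5 + d * 3) σ fun σ' => Mem.Frame [9, 10, 13, 14] [10] σ σ' ∧
      σ'.real 10 0 0 0 = 1 + ∑ i ∈ Finset.range d, σ.real 6 0 i 0 * σ.real 7 0 i 0 ∧
      σ'.real 9 0 0 0 = σ.real 9 0 0 0 /
        (1 + ∑ i ∈ Finset.range d, σ.real 6 0 i 0 * σ.real 7 0 i 0) := by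
  unfold Code.denominator
  refine Sat.mono (T := (2 + d * 3) + 3) (Sat.seq (sat_dot he (Or.inl rfl) ?_ ?_ (by simp)
    (by simp)) ?_) (by omega) fun _ h => h
  · intro i hi
    simp [Ref.InBounds, he.zero, he.hor_pos, he.dim_pos, hi]
  · intro i hi
    simp [Ref.InBounds, he.zero, he.hor_pos, he.dim_pos, hi]
  rintro σ₁ ⟨hf₁, hv₁⟩
  have he₁ := he.of_frame hf₁ (by simp) (by simp) (by simp) (by simp)
  have hz : ∀ a : ℕ, a < 16 → (⟨a, 5, 5, 5⟩ : Ref).InBounds d H σ₁.idx := fun a ha => by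
    simp [Ref.InBounds, ha, he₁.zero, he.hor_pos, he.dim_pos]
  have hF₁ : Mem.Frame [9, 10, 13, 14] [10] σ σ₁ := hf₁.mono (by simp) (by simp)
  have h9 : σ₁.real 9 = σ.real 9 := hf₁.real 9 (by simp)
  refine Sat.block ⟨hz 10 (by norm_num),
    ⟨hz 10 (by norm_num), hz 10 (by norm_num), hz 14 (by norm_num)⟩,
    ⟨hz 9 (by norm_num), hz 9 (by norm_num), hz 10 (by norm_num)⟩,
    (((((hF₁.set _ (by simp)).tick _).set _ (by simp)).tick _).set _ (by simp)).tick _, ?_, ?_⟩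
  · simp [Instr.exec, Mem.set_real, Mem.get, RealOp.eval, he₁.zero, hv₁, he.zero]
  · simp [Instr.exec, Mem.set_real, Mem.get, RealOp.eval, he₁.zero, hv₁, he.zero, h9]

theorem sat_updateTheta {σ : Mem S} (he : Env d nA H σ) (h3 : σ.idx 3 < H) :
    Sat d H F .updateTheta (1 + d * 3) σ fun σ' => Mem.Frame [2, 13] [10] σ σ' ∧
      ∀ i j k, σ'.real 2 i j k = if i = σ.idx 3 ∧ j < d ∧ k = 0 then
        σ.real 2 i j k + σ.real 9 0 0 0 * σ.real 7 0 j 0 else σ.real 2 i j k := by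
  unfold Code.updateTheta
  refine Sat.mono (Sat.loop (T := 2) (n := d) (fun n σ' => Mem.Frame [2, 13] [10] σ σ' ∧
      ∀ i j k, σ'.real 2 i j k = if i = σ.idx 3 ∧ j < n ∧ k = 0 then
        σ.real 2 i j k + σ.real 9 0 0 0 * σ.real 7 0 j 0 else σ.real 2 i j k)
    (by norm_num) (by norm_num) he.dim ⟨(Mem.Frame.refl _ _ _).tick _, by simp⟩ ?_)
    (by apply le_of_eq; ring) fun _ h => h
  rintro n hn σ₁ ⟨hf₁, hv₁⟩
  have he₁ := he.of_frame hf₁ (by simp) (by simp) (by simp) (by simp)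
  have h3' : σ₁.idx 3 = σ.idx 3 := hf₁.idx 3 (by simp)
  have h9 : σ₁.real 9 = σ.real 9 := hf₁.real 9 (by simp)
  have h7 : σ₁.real 7 = σ.real 7 := hf₁.real 7 (by simp)
  refine Sat.block ⟨?_, ?_, ((((hf₁.setIdx _ (by simp)).tick _).set _ (by simp)).tick _ |>.set _
    (by simp)).tick _, fun i j k => ?_⟩
  · simp [Instr.InBounds, Ref.InBounds, he₁.zero, he.hor_pos, he.dim_pos, hn]
  · simp [Instr.InBounds, Ref.InBounds, Instr.exec, he₁.zero, he.hor_pos, he.dim_pos, hn, h3', h3]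
  · simp [Instr.exec, Mem.set_real, Mem.get, RealOp.eval, he₁.zero, h3', h9, h7, hv₁]
    by_cases hi : i = σ.idx 3
    · by_cases hj : j = n
      · by_cases hk : k = 0
        · simp [hi, hj, hk]
        · simp [hi, hj, hk]
      · have : j ≤ n ↔ j < n := by omega
        simp [hi, hj, this]
    · simp [hi]

/-- Updating in place is safe: each entry is changed once, and the correction reads only the
products and the denominator computed beforehand. -/
theorem sat_updateCovInv {σ : Mem S} (he : Env d nA H σ) (h3 : σ.idx 3 < H) :
    Sat d H F .updateCovInv (1 + d * (2 + d * 4)) σ fun σ' => Mem.Frame [3, 13] [10, 11] σ σ' ∧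
      ∀ i j k, σ'.real 3 i j k = if i = σ.idx 3 ∧ j < d ∧ k < d then
        σ.real 3 i j k - σ.real 7 0 j 0 * σ.real 8 0 k 0 / σ.real 10 0 0 0
        else σ.real 3 i j k := by
  unfold Code.updateCovInv
  refine Sat.mono (Sat.loop (T := 1 + d * (3 + 1)) (n := d) (fun n σ' =>
      Mem.Frame [3, 13] [10, 11] σ σ' ∧
      ∀ i j k, σ'.real 3 i j k = if i = σ.idx 3 ∧ j < n ∧ k < d then
        σ.real 3 i j k - σ.real 7 0 j 0 * σ.real 8 0 k 0 / σ.real 10 0 0 0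
        else σ.real 3 i j k)
    (by norm_num) (by norm_num) he.dim ⟨(Mem.Frame.refl _ _ _).tick _, by simp⟩ ?_)
    (by apply le_of_eq; ring) fun _ h => h
  rintro n hn σ₁ ⟨hf₁, hv₁⟩
  set σ₂ := (σ₁.setIdx 10 n).tick {Cell.idx 10, Cell.idx 0} with hσ₂
  have hf₂ : Mem.Frame [3, 13] [10, 11] σ σ₂ := (hf₁.setIdx _ (by simp)).tick _
  have h10 : σ₂.idx 10 = n := by simp [hσ₂]
  have he₂ := he.of_frame hf₂ (by simp) (by simp) (by simp) (by simp)
  -- The entries already updated are those in the rows before `n`, and the first `m` entries of row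
  -- `n`.
  refine Sat.mono (Sat.loop (T := 3) (n := d) (fun m σ' =>
      Mem.Frame [3, 13] [10, 11] σ σ' ∧ σ'.idx 10 = n ∧
      ∀ i j k, σ'.real 3 i j k = if i = σ.idx 3 ∧ (j < n ∧ k < d ∨ j = n ∧ k < m) then
        σ.real 3 i j k - σ.real 7 0 j 0 * σ.real 8 0 k 0 / σ.real 10 0 0 0
        else σ.real 3 i j k)
    (by norm_num) (by norm_num) he₂.dim ⟨hf₂.tick _, h10, fun i j k => ?_⟩ ?_) le_rfl
    fun σ' h => ⟨h.1, fun i j k => ?_⟩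
  · simpa [hσ₂] using hv₁ i j k
  · rintro m hm σ₃ ⟨hf₃, h10₃, hv₃⟩
    have he₃ := he.of_frame hf₃ (by simp) (by simp) (by simp) (by simp)
    have h3' : σ₃.idx 3 = σ.idx 3 := hf₃.idx 3 (by simp)
    have h10' : σ₃.real 10 = σ.real 10 := hf₃.real 10 (by simp)
    have h7 : σ₃.real 7 = σ.real 7 := hf₃.real 7 (by simp)
    have h8 : σ₃.real 8 = σ.real 8 := hf₃.real 8 (by simp)
    refine Sat.block ⟨?_, ?_, ?_, ?_, by simpa [Instr.exec] using h10₃, fun i j k => ?_⟩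
    · simp [Instr.InBounds, Ref.InBounds, he₃.zero, he.hor_pos, he.dim_pos, hn, hm, h10₃]
    · simp [Instr.InBounds, Ref.InBounds, Instr.exec, he₃.zero, he.hor_pos, he.dim_pos]
    · simp [Instr.InBounds, Ref.InBounds, Instr.exec, he₃.zero, he.hor_pos, he.dim_pos, hn, hm,
        h10₃, h3', h3]
    · exact ((((((hf₃.setIdx _ (by simp)).tick _).set _ (by simp)).tick _).set _
        (by simp)).tick _ |>.set _ (by simp)).tick _
    · simp [Instr.exec, Mem.set_real, Mem.get, RealOp.eval, he₃.zero, h3', h10', h7, h8, hv₃,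
        h10₃]
      by_cases hi : i = σ.idx 3
      · by_cases hj : j = n
        · by_cases hk : k = m
          · simp [hi, hj, hk]
          · have : k ≤ m ↔ k < m := by omega
            simp [hi, hj, hk, this]
        · simp [hi, hj]
      · simp [hi]
  · rw [h.2.2]
    have : (j < n ∧ k < d ∨ j = n ∧ k < d) ↔ (j < n + 1 ∧ k < d) := by omega
    simp only [this]

end StepSpec

/-! ### Simulation of one time step. -/

section Refinement

variable {S A : Type*} [Fintype A] [Nonempty A] {d nA H : ℕ} {lam : ℝ}

/-- The memory holds the parameters of the instance and the variables of the algorithm. -/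
structure Represents (nA H : ℕ) (lam : ℝ) (σ : Mem S) (st : S3State d) : Prop where
  env : Env d nA H σ
  level : σ.idx 6 = st.level
  count : σ.idx 7 = st.count
  pow : σ.idx 8 = 2 ^ (st.epochs + 1)
  one : σ.idx 9 = 1
  reg : σ.real 0 0 0 0 = lam
  theta : ∀ h < H, ∀ i : Fin d, σ.real 2 h i 0 = st.theta h i
  covInv : ∀ h < H, ∀ i j : Fin d, σ.real 3 h i j = st.covInv h i j
  target : ∀ h < H, ∀ i : Fin d, σ.real 4 h i 0 = st.target h i
  best : ∀ h < H, ∀ i : Fin d, σ.real 5 h i 0 = st.best h i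

theorem Represents.deliver {σ : Mem S} {st : S3State d} (hr : Represents nA H lam σ st) (h : ℕ)
    (x : Step S A) : Represents nA H lam (Program.deliver h x σ) st where
  env := ⟨hr.env.dim, hr.env.card, hr.env.hor, hr.env.zero, hr.env.dim_pos, hr.env.hor_pos⟩
  level := hr.level
  count := hr.count
  pow := hr.pow
  one := hr.one
  reg := by simpa [Program.deliver] using hr.reg
  theta := by simpa [Program.deliver] using hr.theta
  covInv := by simpa [Program.deliver] using hr.covInv
  target := by simpa [Program.deliver] using hr.target
  best := by simpa [Program.deliver] using hr.best

theorem featureOracle_equivFin (φ : Feature S A d) (h : ℕ) (s : S) (a : A) (i : Fin d) :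
    Program.featureOracle φ h s (Fintype.equivFin A a) i = φ h s a i := by
  simp [Program.featureOracle]

theorem IsMaxBelow.eq_maxOver {f : A → ℝ} {q : ℕ → ℝ} {m : ℝ}
    (h : IsMaxBelow (Fintype.card A) q m) (hq : ∀ a, q (Fintype.equivFin A a) = f a) :
    m = maxOver f := by
  obtain ⟨⟨b, hb, rfl⟩, hmax⟩ := h
  apply le_antisymm
  · have := le_maxOver f ((Fintype.equivFin A).symm ⟨b, hb⟩)
    rw [← hq] at this
    simpa using this
  · exact maxOver_le fun a => by rw [← hq]; exact hmax _ (Fin.is_lt _)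

/-- The error and the products are computed from the old network and the old inverse covariance
before either is overwritten; the frames carry these values to the places where they are used. -/
theorem Represents.sat_timeStep (φ : Feature S A d) {σ : Mem S} {st : S3State d}
    (hr : Represents (Fintype.card A) H lam σ st) {h : ℕ} (hh : h < H) (x : Step S A) :
    Sat d H (Program.featureOracle φ) .timeStep (50 * (d ^ 2 + Fintype.card A * d))
      (Program.deliver h x σ)
      fun σ' => Represents (Fintype.card A) H lam σ' (S3State.update H φ h x st) := by
  have hr₀ := hr.deliver h x
  have hrew : (Program.deliver h x σ).real 1 0 0 0 = x.2.2.1 := by simp [Program.deliver]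
  have h3 : (Program.deliver h x σ).idx 3 = h := by simp [Program.deliver]
  have h4 : (Program.deliver h x σ).idx 4 = Fintype.equivFin A x.2.1 := by simp [Program.deliver]
  have hcur : (Program.deliver h x σ).cur = some x.1 := rfl
  have hnxt : (Program.deliver h x σ).nxt = some x.2.2.2 := rfl
  generalize Program.deliver h x σ = σ₀ at hr₀ hrew h3 h4 hcur hnxt ⊢
  have he := hr₀.env
  have hnA : 0 < Fintype.card A := Fintype.card_pos
  set f : EuclideanSpace ℝ (Fin d) := φ h x.1 x.2.1 with hf
  set P : Matrix (Fin d) (Fin d) ℝ := st.covInv h with hP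
  set m : ℝ := maxOver (linQ H φ st.target (h + 1) x.2.2.2) with hm
  -- The sum is `17 + 20 d + 10 d ^ 2 + |A| (7 + 5 d)`, at most `47 d ^ 2 + 12 |A| d` since `1 ≤ d`.
  have hT : (1 + d * 2) + ((4 + Fintype.card A * (7 + d * 5)) + ((4 + d * 3) +
      ((1 + d * (7 + d * 6)) + ((5 + d * 3) + ((1 + d * 3) + (1 + d * (2 + d * 4))))))) ≤
      50 * (d ^ 2 + Fintype.card A * d) := by
    have h1 : 1 ≤ d := he.dim_pos
    have h2 : Fintype.card A ≤ Fintype.card A * d := Nat.le_mul_of_pos_right _ h1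
    have h3 : d ≤ d ^ 2 := by nlinarith
    nlinarith
  refine Sat.mono (Sat.seq (sat_load he false (by norm_num) (by norm_num) (by norm_num)
    (by norm_num) (by norm_num) (s := x.1) (by simpa using hcur)) ?_) hT fun _ h => h
  rintro σ₁ ⟨hf₁, hv₁⟩
  have g₁ : ∀ i : Fin d, σ₁.real 6 0 i 0 = f i := fun i => by
    rw [hv₁ i i.2, h3, h4, featureOracle_equivFin]
  have he₁ := he.of_frame hf₁ (by simp) (by simp) (by simp) (by simp)
  have h3₁ : σ₁.idx 3 = h := (hf₁.idx 3 (by simp)).trans h3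
  refine Sat.seq (sat_maxNext he₁ ((hf₁.idx 9 (by simp)).trans hr₀.one) hnA
    (hf₁.nxt.trans hnxt)) ?_
  rintro σ₂ ⟨hf₂, hv₂⟩
  have g₂ : σ₂.real 12 0 0 0 = m := by
    rw [h3₁] at hv₂
    split_ifs at hv₂ with hlt
    · refine hv₂.eq_maxOver fun a => ?_
      rw [linQ, if_pos hlt, inner_eq_dotProduct, dotProduct, Finset.sum_range]
      refine Finset.sum_congr rfl fun i _ => ?_
      rw [featureOracle_equivFin, hf₁.real 4 (by simp), hr₀.target _ hlt]
    · rw [hv₂, hm, show linQ H φ st.target (h + 1) x.2.2.2 = fun _ => 0 from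
        funext fun a => by rw [linQ, if_neg hlt], maxOver_zero]
  have he₂ := he₁.of_frame hf₂ (by simp) (by simp) (by simp) (by simp)
  have h3₂ : σ₂.idx 3 = h := (hf₂.idx 3 (by simp)).trans h3₁
  have hF₂ : Mem.Frame [6, 12, 13, 14, 15] [10, 12, 13] σ₀ σ₂ :=
    (hf₁.mono (by simp) (by simp)).trans (hf₂.mono (by simp) (by simp))
  refine Sat.seq (sat_tdError he₂ (h3₂ ▸ hh)) ?_
  rintro σ₃ ⟨hf₃, hv₃⟩
  have g₃ : σ₃.real 9 0 0 0 = x.2.2.1 + m - inner ℝ f (st.theta h) := by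
    rw [hv₃, g₂, hF₂.real 1 (by simp), hrew, hf₂.real 6 (by simp), hF₂.real 2 (by simp), h3₂,
      inner_eq_dotProduct, dotProduct, Finset.sum_range]
    simp only [g₁, hr₀.theta h hh]
  have hF₃ : Mem.Frame [6, 9, 12, 13, 14, 15] [10, 12, 13] σ₀ σ₃ :=
    (hF₂.mono (by simp) (by simp)).trans (hf₃.mono (by simp) (by simp))
  have he₃ := he.of_frame hF₃ (by simp) (by simp) (by simp) (by simp)
  have h3₃ : σ₃.idx 3 = h := (hF₃.idx 3 (by simp)).trans h3
  have h6₃ : σ₃.real 6 = σ₁.real 6 := by rw [hf₃.real 6 (by simp), hf₂.real 6 (by simp)]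
  refine Sat.seq (sat_products he₃ (h3₃ ▸ hh)) ?_
  rintro σ₄ ⟨hf₄, hv₄⟩
  have g₄ : ∀ i : Fin d, σ₄.real 7 0 i 0 = (P *ᵥ f.ofLp) i ∧
      σ₄.real 8 0 i 0 = (f.ofLp ᵥ* P) i := by
    intro i
    rw [(hv₄ i i.2).1, (hv₄ i i.2).2, h3₃, hF₃.real 3 (by simp), h6₃, Finset.sum_range,
      Finset.sum_range]
    simp only [g₁, hr₀.covInv h hh]
    exact ⟨rfl, rfl⟩
  have hF₄ : Mem.Frame [6, 7, 8, 9, 12, 13, 14, 15] [10, 11, 12, 13] σ₀ σ₄ :=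
    (hF₃.mono (by simp) (by simp)).trans (hf₄.mono (by simp) (by simp))
  have he₄ := he.of_frame hF₄ (by simp) (by simp) (by simp) (by simp)
  refine Sat.seq (sat_denominator he₄) ?_
  rintro σ₅ ⟨hf₅, hv₅, hw₅⟩
  have hsum : 1 + ∑ i ∈ Finset.range d, σ₄.real 6 0 i 0 * σ₄.real 7 0 i 0 = 1 + quadForm P f := by
    rw [hf₄.real 6 (by simp), h6₃, Finset.sum_range, quadForm, dotProduct]
    simp only [g₁, g₄]
  rw [hsum] at hv₅ hw₅
  rw [hf₄.real 9 (by simp), g₃] at hw₅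
  have hF₅ : Mem.Frame [6, 7, 8, 9, 10, 12, 13, 14, 15] [10, 11, 12, 13] σ₀ σ₅ :=
    (hF₄.mono (by simp) (by simp)).trans (hf₅.mono (by simp) (by simp))
  have he₅ := he.of_frame hF₅ (by simp) (by simp) (by simp) (by simp)
  have h3₅ : σ₅.idx 3 = h := (hF₅.idx 3 (by simp)).trans h3
  refine Sat.seq (sat_updateTheta he₅ (h3₅ ▸ hh)) ?_
  rintro σ₆ ⟨hf₆, hv₆⟩
  have hF₆ : Mem.Frame [2, 6, 7, 8, 9, 10, 12, 13, 14, 15] [10, 11, 12, 13] σ₀ σ₆ :=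
    (hF₅.mono (by simp) (by simp)).trans (hf₆.mono (by simp) (by simp))
  have he₆ := he.of_frame hF₆ (by simp) (by simp) (by simp) (by simp)
  have h3₆ : σ₆.idx 3 = h := (hF₆.idx 3 (by simp)).trans h3
  refine Sat.mono (sat_updateCovInv he₆ (h3₆ ▸ hh)) le_rfl ?_
  rintro σ₇ ⟨hf₇, hv₇⟩
  have hF₇ : Mem.Frame [2, 3, 6, 7, 8, 9, 10, 12, 13, 14, 15] [10, 11, 12, 13] σ₀ σ₇ :=
    (hF₆.mono (by simp) (by simp)).trans (hf₇.mono (by simp) (by simp))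
  have h7₆ : σ₆.real 7 = σ₄.real 7 := by rw [hf₆.real 7 (by simp), hf₅.real 7 (by simp)]
  have h8₆ : σ₆.real 8 = σ₄.real 8 := by rw [hf₆.real 8 (by simp), hf₅.real 8 (by simp)]
  refine ⟨he.of_frame hF₇ (by simp) (by simp) (by simp) (by simp),
    (hF₇.idx 6 (by simp)).trans hr₀.level, (hF₇.idx 7 (by simp)).trans hr₀.count,
    (hF₇.idx 8 (by simp)).trans hr₀.pow, (hF₇.idx 9 (by simp)).trans hr₀.one,
    ?_, fun g hg i => ?_, fun g hg i j => ?_, fun g hg i => ?_, fun g hg i => ?_⟩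
  · rw [hF₇.real 0 (by simp), hr₀.reg]
  · rw [hf₇.real 2 (by simp), hv₆, h3₅, hF₅.real 2 (by simp), hr₀.theta g hg]
    by_cases hgh : g = h
    · subst hgh
      simp [S3State.update, hw₅, hf₅.real 7 (by simp), g₄]
      rfl
    · simp [S3State.update, hgh]
  · rw [hv₇, h3₆, hF₆.real 3 (by simp), hr₀.covInv g hg]
    by_cases hgh : g = h
    · subst hgh
      simp [S3State.update, Matrix.vecMulVec_apply, h7₆, h8₆, g₄, hf₆.real 10 (by simp), hv₅]
      rw [div_eq_inv_mul]
    · simp [S3State.update, hgh]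
  · rw [hF₇.real 4 (by simp), hr₀.target g hg]; rfl
  · rw [hF₇.real 5 (by simp), hr₀.best g hg]; rfl

end Refinement

/-! ### Specifications of reset, initialization, projection and saving. -/

section LevelSpec

variable {S : Type*} {d nA H : ℕ} {F : ℕ → S → ℕ → ℕ → ℝ}

/-- At the level `l`, the network vanishes and the inverse covariance is `lam⁻¹` times the
identity. -/
def IsResetAt (d : ℕ) (lam : ℝ) (σ : Mem S) (l : ℕ) : Prop :=
  ∀ i < d, σ.real 2 l i 0 = 0 ∧ ∀ j < d, σ.real 3 l i j = if i = j then lam⁻¹ else 0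

/-- The frame protects only whole arrays, so the other levels within the arrays `2` and `3` need the
separate last clause. -/
theorem sat_resetLevel {σ : Mem S} (he : Env d nA H σ) (h6 : σ.idx 6 < H) :
    Sat d H F .resetLevel (3 + d * (4 + d * 2)) σ fun σ' =>
      Mem.Frame [2, 3, 13] [10, 11] σ σ' ∧ IsResetAt d (σ.real 0 0 0 0) σ' (σ.idx 6) ∧
      ∀ g ≠ σ.idx 6, ∀ i j, σ'.real 2 g i j = σ.real 2 g i j ∧
        σ'.real 3 g i j = σ.real 3 g i j := by
  unfold Code.resetLevel
  refine Sat.mono (T := 2 + (1 + d * ((1 + ((1 + d * (1 + 1)) + 1)) + 1)))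
    (Sat.seq (R := fun σ' => Mem.Frame [2, 3, 13] [10, 11] σ σ' ∧
      σ'.real 13 0 0 0 = (σ.real 0 0 0 0)⁻¹ ∧ σ'.real 2 = σ.real 2 ∧ σ'.real 3 = σ.real 3) ?_ ?_)
    (by apply le_of_eq; ring) fun _ h => h
  · refine Sat.block ⟨?_, ?_, ?_, ?_, ?_, ?_⟩
    · simp [Instr.InBounds, Ref.InBounds, he.zero, he.hor_pos, he.dim_pos]
    · simp [Instr.InBounds, Ref.InBounds, Instr.exec, he.zero, he.hor_pos, he.dim_pos]
    · exact (((Mem.Frame.refl _ _ _).set _ (by simp)).tick _ |>.set _ (by simp)).tick _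
    · simp [Instr.exec, Mem.set_real, Mem.get, RealOp.eval, he.zero]
    · ext i j k; simp [Instr.exec, Mem.set_real]
    · ext i j k; simp [Instr.exec, Mem.set_real]
  rintro σ₁ ⟨hf₁, hv₁, h2₁, h3₁⟩
  have he₁ := he.of_frame hf₁ (by simp) (by simp) (by simp) (by simp)
  refine Sat.mono (Sat.loop (n := d) (fun n σ' => Mem.Frame [2, 3, 13] [10, 11] σ σ' ∧
      σ'.real 13 0 0 0 = (σ.real 0 0 0 0)⁻¹ ∧
      (∀ i < n, σ'.real 2 (σ.idx 6) i 0 = 0 ∧ ∀ j < d, σ'.real 3 (σ.idx 6) i j =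
        if i = j then (σ.real 0 0 0 0)⁻¹ else 0) ∧
      ∀ g ≠ σ.idx 6, ∀ i j, σ'.real 2 g i j = σ.real 2 g i j ∧ σ'.real 3 g i j = σ.real 3 g i j)
    (by norm_num) (by norm_num) he₁.dim ⟨hf₁.tick _, hv₁, by simp, by simp [h2₁, h3₁]⟩ ?_)
    le_rfl fun σ' h => ⟨h.1, h.2.2.1, h.2.2.2⟩
  rintro n hn σ₂ ⟨hf₂, hv₂, hrow₂, hoth₂⟩
  set σ₃ := (σ₂.setIdx 10 n).tick {Cell.idx 10, Cell.idx 0} with hσ₃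
  have hf₃ : Mem.Frame [2, 3, 13] [10, 11] σ σ₃ := (hf₂.setIdx _ (by simp)).tick _
  have h10₃ : σ₃.idx 10 = n := by simp [hσ₃]
  have hr₃ : σ₃.real = σ₂.real := rfl
  rw [← hr₃] at hv₂ hrow₂ hoth₂
  clear_value σ₃
  have he₃ := he.of_frame hf₃ (by simp) (by simp) (by simp) (by simp)
  have h6₃ : σ₃.idx 6 = σ.idx 6 := hf₃.idx 6 (by simp)
  refine Sat.seq (R := fun σ' => Mem.Frame [2, 3, 13] [10, 11] σ σ' ∧ σ'.idx 10 = n ∧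
    (∀ i j k, σ'.real 2 i j k = if i = σ.idx 6 ∧ j = n ∧ k = 0 then 0 else σ₃.real 2 i j k) ∧
    σ'.real 3 = σ₃.real 3 ∧ σ'.real 13 = σ₃.real 13) ?_ ?_
  · refine Sat.block ⟨?_, (hf₃.set _ (by simp)).tick _, h10₃, fun i j k => ?_, ?_, ?_⟩
    · simp [Instr.InBounds, Ref.InBounds, he₃.zero, h6₃, h6, h10₃, hn, he.dim_pos]
    · simp [Instr.exec, Mem.set_real, h6₃, h10₃, he₃.zero]
    · ext i j k; simp [Instr.exec, Mem.set_real]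
    · ext i j k; simp [Instr.exec, Mem.set_real]
  rintro σ₄ ⟨hf₄, h10₄, h2₄, h3₄, h13₄⟩
  have he₄ := he.of_frame hf₄ (by simp) (by simp) (by simp) (by simp)
  refine Sat.seq (Sat.loop (n := d) (T := 1) (fun m σ' => Mem.Frame [2, 3, 13] [10, 11] σ σ' ∧
      σ'.idx 10 = n ∧ σ'.real 2 = σ₄.real 2 ∧ σ'.real 13 = σ₃.real 13 ∧
      ∀ i j k, σ'.real 3 i j k =
        if i = σ.idx 6 ∧ j = n ∧ k < m then 0 else σ₃.real 3 i j k)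
    (by norm_num) (by norm_num) he₄.dim
    ⟨hf₄.tick _, h10₄, rfl, h13₄, by simp [h3₄]⟩ ?_) ?_
  · rintro m hm σ₅ ⟨hf₅, h10₅, h2₅, h13₅, h3₅⟩
    have he₅ := he.of_frame hf₅ (by simp) (by simp) (by simp) (by simp)
    have h6₅ : σ₅.idx 6 = σ.idx 6 := hf₅.idx 6 (by simp)
    refine Sat.block ⟨?_, ((hf₅.setIdx _ (by simp)).tick _ |>.set _ (by simp)).tick _,
      by simpa [Instr.exec] using h10₅, ?_, ?_, fun i j k => ?_⟩
    · simp [Instr.InBounds, Ref.InBounds, h6₅, h6, h10₅, hn, hm]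
    · rw [← h2₅]; ext i j k; simp [Instr.exec, Mem.set_real]
    · rw [← h13₅]; ext i j k; simp [Instr.exec, Mem.set_real]
    · simp only [Instr.exec, Mem.tick_real, Mem.set_real, Mem.tick_idx, Mem.setIdx_idx,
        Mem.setIdx_real, h3₅, Int.cast_zero]
      simp only [Function.update_self, ne_eq, show (6 : ℕ) ≠ 11 by norm_num,
        show (10 : ℕ) ≠ 11 by norm_num, not_false_eq_true, Function.update_of_ne, h6₅, h10₅]
      by_cases hi : i = σ.idx 6 <;> by_cases hj : j = n <;> by_cases hk : k = m <;>
        simp [hi, hj, hk]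
      have : k ≤ m ↔ k < m := by omega
      simp [this]
  rintro σ₅ ⟨hf₅, h10₅, h2₅, h13₅, h3₅⟩
  have he₅ := he.of_frame hf₅ (by simp) (by simp) (by simp) (by simp)
  have h6₅ : σ₅.idx 6 = σ.idx 6 := hf₅.idx 6 (by simp)
  -- Row `n` is first filled with zeros and then its diagonal entry is overwritten.
  have key3 : ∀ i j k, (Instr.exec F (.rop .max ⟨3, 6, 10, 10⟩ ⟨13, 5, 5, 5⟩ ⟨13, 5, 5, 5⟩)
      σ₅).real 3 i j k = if i = σ.idx 6 ∧ j = n ∧ k = n then (σ.real 0 0 0 0)⁻¹ else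
        if i = σ.idx 6 ∧ j = n ∧ k < d then 0 else σ₃.real 3 i j k := fun i j k => by
    simp [Instr.exec, Mem.set_real, Mem.get, RealOp.eval, he₅.zero, h6₅, h10₅, h13₅, hv₂, h3₅]
  have key2 : ∀ i j k, (Instr.exec F (.rop .max ⟨3, 6, 10, 10⟩ ⟨13, 5, 5, 5⟩ ⟨13, 5, 5, 5⟩)
      σ₅).real 2 i j k = if i = σ.idx 6 ∧ j = n ∧ k = 0 then 0 else σ₃.real 2 i j k :=
    fun i j k => by simp [Instr.exec, Mem.set_real, h2₅, h2₄]
  refine Sat.block ⟨?_, (hf₅.set _ (by simp)).tick _, ?_, fun i hi => ⟨?_, fun j hj => ?_⟩,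
    fun g hg i j => ⟨?_, ?_⟩⟩
  · simp [Instr.InBounds, Ref.InBounds, h6₅, h6, h10₅, hn, he₅.zero, he.hor_pos, he.dim_pos]
  · simp [Instr.exec, Mem.set_real, h13₅, hv₂]
  · rw [key2]
    by_cases hin : i = n
    · simp [hin]
    · simp [hin, hrow₂ i (by omega)]
  · rw [key3]
    by_cases hin : i = n
    · subst hin
      by_cases hji : j = i
      · simp [hji]
      · simp [hji, hj, Ne.symm hji]
    · simp [hin, (hrow₂ i (by omega)).2 j hj]
  · rw [key2, if_neg (fun h => hg h.1), (hoth₂ g hg i j).1]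
  · rw [key3, if_neg (fun h => hg h.1), if_neg (fun h => hg h.1), (hoth₂ g hg i j).2]

/-- The loop register is the level register itself: it directs the reset, and its last value `H - 1`
is the level at which the first epoch starts. -/
theorem sat_initLevels {σ : Mem S} (he : Env d nA H σ) :
    Sat d H F .initLevels (3 + H * (4 + d * (4 + d * 2))) σ fun σ' =>
      Mem.Frame [2, 3, 13] [6, 8, 9, 10, 11] σ σ' ∧ σ'.idx 6 = H - 1 ∧ σ'.idx 8 = 2 ∧
      σ'.idx 9 = 1 ∧ ∀ g < H, IsResetAt d (σ.real 0 0 0 0) σ' g := by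
  unfold Code.initLevels
  refine Sat.mono (T := 2 + (1 + H * ((3 + d * (4 + d * 2)) + 1)))
    (Sat.seq (R := fun σ' => Mem.Frame [2, 3, 13] [6, 8, 9, 10, 11] σ σ' ∧ σ'.idx 8 = 2 ∧
      σ'.idx 9 = 1) ?_ ?_) (by apply le_of_eq; ring) fun _ h => h
  · refine Sat.block ⟨?_, ?_, ?_, ?_, ?_⟩
    · simp [Instr.InBounds]
    · simp [Instr.InBounds]
    · exact (((Mem.Frame.refl _ _ _).setIdx _ (by simp)).tick _ |>.setIdx _ (by simp)).tick _
    · simp [Instr.exec]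
    · simp [Instr.exec]
  rintro σ₁ ⟨hf₁, h8₁, h9₁⟩
  have he₁ := he.of_frame hf₁ (by simp) (by simp) (by simp) (by simp)
  refine Sat.mono (Sat.loop (n := H) (fun n σ' => Mem.Frame [2, 3, 13] [6, 8, 9, 10, 11] σ σ' ∧
      σ'.idx 8 = 2 ∧ σ'.idx 9 = 1 ∧ (0 < n → σ'.idx 6 = n - 1) ∧
      ∀ g < n, IsResetAt d (σ.real 0 0 0 0) σ' g)
    (by norm_num) (by norm_num) he₁.hor ⟨hf₁.tick _, h8₁, h9₁, by simp, by simp⟩ ?_)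
    le_rfl fun σ' h => ⟨h.1, h.2.2.2.1 he.hor_pos, h.2.1, h.2.2.1, h.2.2.2.2⟩
  rintro n hn σ₂ ⟨hf₂, h8₂, h9₂, -, hv₂⟩
  have hf₃ : Mem.Frame [2, 3, 13] [6, 8, 9, 10, 11] σ
      ((σ₂.setIdx 6 n).tick {Cell.idx 6, Cell.idx 2}) := (hf₂.setIdx _ (by simp)).tick _
  have he₃ := he.of_frame hf₃ (by simp) (by simp) (by simp) (by simp)
  refine Sat.mono (sat_resetLevel he₃ (by simpa using hn)) le_rfl ?_
  rintro σ₄ ⟨hf₄, hv₄, ho₄⟩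
  rw [hf₃.real 0 (by simp)] at hv₄
  simp only [Mem.tick_idx, Mem.setIdx_idx, Function.update_self, Mem.tick_real,
    Mem.setIdx_real] at hv₄ ho₄
  refine ⟨hf₃.trans (hf₄.mono (by simp) (by simp)), ?_, ?_, fun _ => ?_, fun g hg => ?_⟩
  · rw [hf₄.idx 8 (by simp)]; simpa using h8₂
  · rw [hf₄.idx 9 (by simp)]; simpa using h9₂
  · rw [hf₄.idx 6 (by simp)]; simp
  · rcases Nat.lt_succ_iff_lt_or_eq.1 hg with hg | rfl
    · intro i hi
      refine ⟨?_, fun j hj => ?_⟩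
      · rw [(ho₄ g hg.ne i 0).1, (hv₂ g hg i hi).1]
      · rw [(ho₄ g hg.ne i j).2, (hv₂ g hg i hi).2 j hj]
    · exact hv₄

/-- The solver call counts as one instruction, but all matrix and vector cells it touches are
charged to the memory. -/
theorem sat_project {σ : Mem S} (hd : 0 < d) (h6 : σ.idx 6 < H) :
    Sat d H F (.project 2 3 4 6) 1 σ fun σ' => Mem.Frame [4] [] σ σ' ∧
      (∀ i : Fin d, σ'.real 4 (σ.idx 6) i 0 =
        projBall (Matrix.of fun i j : Fin d => σ.real 3 (σ.idx 6) i j)⁻¹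
          (WithLp.toLp 2 fun i : Fin d => σ.real 2 (σ.idx 6) i 0) i) ∧
      ∀ g ≠ σ.idx 6, ∀ i j, σ'.real 4 g i j = σ.real 4 g i j := by
  refine ⟨⟨⟨fun a ha => ?_, fun _ _ => rfl, rfl, rfl⟩, fun i => ?_, fun g hg i j => ?_⟩,
    fun hu => ?_,
    le_rfl⟩
  · ext i j k
    simp only [List.mem_cons, List.not_mem_nil, or_false] at ha
    simp [Code.exec, ha]
  · simp [Code.exec]
  · simp [Code.exec, hg]
  · refine Set.union_subset hu (Set.union_subset (Set.union_subset (by simp) ?_) ?_)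
    · rintro x ⟨i, hi, rfl | rfl⟩ <;> simp [h6, hi, hd]
    · rintro x ⟨i, hi, j, hj, rfl⟩
      simp [h6, hi, hj]

theorem sat_saveTarget {σ : Mem S} (he : Env d nA H σ) :
    Sat d H F .saveTarget (1 + H * (2 + d * 2)) σ fun σ' => Mem.Frame [5] [10, 11] σ σ' ∧
      ∀ g < H, ∀ i < d, σ'.real 5 g i 0 = σ.real 4 g i 0 := by
  unfold Code.saveTarget
  refine Sat.mono (Sat.loop (T := 1 + d * (1 + 1)) (n := H) (fun n σ' =>
      Mem.Frame [5] [10, 11] σ σ' ∧ ∀ g < n, ∀ i < d, σ'.real 5 g i 0 = σ.real 4 g i 0)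
    (by norm_num) (by norm_num) he.hor ⟨(Mem.Frame.refl _ _ _).tick _, by simp⟩ ?_)
    (by apply le_of_eq; ring) fun _ h => h
  rintro n hn σ₁ ⟨hf₁, hv₁⟩
  set σ₂ := (σ₁.setIdx 10 n).tick {Cell.idx 10, Cell.idx 2} with hσ₂
  have hf₂ : Mem.Frame [5] [10, 11] σ σ₂ := (hf₁.setIdx _ (by simp)).tick _
  have h10 : σ₂.idx 10 = n := by simp [hσ₂]
  have he₂ := he.of_frame hf₂ (by simp) (by simp) (by simp) (by simp)
  refine Sat.mono (Sat.loop (T := 1) (n := d) (fun m σ' => Mem.Frame [5] [10, 11] σ σ' ∧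
      σ'.idx 10 = n ∧ (∀ g < n, ∀ i < d, σ'.real 5 g i 0 = σ.real 4 g i 0) ∧
      ∀ i < m, σ'.real 5 n i 0 = σ.real 4 n i 0)
    (by norm_num) (by norm_num) he₂.dim ⟨hf₂.tick _, h10, hv₁, by simp⟩ ?_) le_rfl
    fun σ' h => ⟨h.1, fun g hg i hi => ?_⟩
  · rintro m hm σ₃ ⟨hf₃, h10₃, hv₃, hw₃⟩
    have he₃ := he.of_frame hf₃ (by simp) (by simp) (by simp) (by simp)
    have h4 : σ₃.real 4 = σ.real 4 := hf₃.real 4 (by simp)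
    refine Sat.block ⟨?_, ((hf₃.setIdx _ (by simp)).tick _ |>.set _ (by simp)).tick _,
      by simpa [Instr.exec] using h10₃, fun g hg i hi => ?_, fun i hi => ?_⟩
    · simp [Instr.InBounds, Ref.InBounds, h10₃, hn, hm, he₃.zero, he.dim_pos]
    · simp [Instr.exec, Mem.set_real, h10₃, hg.ne, hv₃ g hg i hi]
    · by_cases him : i = m
      · simp [Instr.exec, Mem.set_real, Mem.get, RealOp.eval, h10₃, he₃.zero, him, h4]
      · simp [Instr.exec, Mem.set_real, h10₃, him, hw₃ i (by omega)]
  · rcases Nat.lt_succ_iff_lt_or_eq.1 hg with hg | rfl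
    · exact h.2.2.1 g hg i hi
    · exact h.2.2.2 i hi

end LevelSpec

/-! ### Simulation of whole runs. -/

section Simulation

variable {S A : Type*} {d nA H : ℕ} {lam : ℝ} {F : ℕ → S → ℕ → ℕ → ℝ}

/-- The memory before the first trajectory. -/
structure IsBlank (d nA H : ℕ) (lam : ℝ) (σ : Mem S) : Prop where
  env : Env d nA H σ
  count : σ.idx 7 = 0
  pow : σ.idx 8 = 0
  reg : σ.real 0 0 0 0 = lam
  target : ∀ h i, σ.real 4 h i 0 = 0
  best : ∀ h i, σ.real 5 h i 0 = 0

/-- The memory holds the variables of the algorithm, or it is blank and they are the initial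
ones. -/
def RepresentsOrBlank (nA H : ℕ) (lam : ℝ) (σ : Mem S) (st : S3State d) : Prop :=
  Represents nA H lam σ st ∨ (IsBlank d nA H lam σ ∧ st = S3State.start d H lam)

theorem Represents.sat_resetLevel {σ : Mem S} {st : S3State d} (hr : Represents nA H lam σ st)
    (hl : st.level < H) :
    Sat d H F .resetLevel (3 + d * (4 + d * 2)) σ fun σ' =>
      Represents nA H lam σ' (S3State.reset lam st) := by
  refine Sat.mono (_root_.sat_resetLevel hr.env (hr.level ▸ hl)) le_rfl ?_
  rintro σ' ⟨hf, hv, ho⟩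
  rw [hr.level, hr.reg] at hv
  rw [hr.level] at ho
  refine ⟨hr.env.of_frame hf (by simp) (by simp) (by simp) (by simp),
    (hf.idx 6 (by simp)).trans hr.level, (hf.idx 7 (by simp)).trans hr.count,
    (hf.idx 8 (by simp)).trans hr.pow, (hf.idx 9 (by simp)).trans hr.one, ?_,
    fun g hg i => ?_, fun g hg i j => ?_, fun g hg i => ?_, fun g hg i => ?_⟩
  · rw [hf.real 0 (by simp), hr.reg]
  · by_cases hgl : g = st.level
    · subst hgl
      simp [S3State.reset, (hv i i.2).1]
    · rw [(ho g hgl i 0).1, hr.theta g hg]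
      simp [S3State.reset, hgl]
  · by_cases hgl : g = st.level
    · subst hgl
      simp [S3State.reset, (hv i i.2).2 j j.2, Matrix.one_apply, Fin.ext_iff]
    · rw [(ho g hgl i j).2, hr.covInv g hg]
      simp [S3State.reset, hgl]
  · rw [hf.real 4 (by simp), hr.target g hg]; rfl
  · rw [hf.real 5 (by simp), hr.best g hg]; rfl

theorem IsBlank.sat_initLevels {σ : Mem S} (hb : IsBlank d nA H lam σ) :
    Sat d H F .initLevels (3 + H * (4 + d * (4 + d * 2))) σ fun σ' =>
      Represents nA H lam σ' (S3State.start d H lam) := by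
  refine Sat.mono (_root_.sat_initLevels hb.env) le_rfl ?_
  rintro σ' ⟨hf, h6, h8, h9, hv⟩
  rw [hb.reg] at hv
  refine ⟨hb.env.of_frame hf (by simp) (by simp) (by simp) (by simp), h6,
    (hf.idx 7 (by simp)).trans hb.count, h8, h9, ?_,
    fun g hg i => (hv g hg i i.2).1, fun g hg i j => ?_, fun g hg i => ?_, fun g hg i => ?_⟩
  · rw [hf.real 0 (by simp), hb.reg]
  · rw [(hv g hg i i.2).2 j j.2]
    simp [S3State.start, Matrix.one_apply, Fin.ext_iff]
  · rw [hf.real 4 (by simp), hb.target]; rfl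
  · rw [hf.real 5 (by simp), hb.best]; rfl

/-- Register `8` holds a power of two once the memory is initialized, so its vanishing detects the
blank memory. The time is left existential, since only time steps have a claimed bound. -/
theorem RepresentsOrBlank.sat_beginTrajectory {σ : Mem S} {st : S3State d}
    (hr : RepresentsOrBlank nA H lam σ st) (hl : st.level < H) :
    ∃ T, Sat d H F .beginTrajectory T σ fun σ' =>
      Represents nA H lam σ' (if st.count = 0 then S3State.reset lam st else st) := by
  refine ⟨_, Sat.seq (R := fun σ' => Represents nA H lam σ' st)
    (Sat.ifLt (by norm_num) (by norm_num)
    (T := 3 + H * (4 + d * (4 + d * 2))) (fun h => ?_) fun h => ?_) fun σ' hr' =>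
    Sat.ifLt (T := 3 + d * (4 + d * 2)) (by norm_num) (by norm_num) (fun h => ?_) fun h => ?_⟩
  · rcases hr with hr | ⟨hb, -⟩
    · exact Sat.mono (Sat.skip ⟨hr.env.of_frame ((Mem.Frame.refl [] [] _).tick _) (by simp)
        (by simp) (by simp) (by simp), hr.2, hr.3, hr.4, hr.5, hr.6, hr.7, hr.8, hr.9, hr.10⟩)
        (Nat.zero_le _) fun _ h => h
    · rw [hb.pow] at h; omega
  · rcases hr with hr | ⟨hb, rfl⟩
    · rw [hr.env.zero, hr.pow] at h
      exact absurd (by positivity) h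
    · exact IsBlank.sat_initLevels ⟨hb.env.of_frame ((Mem.Frame.refl [] [] _).tick _) (by simp)
        (by simp) (by simp) (by simp), hb.2, hb.3, hb.4, hb.5, hb.6⟩
  all_goals
    rw [hr'.env.zero, hr'.count] at h
    have ht : Represents nA H lam (σ'.tick {Cell.idx 5, Cell.idx 7}) st :=
      ⟨hr'.env.of_frame ((Mem.Frame.refl [] [] _).tick _) (by simp) (by simp)
        (by simp) (by simp), hr'.2, hr'.3, hr'.4, hr'.5, hr'.6, hr'.7, hr'.8, hr'.9, hr'.10⟩
  · rw [if_neg h.ne']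
    exact Sat.mono (Sat.skip ht) (Nat.zero_le _) fun _ h => h
  · rw [if_pos (by omega)]
    exact ht.sat_resetLevel hl

/-- The branches follow those of `S3State.finish`; doubling register `8` tracks the batch size of
the next epoch, so no power is ever computed. -/
theorem Represents.sat_endTrajectory {σ : Mem S} {st : S3State d} (hr : Represents nA H lam σ st)
    (hl : st.level < H) :
    ∃ T, Sat d H F .endTrajectory T σ fun σ' =>
      Represents nA H lam σ' (S3State.finish H st) := by
  set θ := projBall (st.covInv st.level)⁻¹ (st.theta st.level) with hθ
  have he := hr.env
  refine ⟨_, Sat.seq (T₁ := 1) (T₂ := 1 + (1 + (1 + (1 + (3 + H * (2 + d * 2))))))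
    (R := fun σ' => Mem.Frame [] [7] σ σ' ∧ σ'.idx 7 = st.count + 1) ?_ ?_⟩
  · refine Sat.block ⟨?_, ((Mem.Frame.refl _ _ _).setIdx _ (by simp)).tick _, ?_⟩
    · simp [Instr.InBounds]
    · simp [Instr.exec, hr.count, hr.one]
  rintro σ₁ ⟨hf₁, h7₁⟩
  have he₁ := he.of_frame hf₁ (by simp) (by simp) (by simp) (by simp)
  have h8₁ : σ₁.idx 8 = 2 ^ (st.epochs + 1) := (hf₁.idx 8 (by simp)).trans hr.pow
  refine Sat.ifLt (by norm_num) (by norm_num) (fun h => ?_) fun h => ?_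
  · rw [h7₁, h8₁] at h
    rw [S3State.finish, if_pos h]
    have hf := hf₁.tick {Cell.idx 7, Cell.idx 8}
    refine Sat.mono (Sat.skip ?_) (Nat.zero_le _) fun _ h => h
    exact ⟨he.of_frame hf (by simp) (by simp) (by simp) (by simp),
      (hf.idx 6 (by simp)).trans hr.level, h7₁, h8₁, (hf.idx 9 (by simp)).trans hr.one,
      by rw [hf.real 0 (by simp)]; exact hr.reg,
      by rw [hf.real 2 (by simp)]; exact hr.theta,
      by rw [hf.real 3 (by simp)]; exact hr.covInv,
      by rw [hf.real 4 (by simp)]; exact hr.target,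
      by rw [hf.real 5 (by simp)]; exact hr.best⟩
  rw [h7₁, h8₁] at h
  rw [S3State.finish, if_neg h, ← hθ]
  refine Sat.seq (R := fun σ' => Mem.Frame [] [7] σ σ' ∧ σ'.idx 7 = 0) ?_ ?_
  · refine Sat.block ⟨?_, ((hf₁.tick _).setIdx _ (by simp)).tick _, ?_⟩
    · simp [Instr.InBounds]
    · simp [Instr.exec]
  rintro σ₂ ⟨hf₂, h7₂⟩
  have h6₂ : σ₂.idx 6 = st.level := (hf₂.idx 6 (by simp)).trans hr.level
  refine Sat.seq (sat_project he.dim_pos (h6₂ ▸ hl)) ?_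
  rintro σ₃ ⟨hf₃, hv₃, ho₃⟩
  rw [h6₂] at hv₃ ho₃
  have hF₃ : Mem.Frame [4] [7] σ σ₃ :=
    (hf₂.mono (by simp) (by simp)).trans (hf₃.mono (by simp) (by simp))
  have h7₃ : σ₃.idx 7 = 0 := (hf₃.idx 7 (by simp)).trans h7₂
  have ht₃ : ∀ g < H, ∀ i : Fin d, σ₃.real 4 g i 0 = Function.update st.target st.level θ g i := by
    intro g hg i
    by_cases hgl : g = st.level
    · subst hgl
      have hP : (Matrix.of fun i j : Fin d => σ₂.real 3 st.level i j) = st.covInv st.level := by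
        ext i j
        rw [Matrix.of_apply, hf₂.real 3 (by simp), hr.covInv _ hl]
      have hw : (WithLp.toLp 2 fun i : Fin d => σ₂.real 2 st.level i 0) = st.theta st.level := by
        ext i
        rw [hf₂.real 2 (by simp)]
        exact hr.theta _ hl i
      rw [hv₃, hP, hw, Function.update_self]
    · rw [ho₃ g hgl, hf₂.real 4 (by simp), hr.target g hg, Function.update_of_ne hgl]
  have he₃ := he.of_frame hF₃ (by simp) (by simp) (by simp) (by simp)
  refine Sat.ifLt (by norm_num) (by norm_num) (fun h0 => ?_) fun h0 => ?_
  · rw [he₃.zero, hF₃.idx 6 (by simp), hr.level] at h0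
    rw [if_neg h0.ne']
    have hf : Mem.Frame [4] [6, 7] σ ((σ₃.tick {Cell.idx 5, Cell.idx 6})) :=
      (hF₃.tick _).mono (by simp) (by simp)
    refine Sat.mono (T := 1) (Sat.block ⟨?_, ?_⟩) (by omega) fun _ h => h
    · simp [Instr.InBounds]
    · have hf' := (hf.setIdx (x := 6) (σ₃.idx 6 - σ₃.idx 9) (by simp)).tick
        {Cell.idx 6, Cell.idx 6, Cell.idx 9}
      refine ⟨he.of_frame hf' (by simp) (by simp) (by simp) (by simp), ?_, h7₃,
        (hf'.idx 8 (by simp)).trans hr.pow, (hf'.idx 9 (by simp)).trans hr.one,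
        ?_, ?_, ?_, ht₃, ?_⟩
      · simp [Instr.exec, hF₃.idx 6 (by simp), hF₃.idx 9 (by simp), hr.level, hr.one]
      · exact (congr_fun (congr_fun (congr_fun (hF₃.real 0 (by simp)) 0) 0) 0).trans hr.reg
      · intro g hg i
        exact (congr_fun (congr_fun (congr_fun (hF₃.real 2 (by simp)) g) i) 0).trans
          (hr.theta g hg i)
      · intro g hg i j
        exact (congr_fun (congr_fun (congr_fun (hF₃.real 3 (by simp)) g) i) j).trans
          (hr.covInv g hg i j)
      · intro g hg i
        exact (congr_fun (congr_fun (congr_fun (hF₃.real 5 (by simp)) g) i) 0).trans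
          (hr.best g hg i)
  · rw [he₃.zero, hF₃.idx 6 (by simp), hr.level] at h0
    rw [if_pos (by omega)]
    refine Sat.mono (T := 2 + (1 + H * (2 + d * 2))) (Sat.seq (R := fun σ' =>
      Mem.Frame [4] [6, 7, 8] σ σ' ∧ σ'.idx 6 = H - 1 ∧ σ'.idx 7 = 0 ∧
      σ'.idx 8 = 2 ^ (st.epochs + 1 + 1) ∧ σ'.real 4 = σ₃.real 4) ?_ ?_) (by omega) fun _ h => h
    · refine Sat.block ⟨?_, ?_, ?_, ?_, ?_, ?_, rfl⟩
      · simp [Instr.InBounds]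
      · simp [Instr.InBounds]
      · exact ((((hF₃.mono (by simp) (by simp)).tick _).setIdx _ (by simp)).tick _ |>.setIdx _
          (by simp)).tick _
      · simp [Instr.exec, he₃.hor, hF₃.idx 9 (by simp), hr.one]
      · simp [Instr.exec, h7₃]
      · simp [Instr.exec, hF₃.idx 8 (by simp), hr.pow]
        ring
    rintro σ₄ ⟨hf₄, h6₄, h7₄, h8₄, h4₄⟩
    have he₄ := he.of_frame hf₄ (by simp) (by simp) (by simp) (by simp)
    refine Sat.mono (sat_saveTarget he₄) le_rfl ?_
    rintro σ₅ ⟨hf₅, hv₅⟩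
    have hF₅ : Mem.Frame [4, 5] [6, 7, 8, 10, 11] σ σ₅ :=
      (hf₄.mono (by simp) (by simp)).trans (hf₅.mono (by simp) (by simp))
    refine ⟨he.of_frame hF₅ (by simp) (by simp) (by simp) (by simp),
      (hf₅.idx 6 (by simp)).trans h6₄, (hf₅.idx 7 (by simp)).trans h7₄,
      (hf₅.idx 8 (by simp)).trans h8₄, (hF₅.idx 9 (by simp)).trans hr.one,
      by rw [hF₅.real 0 (by simp)]; exact hr.reg,
      by rw [hF₅.real 2 (by simp)]; exact hr.theta,
      by rw [hF₅.real 3 (by simp)]; exact hr.covInv,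
      by rw [hf₅.real 4 (by simp), h4₄]; exact ht₃,
      fun g hg i => ?_⟩
    rw [hv₅ g hg i i.2, h4₄]
    exact ht₃ g hg i

variable [Fintype A]

/-- The program for the algorithm. -/
def s3Program : Program where
  pre := .beginTrajectory
  step := .timeStep
  post := .endTrajectory
  out := 5

theorem solverFree_s3Program : s3Program.step.SolverFree := by
  simp [s3Program, Code.timeStep, Code.maxNext, Code.tdError, Code.products, Code.denominator,
    Code.updateTheta, Code.updateCovInv, Code.load, Code.dot, Code.block, Code.SolverFree]

theorem deliver_used_subset {σ : Mem S} (hd : 1 ≤ d) (hH : 1 ≤ H)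
    (hu : σ.used ⊆ allowedCells d H) (h : ℕ) (x : Step S A) :
    (Program.deliver h x σ).used ⊆ allowedCells d H := by
  refine Set.union_subset hu ?_
  simp only [Set.insert_subset_iff, Set.singleton_subset_iff]
  simp
  omega

variable [Nonempty A]

/-- After `n` time steps the memory represents the fold over the first `n` stages. The bound on the
accessed cells is carried along because a triple only preserves it. -/
theorem sat_steps (φ : Feature S A d) (hd : 1 ≤ d) (hH : 1 ≤ H) (τ : Fin H → Step S A)
    {σ : Mem S} {st : S3State d} (hr : RepresentsOrBlank (Fintype.card A) H lam σ st)
    (hl : st.level < H) (hu : σ.used ⊆ allowedCells d H) :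
    ∀ n ≤ H, Represents (Fintype.card A) H lam (s3Program.steps φ τ σ n)
        (((List.finRange H).take n).foldl
          (fun (st : S3State d) (h : Fin H) => S3State.update H φ h (τ h) st)
          (if st.count = 0 then S3State.reset lam st else st)) ∧
      (s3Program.steps φ τ σ n).used ⊆ allowedCells d H := by
  intro n
  induction n with
  | zero =>
    intro _
    obtain ⟨T, h⟩ := hr.sat_beginTrajectory (F := Program.featureOracle φ) hl
    simpa using ⟨h.1, h.2.1 hu⟩
  | succ n ih =>
    intro hn
    obtain ⟨i1, i2⟩ := ih (by omega)
    have h := i1.sat_timeStep φ (h := n) (by omega) (τ ⟨n, by omega⟩)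
    rw [List.take_succ_eq_append_getElem (by simpa using hn), List.foldl_append, Program.steps,
      dif_pos (by omega)]
    exact ⟨by simpa [s3Program] using h.1, h.2.1 (deliver_used_subset hd hH i2 _ _)⟩

/-- That the level stays below `H`, needed for the addresses, comes from the invariant of the
algorithm rather than from the program. -/
theorem sat_run (φ : Feature S A d) (hd : 1 ≤ d) (hH : 1 ≤ H) (hlam : 0 < lam)
    (τ : ℕ → Fin H → Step S A) (K : ℕ) :
    RepresentsOrBlank (Fintype.card A) H lam (s3Program.run φ lam τ K) (S3State.run φ lam τ K) ∧
      (s3Program.run φ lam τ K).used ⊆ allowedCells d H := by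
  induction K with
  | zero =>
    -- The boot memory has zeros where the algorithm has the inverse covariances and the batch size,
    -- so it is blank rather than a representation.
    refine ⟨Or.inr ⟨⟨⟨rfl, rfl, rfl, rfl, hd, hH⟩, rfl, rfl, ?_, ?_, ?_⟩, rfl⟩, ?_⟩
    · simp [Program.run, Program.boot]
    · simp [Program.run, Program.boot]
    · simp [Program.run, Program.boot]
    · simp only [Program.run, Program.boot, Set.insert_subset_iff, Set.singleton_subset_iff]
      simp
      omega
  | succ K ih =>
    have hl := (S3State.invariant_run (φ := φ) hlam hH τ K).level_lt
    obtain ⟨h1, h2⟩ := sat_steps φ hd hH (τ K) ih.1 hl ih.2 H le_rfl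
    rw [List.take_of_length_le (by simp)] at h1
    obtain ⟨T, h⟩ := h1.sat_endTrajectory (F := Program.featureOracle φ) (by
      rw [(S3State.foldl_update H φ (τ K) _ (List.nodup_finRange H) _).1.2.1]
      split_ifs <;> exact hl)
    exact ⟨Or.inl h.1, h.2.1 h2⟩

theorem s3Program_complexity (φ : Feature S A d) (lam : ℝ) (τ : ℕ → Fin H → Step S A) (hd : 1 ≤ d)
    (hH : 1 ≤ H) (hlam : 0 < lam) (K : ℕ) :
    (∀ (h : ℕ) (i : Fin d), h < H →
      (s3Program.run φ lam τ K).real s3Program.out h i 0 = (S3State.run φ lam τ K).best h i) ∧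
    (s3Program.run φ lam τ K).used.encard ≤ (50 * (d ^ 2 * H) : ℕ) ∧
    ∀ n < H,
      (s3Program.steps φ (τ K) (s3Program.run φ lam τ K) (n + 1)).time ≤
        (s3Program.steps φ (τ K) (s3Program.run φ lam τ K) n).time +
          50 * (d ^ 2 + Fintype.card A * d) := by
  obtain ⟨h1, h2⟩ := sat_run φ hd hH hlam τ K
  refine ⟨fun h i hh => ?_, ?_, fun n hn => ?_⟩
  -- In the blank case the output array is still zero, which agrees with the initial predictor.
  · rcases h1 with h1 | ⟨hb, he⟩
    · exact h1.best h hh i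
    · rw [he]
      exact hb.best h i
  · refine (Set.encard_le_encard h2).trans ((encard_allowedCells_le hd hH).trans ?_)
    exact_mod_cast Nat.mul_le_mul_right _ (by norm_num)
  · have hl := (S3State.invariant_run (φ := φ) hlam hH τ K).level_lt
    obtain ⟨i1, -⟩ := sat_steps φ hd hH (τ K) h1 hl h2 n hn.le
    have h := (i1.sat_timeStep φ hn (τ K ⟨n, hn⟩)).2.2
    rw [Program.steps, dif_pos hn]
    exact h

end Simulation

theorem theorem2 :
    -- performance, with a universal constant `c`
    (∃ c : ℝ, 0 < c ∧
      ∀ {S A Ω : Type*} [MeasurableSpace S] [MeasurableSpace A] [DiscreteMeasurableSpace A]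
        [Fintype A] [Nonempty A] [MeasurableSpace Ω]
        (M : MDP S A) (d : ℕ) (φ : Feature S A d) (κ : ℕ → Kernel S A)
        (fit : ℕ → (S → A → ℝ) → EuclideanSpace ℝ (Fin d)) (lam ε δ : ℝ)
        (P : Measure Ω) (X : ℕ → Ω → Fin M.H → Step S A),
        1 ≤ M.H → 1 ≤ d → 0 < lam → 0 < δ → δ < 1 →
        M.BoundedRewards →
        (∀ h < M.H, ∀ a, Measurable fun s => φ h s a) → (∀ h < M.H, ∀ s a, ‖φ h s a‖ ≤ 1) →
        (∀ h, IsMarkovKernel (κ h)) →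
        M.IsBestFitRule φ κ fit → M.Misspecified φ fit ε →
        IsProbabilityMeasure P →
        -- independent trajectories of the controller `κ`
        (∀ k, Measurable (X k)) → (∀ k, P.map (X k) = M.trajLaw κ) → iIndepFun X P →
        ∃ E : Set Ω, MeasurableSet E ∧ ENNReal.ofReal (1 - δ) ≤ P E ∧
          ∀ ω ∈ E, ∀ K : ℕ, 2 * M.H < K →
            let st : S3State d := S3State.run φ lam (fun k => X k ω) K
            let Q : ℕ → S → A → ℝ := linQ M.H φ st.best
            let U : ℕ → S → A → ℝ := uncertainty M φ κ lam c δ K st.epochs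
            (∀ h < M.H, ‖st.best h‖ ≤ 1) ∧
            (∀ h < M.H, ∀ s a,
              |(Q h s a - M.bellman h (Q (h + 1)) s a) +
                (M.bellman h (Q (h + 1)) s a - inner ℝ (φ h s a) (fit h (Q (h + 1))))|
                ≤ U h s a) ∧
            ∀ greedy opt : Policy S A,
              (∀ h < M.H, ∀ s a, Q h s a ≤ Q h s (greedy.act h s)) → M.IsOptimal opt →
              -M.expSum opt.kernel U - ε ≤ ∫ s, (maxOver (Q 0 s) - M.optValue 0 s) ∂M.start ∧
              ∫ s, (maxOver (Q 0 s) - M.optValue 0 s) ∂M.start ≤ M.expSum greedy.kernel U + ε) ∧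
    -- memory and computation, with one program for all instances
    (∃ (P : Program) (C : ℕ), P.step.SolverFree ∧
      ∀ {S A : Type*} [Fintype A] [Nonempty A] (d H : ℕ) (φ : Feature S A d) (lam : ℝ)
        (τ : ℕ → Fin H → Step S A), 1 ≤ d → 1 ≤ H → 0 < lam →
        ∀ K : ℕ,
          (∀ (h : ℕ) (i : Fin d), h < H →
            (P.run φ lam τ K).real P.out h i 0 = (S3State.run φ lam τ K).best h i) ∧
          (P.run φ lam τ K).used.encard ≤ (C * (d ^ 2 * H) : ℕ) ∧
          ∀ n < H,
            (P.steps φ (τ K) (P.run φ lam τ K) (n + 1)).time ≤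
              (P.steps φ (τ K) (P.run φ lam τ K) n).time + C * (d ^ 2 + Fintype.card A * d)) := by
  refine ⟨⟨67, by norm_num, ?_⟩, ?_⟩
  · intro S A Ω _ _ _ _ _ _ M d φ κ fit lam ε δ P X hH hd hlam hδ hδ1 hM hφ hφ1 hκ hfit hmis hP hX
      hlaw hind
    exact performance_guarantee M d φ κ fit lam ε δ P X hH hd hlam hδ hδ1 hM hφ hφ1 hκ hfit hmis hP
      hX hlaw hind
  · exact ⟨s3Program, 50, solverFree_s3Program, fun d H φ lam τ hd hH hlam K =>
      s3Program_complexity φ lam τ hd hH hlam K⟩
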